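/- **Setting.** Let $\Omega\subset\mathbb R^3$ be a domain, $T>0$, and let $\mathbf w$ be a smooth ($C^2$ suffices) velocity field on $\Omega\times[0,T]$. Let $\Gamma_0\subset\Omega$ be a closed (compact, without boundary), connected hypersurface of $\mathbb R^3$, smooth ($C^2$ suffices), transported by $\mathbf w$: for each $y\in\Gamma_0$ there is a particle path $\Phi(y,\cdot):[0,T]\to\Omega$ with $\Phi(y,0)=y$, $\partial_t\Phi(y,t)=\mathbf w(\Phi(y,t),t)$, and $\Gamma(t)=\Phi(\Gamma_0,t)$. Put $\mathcal G=\bigcup_{t\in(0,T]}\Gamma(t)\times\{t\}$, $(u,v)_0=\int_0^T\int_{\Gamma(t)}uv\,ds\,dt$, $\|u\|_0^2=(u,u)_0$ and $\|u\|_H^2=\|u\|_0^2+\|\nabla_\Gamma u\|_0^2$, where $\nabla_\Gamma$ is the tangential gradient on $\Gamma(t)$. Let $\bar u(t)=\int_{\Gamma(t)}u\,ds$, let $\dot u=\partial_tu+\mathbf w\cdot\nabla u$ be the material derivative (the derivative along particle paths), and let $\operatorname{div}_\Gamma\mathbf w=\operatorname{tr}((I-\mathbf n\mathbf n^T)\nabla\mathbf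 w)$, with $\mathbf n$ a unit normal on $\Gamma(t)$. **Discretization.** Let $N\ge1$, $t_n=nT/N$, $I_n=(t_{n-1},t_n]$, and for $n=1,\dots,N$ let $\mathcal T_n$ be a tetrahedral triangulation of $\Omega$, with $V_n$ the space of continuous piecewise affine functions on $\mathcal T_n$. Let $Q^{\mathcal G}$ be the union of the prisms $K\times I_n$ ($K\in\mathcal T_n$, $1\le n\le N$) whose intersection with $\mathcal G$ has positive three-dimensional measure. Let $V_h$ be the space of functions $v:Q^{\mathcal G}\to\mathbb R$ that on each $Q^{\mathcal G}\cap(\mathbb R^3\times I_n)$, with prisms from $\mathcal T_n$, have the form $v(x,t)=\phi_0(x)+t\,\phi_1(x)$ with $\phi_0,\phi_1\in V_n$, and let $W_h=\{v|_{\mathcal G}: v\in V_h\}$. For $u\in W_h$ let $u^n_\pm$ be the one-sided limits of $u$ on $\Gamma(t_n)$ from later ($+$) and earlier ($-$) times, $[u]^n=u^n_+-u^n_-$ for $1\le n\le N-1$, and $[u]^0=u^0_+$. Let $(\psi,\phi)_{t_n}=\int_{\Gamma(t_n)}\psi\phi\,ds$, with norm $\|\cdot\|_{t_n}$. For a diffusion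 coefficient $\nu_d>0$ and $\sigma\ge0$ put $$\langle\dot u,v\rangle_b=\sum_{n=1}^N\int_{t_{n-1}}^{t_n}\int_{\Gamma(t)}\dot u\,v\,ds\,dt,\qquad d(u,v)=\sum_{n=1}^N([u]^{n-1},v_+^{n-1})_{t_{n-1}},$$ $$a_\sigma(u,v)=\nu_d(\nabla_\Gamma u,\nabla_\Gamma v)_0+(\operatorname{div}_\Gamma\mathbf w\,u,v)_0+\sigma\int_0^T\bar u(t)\bar v(t)\,dt,$$ $$|||u|||_h=\Big(\max_{1\le n\le N}\|u^n_-\|_{t_n}^2+\sum_{n=1}^N\|[u]^{n-1}\|_{t_{n-1}}^2+\|u\|_H^2\Big)^{1/2}.$$ **Assumptions.** For $t\in[0,T]$ let $c_F(t)>0$ be a constant in the Friedrichs inequality $$\int_{\Gamma(t)}|\nabla_\Gamma g|^2\,ds\ \ge\ c_F(t)\int_{\Gamma(t)}\Big(g-\frac1{|\Gamma(t)|}\int_{\Gamma(t)}g\,ds\Big)^2ds$$ (for all Lipschitz $g$ on $\Gamma(t)$, equivalently all $g\in H^1(\Gamma(t))$). Assume that there is a $c_0>0$ with $$\operatorname{div}_\Gamma\mathbf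 w(x,t)+\nu_d\,c_F(t)\ge c_0\qquad\text{for all }x\in\Gamma(t),\ t\in[0,T],$$ and that $\sigma\ge\frac{\nu_d}2\,\frac{c_F(t)}{|\Gamma(t)|}$ for all $t\in[0,T]$. **Proposition 4.3 (discrete well-posedness).** For every $f\in L^2(\mathcal G)$ there is exactly one $u_h\in W_h$ with $$\langle\dot u_h,v_h\rangle_b+a_\sigma(u_h,v_h)+d(u_h,v_h)=(f,v_h)_0\qquad\text{for all }v_h\in W_h,$$ and it satisfies $|||u_h|||_h\le c_s^{-1}\|f\|_0$ with $c_s=\frac14\min\{1,\nu_d,c_0\}$. -/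

import Mathlib

open MeasureTheory Set Filter Topology

noncomputable section

/-- Three-dimensional Euclidean space. -/
abbrev E3 : Type := EuclideanSpace ℝ (Fin 3)

/-- A closed (compact, without boundary), connected, embedded hypersurface of `ℝ³`, of class `C²`:
near each of its points it is the zero set of a `C²` function with nonvanishing differential. -/
structure IsClosedSurface (Γ : Set E3) : Prop where
  isCompact : IsCompact Γ
  isConnected : IsConnected Γ
  regular : ∀ x ∈ Γ, ∃ U : Set E3, IsOpen U ∧ x ∈ U ∧ ∃ φ : E3 → ℝ,
    ContDiffOn ℝ 2 φ U ∧ (∀ y ∈ U, fderiv ℝ φ y ≠ 0) ∧ Γ ∩ U = {y ∈ U | φ y = 0}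

/-- The orthogonal projection `I - n nᵀ` onto the tangent plane of the hypersurface `Γ` at `x`. -/
def tangentProj (Γ : Set E3) (x : E3) : E3 →L[ℝ] E3 :=
  (Submodule.span ℝ (tangentConeAt ℝ Γ x)).starProjection

/-- The tangential gradient at `x` of a function `g` on `Γ`. A derivative of `g` within `Γ` is
determined by the values of `g` on `Γ` up to a multiple of the normal, which the projection
removes. -/
def tangentGrad (Γ : Set E3) (g : E3 → ℝ) (x : E3) : E3 :=
  tangentProj Γ x (gradientWithin g Γ x)

/-- The surface divergence `tr ((I - n nᵀ) ∇F)` at `x` of a vector field `F` on `ℝ³`. -/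
def surfaceDiv (Γ : Set E3) (F : E3 → E3) (x : E3) : ℝ :=
  LinearMap.trace ℝ E3 (tangentProj Γ x ∘L fderiv ℝ F x).toLinearMap

/-- The surface integral `∫_Γ g ds` (with respect to the two-dimensional Hausdorff measure,
normalized to agree with area). -/
def surfaceIntegral (Γ : Set E3) (g : E3 → ℝ) : ℝ :=
  ∫ x in Γ, g x ∂(μHE[2] : Measure E3)

/-- The area `|Γ|`. -/
def surfaceArea (Γ : Set E3) : ℝ :=
  (μHE[2] : Measure E3).real Γ

/-- `c` is a constant in the Friedrichs inequality on `Γ`: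
`∫_Γ |∇_Γ g|² ds ≥ c ∫_Γ (g - |Γ|⁻¹ ∫_Γ g ds)² ds`. The inequality is required for Lipschitz
functions `g` only; these are dense in `H¹(Γ)`. -/
def IsFriedrichsConstant (Γ : Set E3) (c : ℝ) : Prop :=
  ∀ g : E3 → ℝ, (∃ K, LipschitzOnWith K g Γ) →
    c * surfaceIntegral Γ (fun x => (g x - 1 / surfaceArea Γ * surfaceIntegral Γ g) ^ 2) ≤
      surfaceIntegral Γ (fun x => ‖tangentGrad Γ g x‖ ^ 2)

/-- A closed surface `Γ₀`, passively advected over the time interval `[0, T]` by a velocity field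
`w` defined on a domain `Ω`. -/
structure EvolvingSurface where
  /-- the spatial domain -/
  Ω : Set E3
  /-- the final time -/
  T : ℝ
  /-- the velocity field -/
  w : E3 → ℝ → E3
  /-- the initial surface -/
  Γ₀ : Set E3
  /-- the flow: `t ↦ Φ y t` is the particle path that starts in `y ∈ Γ₀` -/
  Φ : E3 → ℝ → E3
  isOpen_Ω : IsOpen Ω
  isConnected_Ω : IsConnected Ω
  T_pos : 0 < T
  contDiffOn_w : ContDiffOn ℝ 2 (fun p : E3 × ℝ => w p.1 p.2) (Ω ×ˢ Icc 0 T)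
  isClosedSurface : IsClosedSurface Γ₀
  flow_zero : ∀ y ∈ Γ₀, Φ y 0 = y
  flow_ode : ∀ y ∈ Γ₀, ∀ t ∈ Icc 0 T, HasDerivWithinAt (Φ y) (w (Φ y t) t) (Icc 0 T) t
  flow_mem : ∀ y ∈ Γ₀, ∀ t ∈ Icc 0 T, Φ y t ∈ Ω

namespace EvolvingSurface

variable (S : EvolvingSurface)

/-- The surface `Γ(t)` at time `t`. -/
def Γ (t : ℝ) : Set E3 := (fun y => S.Φ y t) '' S.Γ₀

/-- The part of the space-time manifold over a set `I` of times: `⋃_{t ∈ I} Γ(t) × {t}`. -/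
def slab (I : Set ℝ) : Set (E3 × ℝ) := {p | p.2 ∈ I ∧ p.1 ∈ S.Γ p.2}

/-- The space-time manifold `⋃_{t ∈ (0, T]} Γ(t) × {t}`. -/
def manifold : Set (E3 × ℝ) := S.slab (Ioc 0 S.T)

/-- The measure `ds dt` on the space-time manifold, that is, the measure
`A ↦ ∫_0^T |{x ∈ Γ(t) | (x, t) ∈ A}| dt`. -/
def stMeasure : Measure (E3 × ℝ) :=
  (volume.restrict (Ioc 0 S.T)).bind
    (fun t => ((μHE[2] : Measure E3).restrict (S.Γ t)).map (fun x => (x, t)))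

/-- The inner product `(u, v)₀ = ∫_0^T ∫_{Γ(t)} u v ds dt`. -/
def inner0 (u v : E3 × ℝ → ℝ) : ℝ := ∫ p, u p * v p ∂S.stMeasure

/-- The norm `‖u‖₀`. -/
def norm0 (u : E3 × ℝ → ℝ) : ℝ := Real.sqrt (S.inner0 u u)

/-- The tangential gradient `∇_Γ u` of a function on the space-time manifold. -/
def grad (u : E3 × ℝ → ℝ) (p : E3 × ℝ) : E3 :=
  tangentGrad (S.Γ p.2) (fun x => u (x, p.2)) p.1

/-- The inner product `(∇_Γ u, ∇_Γ v)₀`. -/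
def gradInner (u v : E3 × ℝ → ℝ) : ℝ := ∫ p, inner ℝ (S.grad u p) (S.grad v p) ∂S.stMeasure

/-- The squared norm `‖u‖_H² = (u, u)₀ + (∇_Γ u, ∇_Γ u)₀`. -/
def normHSq (u : E3 × ℝ → ℝ) : ℝ := S.inner0 u u + S.gradInner u u

/-- The surface divergence `div_Γ w` of the velocity field, at `(x, t)` with `x ∈ Γ(t)`. -/
def divW (p : E3 × ℝ) : ℝ := surfaceDiv (S.Γ p.2) (fun x => S.w x p.2) p.1

/-- The bilinear form `a(u, v) = ν (∇_Γ u, ∇_Γ v)₀ + (div_Γ w u, v)₀`. -/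
def formA (ν : ℝ) (u v : E3 × ℝ → ℝ) : ℝ :=
  ν * S.gradInner u v + S.inner0 (fun p => S.divW p * u p) v

/-- The integral `ū(t) = ∫_{Γ(t)} u(·, t) ds`. -/
def bar (u : E3 × ℝ → ℝ) (t : ℝ) : ℝ := surfaceIntegral (S.Γ t) (fun x => u (x, t))

/-- The stabilized form `a_σ(u, v) = a(u, v) + σ ∫_0^T ū(t) v̄(t) dt`. -/
def formASigma (ν σ : ℝ) (u v : E3 × ℝ → ℝ) : ℝ :=
  S.formA ν u v + σ * ∫ t in (0 : ℝ)..S.T, S.bar u t * S.bar v t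

/-- The material derivative `∂u/∂t + w · ∇u` of a function on the space-time manifold: the
derivative of `u` along the particle path through `p = (x, t)`. -/
def matDeriv (u : E3 × ℝ → ℝ) (p : E3 × ℝ) : ℝ :=
  deriv (fun s => u (S.Φ (Function.invFunOn (fun y => S.Φ y p.2) S.Γ₀ p.1) s, s)) p.2

end EvolvingSurface

/-- `K` is a tetrahedral triangulation of `Ω`: a finite simplicial complex with union the closure
of `Ω`, all of whose simplices are faces of tetrahedra. (The tetrahedra are nondegenerate and meet
in common faces, by the definition of a simplicial complex.) -/
structure IsTetrahedralTriangulation (Ω : Set E3) (K : Geometry.SimplicialComplex ℝ E3) :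
    Prop where
  finite : K.faces.Finite
  space_eq : K.space = closure Ω
  pure : ∀ s ∈ K.faces, ∃ t ∈ K.faces, s ⊆ t ∧ t.card = 4

/-- The continuous piecewise affine functions on a tetrahedral triangulation (only their values on
the union of the tetrahedra matter). -/
def piecewiseAffine (K : Geometry.SimplicialComplex ℝ E3) : Set (E3 → ℝ) :=
  {φ | ContinuousOn φ K.space ∧ ∀ s ∈ K.faces, s.card = 4 →
    ∃ L : E3 →ᵃ[ℝ] ℝ, EqOn φ L (convexHull ℝ (s : Set E3))}

/-- A space-time triangulation of `Ω × (0, T]`: the number `N` of time steps, and a tetrahedral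
triangulation of `Ω` for each of the time intervals `n = 1, …, N`. -/
structure SpaceTimeMesh (S : EvolvingSurface) where
  /-- the number of time steps -/
  N : ℕ
  N_pos : 0 < N
  /-- the triangulation that is used in the `n`-th time interval -/
  tri : ℕ → Geometry.SimplicialComplex ℝ E3
  isTriangulation : ∀ n ∈ Finset.Icc 1 N, IsTetrahedralTriangulation S.Ω (tri n)

namespace SpaceTimeMesh

variable {S : EvolvingSurface} (M : SpaceTimeMesh S)

/-- The time nodes `t_n = n Δt`, with `Δt = T / N`. -/
def node (n : ℕ) : ℝ := n * (S.T / M.N)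

/-- The time intervals `I_n = (t_{n-1}, t_n]`, for `n = 1, …, N`. -/
def interval (n : ℕ) : Set ℝ := Ioc (M.node (n - 1)) (M.node n)

/-- The union of those prisms `K × I_n` of the `n`-th time slab whose intersection with the
space-time manifold has positive measure (the measure `ds dt` and the three-dimensional surface
measure on the manifold have the same null sets). -/
def activeSlab (n : ℕ) : Set (E3 × ℝ) :=
  ⋃ s ∈ {s ∈ (M.tri n).faces | s.card = 4 ∧
      0 < S.stMeasure ((convexHull ℝ (s : Set E3)) ×ˢ M.interval n)},
    (convexHull ℝ (s : Set E3)) ×ˢ M.interval n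

/-- The volume space-time finite element space `V_h`: functions which are of the form
`φ₀(x) + t φ₁(x)` on the active part of each time slab, with `φ₀`, `φ₁` continuous piecewise
affine. -/
def volumeSpace : Set (E3 × ℝ → ℝ) :=
  {v | ∀ n ∈ Finset.Icc 1 M.N, ∃ φ₀ ∈ piecewiseAffine (M.tri n), ∃ φ₁ ∈ piecewiseAffine (M.tri n),
    ∀ p ∈ M.activeSlab n, v p = φ₀ p.1 + p.2 * φ₁ p.1}

/-- The surface finite element space `W_h`, of the traces on the space-time manifold of the
functions in `V_h`. Functions on the manifold are represented by their extension by zero. -/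
def surfaceSpace : Set (E3 × ℝ → ℝ) :=
  {u | ∃ v ∈ M.volumeSpace, u = S.manifold.indicator v}

/-- The one-sided limit `u₊ⁿ(x) = u₊(x, t_n)` from later times, along the space-time manifold. -/
def traceRight (u : E3 × ℝ → ℝ) (n : ℕ) (x : E3) : ℝ :=
  limUnder (𝓝[S.slab (Ioc (M.node n) S.T)] (x, M.node n)) u

/-- The one-sided limit `u₋ⁿ(x) = u₋(x, t_n)` from earlier times, along the space-time manifold. -/
def traceLeft (u : E3 × ℝ → ℝ) (n : ℕ) (x : E3) : ℝ :=
  limUnder (𝓝[S.slab (Ioo 0 (M.node n))] (x, M.node n)) u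

/-- The jump `[u]ⁿ = u₊ⁿ - u₋ⁿ` for `n ≥ 1`, and `[u]⁰ = u₊⁰`. -/
def jump (u : E3 × ℝ → ℝ) (n : ℕ) (x : E3) : ℝ :=
  if n = 0 then M.traceRight u 0 x else M.traceRight u n x - M.traceLeft u n x

/-- The inner product `(ψ, φ)_{t_n} = ∫_{Γ(t_n)} ψ φ ds`. -/
def innerNode (n : ℕ) (ψ φ : E3 → ℝ) : ℝ :=
  surfaceIntegral (S.Γ (M.node n)) (fun x => ψ x * φ x)

/-- The form `d(u, v) = ∑_{n=1}^N ([u]^{n-1}, v₊^{n-1})_{t_{n-1}}`. -/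
def formD (u v : E3 × ℝ → ℝ) : ℝ :=
  ∑ n ∈ Finset.Icc 1 M.N, M.innerNode (n - 1) (M.jump u (n - 1)) (M.traceRight v (n - 1))

/-- The form `⟨u̇, v⟩_b = ∑_{n=1}^N ∫_{t_{n-1}}^{t_n} ∫_{Γ(t)} u̇ v ds dt`. -/
def formDot (u v : E3 × ℝ → ℝ) : ℝ :=
  ∑ n ∈ Finset.Icc 1 M.N, ∫ p in S.slab (M.interval n), S.matDeriv u p * v p ∂S.stMeasure

/-- `u` is a solution of the stabilized discrete problem:
`u ∈ W_h` and `⟨u̇, v⟩_b + a_σ(u, v) + d(u, v) = (f, v)₀` for all `v ∈ W_h`. -/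
def IsDiscreteSolution (ν σ : ℝ) (f u : E3 × ℝ → ℝ) : Prop :=
  u ∈ M.surfaceSpace ∧ ∀ v ∈ M.surfaceSpace,
    M.formDot u v + S.formASigma ν σ u v + M.formD u v = S.inner0 f v

/-- The mesh-dependent norm
`(max_{1 ≤ n ≤ N} ‖u₋ⁿ‖²_{t_n} + ∑_{n=1}^N ‖[u]^{n-1}‖²_{t_{n-1}} + ‖u‖_H²)^{1/2}`. -/
def normh (u : E3 × ℝ → ℝ) : ℝ :=
  Real.sqrt
    ((Finset.Icc 1 M.N).sup' (Finset.nonempty_Icc.mpr M.N_pos)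
        (fun n => M.innerNode n (M.traceLeft u n) (M.traceLeft u n)) +
      ∑ n ∈ Finset.Icc 1 M.N, M.innerNode (n - 1) (M.jump u (n - 1)) (M.jump u (n - 1)) +
      S.normHSq u)

end SpaceTimeMesh

end

/-! The stability bound is an energy estimate, and well-posedness follows from it because the
discrete problem is a square linear system. Functions in the trial space may jump at the time nodes,
so `truncate k u`, which is `u` cut off after `t_k`, is an admissible test function. On one slab the
Leibniz rule for moving surfaces reads `2∫u̇u = ‖u₋ⁿ‖² - ‖u₊ⁿ⁻¹‖² - ∫ div_Γ w u²`
(`IsLift.energy_slab`), and at a node `2[u]u₊ = [u]² + u₊² - u₋²`. Summed over the first `k` slabs,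
this telescopes to `‖u₋ᵏ‖²` plus the squared jumps, minus the divergence term. Half of the
divergence term in `a_σ` survives.

At a fixed time, half of the diffusion is spent on the Friedrichs inequality. It yields `(ν/2) c_F
(∫u² - ū²/|Γ|)`; the condition on `σ` absorbs the mean value, and the condition on the divergence
turns the rest into `(c₀/2)∫u²`. The other half of the diffusion keeps the gradient
(`coercive_slice`). The result is `IsLift.energy`. Using it for `k = N` and for the `k` that attains
the maximum, and adding, costs a factor two, hence the constant 1/4 (`normh_le`). With zero data the
norm vanishes, so the form is injective, and in finite dimension it is bijective onto the dual.

Most of the work justifies these computations for surfaces given only as images under the flow, with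
Hausdorff measure, tangent cones and one-sided limits. Everything is pulled back to the cylinder `Γ₀
× [0, T]`. The flow is strictly differentiable along `Γ₀`, and its derivative solves the linear
variational equation (`exists_flow_sub_le`); it changes area by the factor `jac = exp ∫ div_Γ w`
(`areaFactor_tangentMap`). Local comparison of measures then gives the area formula
(`comap_flow_eq_withDensity`) and turns `ds dt` into a product measure with density `jac`
(`stMeasure_eq`). On each slab a finite element function becomes a Lipschitz function on the
cylinder (`IsLift`). By Rademacher's theorem and Fubini it has a bounded tangential gradient and
material derivative almost everywhere, the latter being a plain time derivative. -/

open scoped NNReal ENNReal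

noncomputable section

/-! ### Area of images of plane sets under linear and strictly differentiable maps. -/

/-- The Euclidean plane. -/
abbrev E2 : Type := EuclideanSpace ℝ (Fin 2)

/-- The Gram determinant of two vectors. -/
def gram2 {E : Type*} [NormedAddCommGroup E] [InnerProductSpace ℝ E] (a b : E) : ℝ :=
  ‖a‖ ^ 2 * ‖b‖ ^ 2 - inner ℝ a b ^ 2

theorem gram2_nonneg {E : Type*} [NormedAddCommGroup E] [InnerProductSpace ℝ E] (a b : E) :
    0 ≤ gram2 a b := by
  unfold gram2
  have h := abs_real_inner_le_norm a b
  have h2 : inner ℝ a b ^ 2 ≤ (‖a‖ * ‖b‖) ^ 2 := by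
    rw [← sq_abs (inner ℝ a b)]; gcongr
  nlinarith [h2]

theorem LinearIsometry.gram2_map {E F : Type*} [NormedAddCommGroup E] [InnerProductSpace ℝ E]
    [NormedAddCommGroup F] [InnerProductSpace ℝ F] (f : E →ₗᵢ[ℝ] F) (a b : E) :
    gram2 (f a) (f b) = gram2 a b := by
  simp [gram2]

/-- The factor by which a linear map from the plane changes area. -/
noncomputable def areaFactor (L : E2 →L[ℝ] E3) : ℝ :=
  Real.sqrt (gram2 (L (EuclideanSpace.single 0 1)) (L (EuclideanSpace.single 1 1)))

theorem abs_det_eq_sqrt_gram2 (A : E2 →ₗ[ℝ] E2) :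
    |LinearMap.det A| =
      Real.sqrt (gram2 (A (EuclideanSpace.single 0 1)) (A (EuclideanSpace.single 1 1))) := by
  rw [← LinearMap.det_toMatrix (EuclideanSpace.basisFun (Fin 2) ℝ).toBasis, Matrix.det_fin_two,
    ← Real.sqrt_sq_eq_abs]
  congr 1
  simp only [LinearMap.toMatrix_apply, OrthonormalBasis.coe_toBasis, EuclideanSpace.basisFun_apply,
    OrthonormalBasis.coe_toBasis_repr_apply, EuclideanSpace.basisFun_repr, gram2,
    EuclideanSpace.real_norm_sq_eq, Fin.sum_univ_two, PiLp.inner_apply]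
  simp
  ring

/-- `L` is a linear map of the plane into itself followed by an isometric embedding. The isometry
preserves area and Gram determinants, and the determinant of the plane map is the square root of a
Gram determinant. -/
theorem hausdorff_image_linear (L : E2 →L[ℝ] E3) (hL : Function.Injective L) (B : Set E2) :
    (μHE[2] : Measure E3) (L '' B) = ENNReal.ofReal (areaFactor L) * volume B := by
  have hfr : Module.finrank ℝ (LinearMap.range L.toLinearMap) = 2 := by
    rw [LinearMap.finrank_range_of_inj hL]; simp
  let b := (stdOrthonormalBasis ℝ (LinearMap.range L.toLinearMap)).reindex (finCongr hfr)
  let κ : E2 →ₗᵢ[ℝ] E3 :=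
    (LinearMap.range L.toLinearMap).subtypeₗᵢ.comp b.repr.symm.toLinearIsometry
  let A : E2 →ₗ[ℝ] E2 := b.repr.toLinearEquiv.toLinearMap ∘ₗ L.toLinearMap.rangeRestrict
  have hκ : ∀ v, κ (A v) = L v := by
    intro v
    simp [κ, A]
  have himg : L '' B = κ '' (A '' B) := by
    rw [image_image]
    simp [hκ]
  rw [himg, κ.isometry.euclideanHausdorffMeasure_image,
    EuclideanSpace.euclideanHausdorffMeasure_eq_volume, Measure.addHaar_image_linearMap,
    abs_det_eq_sqrt_gram2, areaFactor, ← hκ, ← hκ, κ.gram2_map]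

/-- A vanishing Gram determinant is equality in the Cauchy–Schwarz inequality, which would make the
images of the two basis vectors parallel. -/
theorem areaFactor_pos (L : E2 →L[ℝ] E3) (hL : Function.Injective L) : 0 < areaFactor L := by
  by_contra hc
  have h0 : areaFactor L = 0 := le_antisymm (not_lt.mp hc) (Real.sqrt_nonneg _)
  rw [areaFactor, Real.sqrt_eq_zero (gram2_nonneg _ _)] at h0
  have hab : |inner ℝ (L (EuclideanSpace.single 0 1)) (L (EuclideanSpace.single 1 1))| =
      ‖L (EuclideanSpace.single 0 1)‖ * ‖L (EuclideanSpace.single 1 1)‖ := by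
    rw [← abs_of_nonneg (mul_nonneg (norm_nonneg (L (EuclideanSpace.single 0 1)))
      (norm_nonneg (L (EuclideanSpace.single 1 1)))), ← sq_eq_sq_iff_abs_eq_abs]
    unfold gram2 at h0
    linarith [mul_pow ‖L (EuclideanSpace.single 0 1)‖ ‖L (EuclideanSpace.single 1 1)‖ 2]
  have hne : ∀ i, L (EuclideanSpace.single i 1) ≠ 0 := by
    intro i h; have := hL (h.trans (map_zero L).symm); simp at this
  obtain ⟨r, -, hr⟩ := (norm_inner_eq_norm_iff (𝕜 := ℝ) (hne 0) (hne 1)).mp hab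
  rw [← map_smul] at hr
  have h1 := congrArg (fun v : E2 => v 1) (hL hr)
  simp at h1

/-- Points of `B` identified by `g` are also identified by `f`, so `f` factors through `g` on `B` by
a `d`-Lipschitz map, which enlarges area by at most `d²`. -/
theorem hausdorff_image_le_of_edist_le {α X Y : Type*} [Nonempty α] [MetricSpace X]
    [MetricSpace Y] [MeasurableSpace X] [BorelSpace X] [MeasurableSpace Y] [BorelSpace Y]
    {f : α → X} {g : α → Y} {B : Set α} {d : ℝ≥0}
    (h : ∀ a ∈ B, ∀ b ∈ B, dist (f a) (f b) ≤ d * dist (g a) (g b)) :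
    (μHE[2] : Measure X) (f '' B) ≤ (d : ℝ≥0∞) ^ 2 * (μHE[2] : Measure Y) (g '' B) := by
  have key : ∀ a ∈ B, f (Function.invFunOn g B (g a)) = f a := by
    intro a ha
    have h1 := Function.invFunOn_mem (f := g) (s := B) ⟨a, ha, rfl⟩
    have h2 := Function.invFunOn_eq (f := g) (s := B) ⟨a, ha, rfl⟩
    have := h _ h1 a ha
    rw [h2, dist_self, mul_zero] at this
    exact dist_le_zero.mp this
  have himg : f '' B = (f ∘ Function.invFunOn g B) '' (g '' B) := by
    rw [image_image]
    exact image_congr fun a ha => (key a ha).symm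
  have hlip : LipschitzOnWith d (f ∘ Function.invFunOn g B) (g '' B) := by
    refine LipschitzOnWith.of_dist_le_mul ?_
    rintro _ ⟨a, ha, rfl⟩ _ ⟨b, hb, rfl⟩
    simp only [Function.comp, key a ha, key b hb]
    exact h a ha b hb
  have := hlip.hausdorffMeasure_image_le (d := 2) (by norm_num)
  rw [himg]
  simp only [Measure.euclideanHausdorffMeasure_def, Measure.smul_apply]
  rw [mul_smul_comm]
  gcongr
  simpa using this

/-- Near `z` the distances between values of `F` and between values of `L` agree up to a factor
close to one, because `L` is bounded below and `F - L` has a small Lipschitz constant there. -/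
theorem HasStrictFDerivAt.exists_hausdorff_image_le {F : E2 → E3} {L : E2 →L[ℝ] E3} {z : E2}
    (hF : HasStrictFDerivAt F L z) (hL : Function.Injective L) {c : ℝ≥0} (hc : 1 < c) :
    ∃ W ∈ 𝓝 z, ∀ B ⊆ W,
      (μHE[2] : Measure E3) (F '' B) ≤ c * (ENNReal.ofReal (areaFactor L) * volume B) ∧
      ENNReal.ofReal (areaFactor L) * volume B ≤ c * (μHE[2] : Measure E3) (F '' B) := by
  obtain ⟨K, hK0, hK⟩ : ∃ K : ℝ≥0, 0 < K ∧ AntilipschitzWith K L :=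
    L.exists_antilipschitzWith (LinearMap.ker_eq_bot.mpr hL)
  set d : ℝ≥0 := NNReal.sqrt c with hd
  have hd1 : 1 < d := by
    rw [hd, ← NNReal.sqrt_one]
    exact NNReal.sqrt_lt_sqrt.mpr hc
  have hd2 : (d : ℝ≥0∞) ^ 2 = c := by
    rw [← ENNReal.coe_pow, hd, NNReal.sq_sqrt]
  have hd1' : (1 : ℝ) < d := by exact_mod_cast hd1
  have hK0' : (0 : ℝ) < K := by exact_mod_cast hK0
  -- With this choice the relative error is `δK = 1 - 1/d`. The lower factor is then exactly `1/d`,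
  -- and the upper factor `2 - 1/d` is at most `d`.
  set δ : ℝ := (1 - (d : ℝ)⁻¹) / K with hδ
  have hdi : (d : ℝ)⁻¹ < 1 := inv_lt_one_of_one_lt₀ hd1'
  have hδ0 : 0 < δ := div_pos (by linarith) hK0'
  have hδK : δ * K = 1 - (d : ℝ)⁻¹ := by rw [hδ]; field_simp
  have hev := hF.isLittleO.def hδ0
  rw [nhds_prod_eq, eventually_prod_self_iff'] at hev
  obtain ⟨W, hW, hWF⟩ := hev
  refine ⟨W, hW, fun B hB => ?_⟩
  have est : ∀ a ∈ B, ∀ b ∈ B, ‖F a - F b - L (a - b)‖ ≤ δ * K * ‖L a - L b‖ := by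
    intro a ha b hb
    have h1 := hWF a (hB ha) b (hB hb)
    have h2 := hK.le_mul_dist a b
    rw [dist_eq_norm, dist_eq_norm] at h2
    calc _ ≤ δ * ‖a - b‖ := h1
      _ ≤ δ * (K * ‖L a - L b‖) := by gcongr
      _ = _ := by ring
  have hsum : (d : ℝ)⁻¹ + d ≥ 2 := by
    have : (d : ℝ)⁻¹ * d = 1 := inv_mul_cancel₀ (by positivity)
    nlinarith [sq_nonneg ((d : ℝ) - 1), inv_pos.mpr (show (0 : ℝ) < d by linarith)]
  have up : ∀ a ∈ B, ∀ b ∈ B, dist (F a) (F b) ≤ d * dist (L a) (L b) := by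
    intro a ha b hb
    have h1 := est a ha b hb
    rw [map_sub] at h1
    have h2 := norm_sub_norm_le (F a - F b) (L a - L b)
    rw [dist_eq_norm, dist_eq_norm]
    rw [hδK] at h1
    nlinarith [norm_nonneg (L a - L b)]
  have low : ∀ a ∈ B, ∀ b ∈ B, dist (L a) (L b) ≤ d * dist (F a) (F b) := by
    intro a ha b hb
    have h1 := est a ha b hb
    rw [map_sub] at h1
    have h2 := norm_sub_norm_le (L a - L b) (F a - F b)
    rw [norm_sub_rev (L a - L b)] at h2
    rw [dist_eq_norm, dist_eq_norm]
    rw [hδK] at h1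
    have h3 : (d : ℝ)⁻¹ * ‖L a - L b‖ ≤ ‖F a - F b‖ := by linarith
    rwa [inv_mul_le_iff₀ (by linarith)] at h3
  rw [← hausdorff_image_linear L hL, ← hd2]
  exact ⟨hausdorff_image_le_of_edist_le up, hausdorff_image_le_of_edist_le low⟩

/-- By second countability the space is covered by countably many of the given neighbourhoods;
disjointifying them makes the inequality with factor `c` global, and then `c` decreases to 1. -/
theorem MeasureTheory.Measure.le_of_locally_le {X : Type*} [TopologicalSpace X]
    [SecondCountableTopology X] [MeasurableSpace X] [OpensMeasurableSpace X] {μ ν : Measure X}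
    (h : ∀ c : ℝ≥0, 1 < c → ∀ x, ∃ V ∈ 𝓝 x, ∀ A ⊆ V, MeasurableSet A → ν A ≤ c * μ A) :
    ν ≤ μ := by
  rw [Measure.le_iff]
  intro A hA
  have hc : ∀ c : ℝ≥0, 1 < c → ν A ≤ c * μ A := by
    intro c hc
    choose V hV hVA using h c hc
    obtain ⟨s, hs, hsU⟩ := TopologicalSpace.countable_cover_nhds
      (f := fun x => interior (V x)) (fun x => interior_mem_nhds.mpr (hV x))
    rcases s.eq_empty_or_nonempty with rfl | hne
    · have : A = ∅ := by
        apply eq_empty_of_subset_empty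
        intro x _
        have : x ∈ (univ : Set X) := mem_univ x
        rw [← hsU] at this
        simp at this
      simp [this]
    obtain ⟨x, rfl⟩ := hs.exists_eq_range hne
    rw [biUnion_range] at hsU
    have hm : ∀ n, MeasurableSet (interior (V (x n))) := fun n => isOpen_interior.measurableSet
    have hdec : A = ⋃ n, A ∩ disjointed (fun n => interior (V (x n))) n := by
      rw [← inter_iUnion, iUnion_disjointed, hsU, inter_univ]
    have hmeas : ∀ n, MeasurableSet (A ∩ disjointed (fun n => interior (V (x n))) n) :=
      fun n => hA.inter (MeasurableSet.disjointed hm n)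
    have hdisj : Pairwise (Function.onFun Disjoint
        fun n => A ∩ disjointed (fun n => interior (V (x n))) n) := by
      intro i j hij
      exact (disjoint_disjointed _ hij).mono inter_subset_right inter_subset_right
    rw [hdec, measure_iUnion hdisj hmeas, measure_iUnion hdisj hmeas, ← ENNReal.tsum_mul_left]
    refine ENNReal.tsum_le_tsum fun n => hVA (x n) _ ?_ (hmeas n)
    exact inter_subset_right.trans ((disjointed_subset _ n).trans interior_subset)
  refine le_of_tendsto_of_tendsto (b := 𝓝[>] (1 : ℝ≥0)) (tendsto_const_nhds (x := ν A))
    (g := fun c : ℝ≥0 => (c : ℝ≥0∞) * μ A) ?_ ?_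
  · have h1 : Tendsto (fun c : ℝ≥0 => (c : ℝ≥0∞) * μ A) (𝓝[>] (1 : ℝ≥0)) (𝓝 ((1 : ℝ≥0) * μ A)) := by
      refine ENNReal.Tendsto.mul_const ?_ (Or.inl (by simp))
      exact (ENNReal.continuous_coe.tendsto 1).mono_left nhdsWithin_le_nhds
    simpa using h1
  · filter_upwards [self_mem_nhdsWithin] with c hc' using hc c hc'

/-! ### Linear initial value problems in Banach spaces. -/

section LinearODE

variable {E : Type*} [NormedAddCommGroup E] [NormedSpace ℝ E]

theorem HasDerivWithinAt.piecewise_Icc {f g : ℝ → E} {f' : ℝ → E} {a b c : ℝ} (hab : a ≤ b)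
    (hbc : b ≤ c) (hf : ∀ t ∈ Icc a b, HasDerivWithinAt f (f' t) (Icc a b) t)
    (hg : ∀ t ∈ Icc b c, HasDerivWithinAt g (f' t) (Icc b c) t) (hfg : f b = g b) :
    ∀ t ∈ Icc a c, HasDerivWithinAt (fun t => if t ≤ b then f t else g t) (f' t) (Icc a c) t := by
  have hF : EqOn (fun t => if t ≤ b then f t else g t) f (Icc a b) := fun t ht => if_pos ht.2
  have hG : EqOn (fun t => if t ≤ b then f t else g t) g (Icc b c) := by
    intro t ht
    rcases ht.1.eq_or_lt with rfl | h
    · simpa using hfg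
    · exact if_neg (not_le.mpr h)
  intro t ht
  rw [← Icc_union_Icc_eq_Icc hab hbc]
  refine HasDerivWithinAt.union ?_ ?_
  · by_cases h : t ≤ b
    · exact (hf t ⟨ht.1, h⟩).congr hF (hF ⟨ht.1, h⟩)
    · rw [hasDerivWithinAt_iff_hasFDerivWithinAt]
      apply HasFDerivWithinAt.of_notMem_closure
      rw [isClosed_Icc.closure_eq]
      exact fun h' => h h'.2
  · by_cases h : b ≤ t
    · exact (hg t ⟨h, ht.2⟩).congr hG (hG ⟨h, ht.2⟩)
    · rw [hasDerivWithinAt_iff_hasFDerivWithinAt]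
      apply HasFDerivWithinAt.of_notMem_closure
      rw [isClosed_Icc.closure_eq]
      exact fun h' => h h'.1

variable [CompleteSpace E]

/-- Picard–Lindelöf on the ball of radius `‖x₀‖` about `x₀`: there the velocity is at most `2K‖x₀‖`,
so in time `1/(2K)` the solution cannot leave the ball. -/
theorem exists_linearODE_solution_short {A : ℝ → E →L[ℝ] E} {a b : ℝ} {K : ℝ≥0} (hab : a ≤ b)
    (hA : ContinuousOn A (Icc a b)) (hK : ∀ t ∈ Icc a b, ‖A t‖ ≤ K) (hKab : K * (b - a) ≤ 1 / 2)
    (x₀ : E) :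
    ∃ x : ℝ → E, x a = x₀ ∧ ∀ t ∈ Icc a b, HasDerivWithinAt x (A t (x t)) (Icc a b) t := by
  have hPL : IsPicardLindelof (fun t x => A t x) (⟨a, left_mem_Icc.mpr hab⟩ : Icc a b) x₀
      ‖x₀‖₊ 0 (K * (2 * ‖x₀‖₊)) K := by
    refine ⟨fun t ht => ?_, fun x _ => hA.clm_apply continuousOn_const, fun t ht x hx => ?_, ?_⟩
    · exact ((A t).lipschitz.weaken (hK t ht)).lipschitzOnWith
    · have hx' : ‖x‖ ≤ 2 * ‖x₀‖ := by
        have h1 : ‖x - x₀‖ ≤ ‖x₀‖ := by simpa [dist_eq_norm] using hx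
        have h2 := norm_le_norm_add_norm_sub' x x₀
        linarith
      calc ‖A t x‖ ≤ ‖A t‖ * ‖x‖ := (A t).le_opNorm x
        _ ≤ K * (2 * ‖x₀‖) := by gcongr; exact hK t ht
        _ = _ := by simp
    · have : max (b - a) (a - a) = b - a := max_eq_left (by linarith)
      change ((K * (2 * ‖x₀‖₊) : ℝ≥0) : ℝ) * max (b - a) (a - a) ≤ (‖x₀‖₊ : ℝ) - (0 : ℝ≥0)
      rw [this]
      push_cast
      have := norm_nonneg x₀
      nlinarith
  exact hPL.exists_eq_forall_mem_Icc_hasDerivWithinAt₀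

theorem exists_linearODE_solution {A : ℝ → E →L[ℝ] E} {T : ℝ} (hT : 0 ≤ T)
    (hA : ContinuousOn A (Icc 0 T)) (x₀ : E) :
    ∃ x : ℝ → E, x 0 = x₀ ∧ ∀ t ∈ Icc 0 T, HasDerivWithinAt x (A t (x t)) (Icc 0 T) t := by
  obtain ⟨C, hC⟩ := isCompact_Icc.exists_bound_of_continuousOn hA
  set K : ℝ≥0 := Real.toNNReal C + 1 with hKdef
  have hK : ∀ t ∈ Icc 0 T, ‖A t‖ ≤ K := by
    intro t ht
    refine (hC t ht).trans ((Real.le_coe_toNNReal C).trans ?_)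
    simp [hKdef]
  have hKpos : (0 : ℝ) < K := by simp only [hKdef]; positivity
  -- The step length depends only on the bound for `A`, not on the initial value, so finitely many
  -- short solutions cover `[0, T]`.
  set τ : ℝ := 1 / (2 * K) with hτ
  have hτpos : 0 < τ := by positivity
  have hKτ : K * τ = 1 / 2 := by rw [hτ]; field_simp
  have key : ∀ n : ℕ, ∀ b ∈ Icc 0 T, b ≤ n * τ → ∃ x : ℝ → E, x 0 = x₀ ∧
      ∀ t ∈ Icc 0 b, HasDerivWithinAt x (A t (x t)) (Icc 0 b) t := by
    intro n
    induction n with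
    | zero =>
      intro b hb hbn
      have hb0 : b = 0 := le_antisymm (by simpa using hbn) hb.1
      subst hb0
      refine ⟨fun _ => x₀, rfl, fun t ht => ?_⟩
      rw [hasDerivWithinAt_iff_hasFDerivWithinAt]
      apply HasFDerivWithinAt.of_subsingleton
      simp
    | succ n ih =>
      intro b hb hbn
      set a := max 0 (b - τ) with ha
      have ha0 : 0 ≤ a := le_max_left _ _
      have hab : a ≤ b := max_le hb.1 (by linarith)
      have han : a ≤ n * τ := by
        refine max_le (by positivity) ?_
        push_cast at hbn
        linarith
      have hba : b - a ≤ τ := by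
        have := le_max_right 0 (b - τ)
        linarith
      obtain ⟨x, hx0, hx⟩ := ih a ⟨ha0, hab.trans hb.2⟩ han
      have hsub : Icc a b ⊆ Icc 0 T := Icc_subset_Icc ha0 hb.2
      obtain ⟨y, hy0, hy⟩ := exists_linearODE_solution_short hab (hA.mono hsub)
        (fun t ht => hK t (hsub ht)) (by nlinarith) (x a)
      refine ⟨fun t => if t ≤ a then x t else y t, by simp [ha0, hx0], ?_⟩
      have := HasDerivWithinAt.piecewise_Icc (f := x) (g := y)
        (f' := fun t => A t (if t ≤ a then x t else y t)) ha0 hab ?_ ?_ hy0.symm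
      · exact this
      · intro t ht
        simpa [ht.2] using hx t ht
      · intro t ht
        have h := hy t ht
        rcases ht.1.eq_or_lt with rfl | h'
        · simpa [hy0] using h
        · simpa [not_le.mpr h'] using h
  obtain ⟨n, hn⟩ := exists_nat_ge (T / τ)
  exact key n T ⟨hT, le_rfl⟩ ((div_le_iff₀ hτpos).mp hn)

end LinearODE

/-- A linear initial value problem `M' = A M`, `M(0) = 1` in a Banach algebra has a solution with a
left inverse. -/
theorem exists_fundamental_solution {R : Type*} [NormedRing R] [NormedAlgebra ℝ R] [CompleteSpace R]
    {A : ℝ → R} {T : ℝ} (hT : 0 ≤ T) (hA : ContinuousOn A (Icc 0 T)) :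
    ∃ M N : ℝ → R, M 0 = 1 ∧ (∀ t ∈ Icc 0 T, HasDerivWithinAt M (A t * M t) (Icc 0 T) t) ∧
      (∀ t ∈ Icc 0 T, N t * M t = 1) ∧ ContinuousOn N (Icc 0 T) := by
  obtain ⟨M, hM0, hM⟩ := exists_linearODE_solution (A := fun t => ContinuousLinearMap.mul ℝ R (A t))
    hT ((ContinuousLinearMap.mul ℝ R).continuous.comp_continuousOn hA) 1
  -- `N` solves `N' = -N A`; the flipped product multiplies from the right. Hence `(N M)' = -N A M +
  -- N A M = 0`.
  obtain ⟨N, hN0, hN⟩ := exists_linearODE_solution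
    (A := fun t => (ContinuousLinearMap.mul ℝ R).flip (-A t)) hT
    ((ContinuousLinearMap.mul ℝ R).flip.continuous.comp_continuousOn hA.neg) 1
  simp only [ContinuousLinearMap.flip_apply, ContinuousLinearMap.mul_apply'] at hM hN
  refine ⟨M, N, hM0, hM, ?_, fun t ht => (hN t ht).continuousWithinAt⟩
  have hd : ∀ t ∈ Icc 0 T, HasDerivWithinAt (fun t => N t * M t) 0 (Icc 0 T) t := by
    intro t ht
    have := (hN t ht).mul (hM t ht)
    convert! this using 1
    noncomm_ring
  intro t ht
  have hconst := constant_of_has_deriv_right_zero (f := fun t => N t * M t)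
    (fun t ht => (hd t ht).continuousWithinAt)
    (fun t ht => ((hd t (Ico_subset_Icc_self ht)).mono_of_mem_nhdsWithin
      (Icc_mem_nhdsGE_of_mem ht))) t ht
  simpa [hM0, hN0] using hconst

/-! ### Local charts of a closed surface over its tangent planes. -/

/-- Radial projection onto the closed ball of radius `r` about `0`. -/
noncomputable def radialClamp {E : Type*} [NormedAddCommGroup E] [NormedSpace ℝ E] (r : ℝ) (z : E) : E :=
  (r / max r ‖z‖) • z

theorem continuous_radialClamp {E : Type*} [NormedAddCommGroup E] [NormedSpace ℝ E] {r : ℝ}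
    (hr : 0 < r) : Continuous (radialClamp r : E → E) := by
  unfold radialClamp
  refine Continuous.smul (Continuous.div continuous_const (by fun_prop) fun z => ?_) continuous_id
  exact (lt_max_of_lt_left hr).ne'

theorem norm_radialClamp_le {E : Type*} [NormedAddCommGroup E] [NormedSpace ℝ E] {r : ℝ}
    (hr : 0 < r) (z : E) : ‖radialClamp r z‖ ≤ r := by
  have h : 0 < max r ‖z‖ := lt_max_of_lt_left hr
  rw [radialClamp, norm_smul, Real.norm_of_nonneg (by positivity), div_mul_eq_mul_div, div_le_iff₀ h]
  gcongr
  exact le_max_right _ _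

theorem radialClamp_of_norm_le {E : Type*} [NormedAddCommGroup E] [NormedSpace ℝ E] {r : ℝ}
    (hr : 0 < r) {z : E} (hz : ‖z‖ ≤ r) : radialClamp r z = z := by
  rw [radialClamp, max_eq_left hz, div_self hr.ne', one_smul]

/-- A parametrization of the surface `Γ` near `x₀` as a graph over its tangent plane at `x₀`. -/
structure SurfaceChart (Γ : Set E3) (x₀ : Γ) where
  /-- the tangent plane -/
  ι : E2 →ₗᵢ[ℝ] E3
  /-- the radius of the disk on which `ψ` is a parametrization -/
  r : ℝ
  /-- the parametrization -/
  ψ : E2 → Γ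
  /-- the part of the surface that is parametrized -/
  V : Set Γ
  r_pos : 0 < r
  continuous_ψ : Continuous ψ
  isOpen_V : IsOpen V
  mem_V : x₀ ∈ V
  ψ_zero : ψ 0 = x₀
  coord_ψ : ∀ z ∈ Metric.ball (0 : E2) r,
    ContinuousLinearMap.adjoint ι.toContinuousLinearMap ((ψ z : E3) - x₀) = z
  norm_coord_lt : ∀ y ∈ V,
    ‖ContinuousLinearMap.adjoint ι.toContinuousLinearMap ((y : E3) - x₀)‖ < r
  ψ_coord : ∀ y ∈ V, ψ (ContinuousLinearMap.adjoint ι.toContinuousLinearMap ((y : E3) - x₀)) = y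
  hasStrictFDerivAt : HasStrictFDerivAt (fun z => (ψ z : E3)) ι.toContinuousLinearMap 0
  lipschitzOnWith : LipschitzOnWith 2 ψ (Metric.ball 0 r)
  span_tangentCone : Submodule.span ℝ (tangentConeAt ℝ Γ (x₀ : E3)) = LinearMap.range ι.toLinearMap

theorem exists_isometry_onto_orthogonal {g : E3} (hg : g ≠ 0) :
    ∃ ι : E2 →ₗᵢ[ℝ] E3, (∀ v, inner ℝ g (ι v) = 0) ∧ ∀ x, inner ℝ g x = 0 → ∃ v, ι v = x := by
  have : Fact (Module.finrank ℝ E3 = 2 + 1) := ⟨by simp⟩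
  have hfr : Module.finrank ℝ (Submodule.span ℝ {g})ᗮ = 2 :=
    Submodule.finrank_orthogonal_span_singleton hg
  let b := (stdOrthonormalBasis ℝ (Submodule.span ℝ {g})ᗮ).reindex (finCongr hfr)
  refine ⟨(Submodule.span ℝ {g})ᗮ.subtypeₗᵢ.comp b.repr.symm.toLinearIsometry, fun v => ?_,
    fun x hx => ?_⟩
  · exact Submodule.mem_orthogonal_singleton_iff_inner_right.mp (b.repr.symm v).2
  · have hx' : x ∈ (Submodule.span ℝ {g})ᗮ := Submodule.mem_orthogonal_singleton_iff_inner_right.mpr hx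
    exact ⟨b.repr ⟨x, hx'⟩, by simp⟩

theorem IsClosedSurface.exists_normal {Γ : Set E3} (hΓ : IsClosedSurface Γ) {x₀ : E3} (hx₀ : x₀ ∈ Γ) :
    ∃ U : Set E3, IsOpen U ∧ x₀ ∈ U ∧ ∃ N : E3 → E3, ContinuousOn N U ∧
      ∀ y ∈ Γ ∩ U, N y ≠ 0 ∧ ∀ v ∈ tangentConeAt ℝ Γ y, inner ℝ (N y) v = 0 := by
  obtain ⟨U, hU, hxU, φ, hφ, hd, hΓU⟩ := hΓ.regular x₀ hx₀
  refine ⟨U, hU, hxU, fun y => (InnerProductSpace.toDual ℝ E3).symm (fderiv ℝ φ y), ?_, ?_⟩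
  · exact (InnerProductSpace.toDual ℝ E3).symm.continuous.comp_continuousOn
      (hφ.continuousOn_fderiv_of_isOpen hU (by norm_num))
  · intro y hy
    refine ⟨by simpa using hd y hy.2, fun v hv => ?_⟩
    rw [InnerProductSpace.toDual_symm_apply]
    have h1 : HasFDerivWithinAt φ (fderiv ℝ φ y) Γ y :=
      ((hφ.contDiffAt (hU.mem_nhds hy.2)).differentiableAt (by norm_num)).hasFDerivAt.hasFDerivWithinAt
    have h2 : HasFDerivWithinAt φ (0 : E3 →L[ℝ] ℝ) Γ y := by
      refine (hasFDerivWithinAt_const (0 : ℝ) y Γ).congr_of_eventuallyEq ?_ ?_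
      · filter_upwards [inter_mem_nhdsWithin Γ (hU.mem_nhds hy.2)] with z hz
        rw [hΓU] at hz
        exact hz.2
      · rw [hΓU] at hy; exact hy.2
    exact h1.unique_on h2 hv

/-- The inverse function theorem straightens the surface: a map with derivative the identity at `x₀`
sends `Γ` into the tangent plane, and its local inverse, restricted to that plane, is the
parametrization. -/
theorem IsClosedSurface.nonempty_chart {Γ : Set E3} (hΓ : IsClosedSurface Γ) (x₀ : Γ) :
    Nonempty (SurfaceChart Γ x₀) := by
  obtain ⟨U, hU, hxU, φ, hφ, hd, hΓU⟩ := hΓ.regular x₀ x₀.2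
  set g : E3 := (InnerProductSpace.toDual ℝ E3).symm (fderiv ℝ φ x₀) with hgdef
  have hg : g ≠ 0 := by simpa [hgdef] using hd x₀ hxU
  have hgd : ∀ v, fderiv ℝ φ x₀ v = inner ℝ g v := fun v => by
    rw [hgdef, InnerProductSpace.toDual_symm_apply]
  have hgg : inner ℝ g g ≠ 0 := inner_self_ne_zero.mpr hg
  obtain ⟨ι, hι1, hι2⟩ := exists_isometry_onto_orthogonal hg
  set J : E2 →L[ℝ] E3 := ι.toContinuousLinearMap with hJ
  set P : E3 →L[ℝ] E2 := ContinuousLinearMap.adjoint J with hP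
  have hPg : P g = 0 := by
    refine ext_inner_right ℝ fun v => ?_
    rw [hP, ContinuousLinearMap.adjoint_inner_left, inner_zero_left]
    exact hι1 v
  have hPι : ∀ v, P (ι v) = v := by
    intro v
    refine ext_inner_right ℝ fun w => ?_
    rw [hP, ContinuousLinearMap.adjoint_inner_left]
    exact ι.inner_map_map v w
  have hφ0 : ∀ y : Γ, (y : E3) ∈ U → φ y = 0 := by
    intro y hy
    have : (y : E3) ∈ Γ ∩ U := ⟨y.2, hy⟩
    rw [hΓU] at this
    exact this.2
  -- The tangential part of `x - x₀` plus a normal part with coefficient `φ x / ‖g‖²`. The normal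
  -- part vanishes exactly where `φ` does, and its scaling makes the derivative at `x₀` the
  -- identity.
  let H : E3 → E3 := fun x => J (P (x - x₀)) + ((inner ℝ g g)⁻¹ * φ x) • g
  have hL : J.comp P + ((inner ℝ g g)⁻¹ • fderiv ℝ φ x₀).smulRight g =
      ((ContinuousLinearEquiv.refl ℝ E3 : E3 ≃L[ℝ] E3) : E3 →L[ℝ] E3) := by
    ext1 v
    have hv : inner ℝ g (v - ((inner ℝ g g)⁻¹ * inner ℝ g v) • g) = 0 := by
      rw [inner_sub_right, inner_smul_right]
      field_simp
      ring
    obtain ⟨u, hu⟩ := hι2 _ hv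
    have hv' : v = ι u + ((inner ℝ g g)⁻¹ * inner ℝ g v) • g := by rw [hu]; abel
    have hPv : P v = u := by rw [hv', map_add, map_smul, hPg, hPι]; simp
    change J (P v) + ((inner ℝ g g)⁻¹ * fderiv ℝ φ x₀ v) • g = v
    rw [hPv, hgd]
    exact hv'.symm
  have hH : HasStrictFDerivAt H ((ContinuousLinearEquiv.refl ℝ E3 : E3 ≃L[ℝ] E3) : E3 →L[ℝ] E3) x₀ := by
    have h1 : HasStrictFDerivAt φ (fderiv ℝ φ x₀) (x₀ : E3) :=
      (hφ.contDiffAt (hU.mem_nhds hxU)).hasStrictFDerivAt (by norm_num)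
    have h2 : HasStrictFDerivAt (fun x : E3 => J (P (x - x₀))) (J.comp P) x₀ := by
      have h3 := (J.comp P).hasStrictFDerivAt (x := (x₀ : E3)) |>.sub_const ((J.comp P) x₀)
      refine h3.congr_of_eventuallyEq (Eventually.of_forall fun x => ?_)
      simp only [map_sub, ContinuousLinearMap.comp_apply]
    rw [← hL]
    exact h2.add ((h1.const_mul (inner ℝ g g)⁻¹).smul_const g)
  have hH0 : H x₀ = 0 := by simp [H, hφ0 x₀ hxU]
  set e := hH.toOpenPartialHomeomorph H with he
  have heH : ∀ x, e x = H x := fun x => rfl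
  have hK := hH.to_localInverse
  change HasStrictFDerivAt e.symm ((ContinuousLinearEquiv.refl ℝ E3).symm : E3 →L[ℝ] E3) (H x₀) at hK
  rw [hH0] at hK
  have hsrc : (x₀ : E3) ∈ e.source := hH.mem_toOpenPartialHomeomorph_source
  have htgt : (0 : E3) ∈ e.target := by
    rw [← hH0]; exact hH.image_mem_toOpenPartialHomeomorph_target
  have hK0 : e.symm 0 = x₀ := by rw [← hH0, ← heH]; exact e.left_inv hsrc
  set F : E2 → E3 := fun z => e.symm (ι z) with hF
  have hFstrict : HasStrictFDerivAt F J 0 := by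
    have h1 : HasStrictFDerivAt (fun z : E2 => ι z) J 0 := J.hasStrictFDerivAt
    have h2 : HasStrictFDerivAt e.symm ((ContinuousLinearEquiv.refl ℝ E3).symm : E3 →L[ℝ] E3)
        (ι 0) := by rw [map_zero]; exact hK
    exact (h2.comp (0 : E2) h1).congr_fderiv (by ext1 v; rfl)
  have hlipF : ∃ s ∈ 𝓝 (0 : E2), LipschitzOnWith 2 F s := by
    refine hFstrict.exists_lipschitzOnWith_of_nnnorm_lt 2 ?_
    have : ‖J‖ ≤ 1 := ι.norm_toContinuousLinearMap_le
    rw [← NNReal.coe_lt_coe]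
    simp only [coe_nnnorm]
    norm_num
    linarith
  obtain ⟨s, hs, hslip⟩ := hlipF
  have hnear : {z : E2 | ι z ∈ e.target ∧ F z ∈ U} ∩ s ∈ 𝓝 (0 : E2) := by
    refine inter_mem (inter_mem ?_ ?_) hs
    · exact ι.continuous.continuousAt (e.open_target.mem_nhds (by simpa using htgt))
    · refine hFstrict.continuousAt (hU.mem_nhds ?_)
      simpa [hF, hK0] using hxU
  obtain ⟨r, hr, hrsub⟩ := Metric.nhds_basis_closedBall.mem_iff.mp hnear
  -- Taking the inner product of `H (F z) = ι z` with the normal `g` isolates `φ (F z)` and shows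
  -- that it is zero.
  have hmem : ∀ z : E2, ‖z‖ ≤ r → F z ∈ Γ := by
    intro z hz
    obtain ⟨⟨h1, h2⟩, -⟩ := hrsub (by simpa using hz)
    have h3 : H (F z) = ι z := by rw [← heH]; exact e.right_inv h1
    have h4 : φ (F z) = 0 := by
      have := congrArg (fun x => inner ℝ g x) h3
      simp only [H, inner_add_right, inner_smul_right, hι1] at this
      have h5 : inner ℝ g (J (P (F z - x₀))) = 0 := hι1 _
      rw [h5, zero_add, mul_right_comm, inv_mul_cancel₀ hgg, one_mul] at this
      exact this
    have : F z ∈ Γ ∩ U := by rw [hΓU]; exact ⟨h2, h4⟩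
    exact this.1
  -- Precomposing with `radialClamp` yields a continuous map on the whole plane with values in `Γ`,
  -- without altering it on the disk.
  let ψ : E2 → Γ := fun z => ⟨F (radialClamp r z), hmem _ (norm_radialClamp_le hr z)⟩
  have hψ : ∀ z, ‖z‖ ≤ r → (ψ z : E3) = F z := by
    intro z hz
    simp only [ψ, radialClamp_of_norm_le hr hz]
  have hψcont : Continuous ψ := by
    refine Continuous.subtype_mk ?_ _
    refine e.continuousOn_symm.comp_continuous (ι.continuous.comp (continuous_radialClamp hr)) ?_
    intro z
    exact (hrsub (by simpa using norm_radialClamp_le hr z)).1.1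
  have hψev : (fun z => (ψ z : E3)) =ᶠ[𝓝 0] F := by
    filter_upwards [Metric.ball_mem_nhds (0 : E2) hr] with z hz
    exact hψ z (by simpa using (Metric.mem_ball.mp hz).le)
  have hψ0 : ψ 0 = x₀ := Subtype.ext (by rw [hψ 0 (by simpa using hr.le)]; simp [hF, hK0])
  have hψstrict : HasStrictFDerivAt (fun z => (ψ z : E3)) J 0 :=
    hFstrict.congr_of_eventuallyEq hψev.symm
  have hHΓ : ∀ y : Γ, (y : E3) ∈ U → H y = ι (P (y - x₀)) := by
    intro y hy
    simp [H, hφ0 y hy, hJ]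
  refine ⟨⟨ι, r, ψ, {y : Γ | (y : E3) ∈ e.source ∩ U ∧ ‖P ((y : E3) - x₀)‖ < r}, hr, hψcont, ?_, ?_,
    hψ0, ?_, fun y hy => hy.2, ?_, hψstrict, ?_, ?_⟩⟩
  · refine IsOpen.inter ((e.open_source.inter hU).preimage continuous_subtype_val) ?_
    exact isOpen_lt (P.continuous.comp (continuous_subtype_val.sub continuous_const)).norm
      continuous_const
  · exact ⟨⟨hsrc, hxU⟩, by simpa using hr⟩
  · intro z hz
    have hz' : ‖z‖ ≤ r := by simpa using (Metric.mem_ball.mp hz).le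
    obtain ⟨⟨h1, h2⟩, -⟩ := hrsub (by simpa using hz')
    have h3 : H (F z) = ι z := by rw [← heH]; exact e.right_inv h1
    have h4 := hHΓ ⟨F z, hmem z hz'⟩ h2
    rw [hψ z hz']
    simp only at h4
    rw [h3] at h4
    exact (ι.injective h4).symm
  · rintro y ⟨⟨h1, h2⟩, h3⟩
    apply Subtype.ext
    rw [hψ _ h3.le]
    change e.symm (ι (P ((y : E3) - x₀))) = y
    rw [← hHΓ y h2, ← heH]
    exact e.left_inv h1
  · intro a ha b hb
    have ha' : ‖a‖ ≤ r := by simpa using (Metric.mem_ball.mp ha).le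
    have hb' : ‖b‖ ≤ r := by simpa using (Metric.mem_ball.mp hb).le
    rw [Subtype.edist_eq, hψ a ha', hψ b hb']
    exact hslip (hrsub (by simpa using ha')).2 (hrsub (by simpa using hb')).2
  · apply le_antisymm
    · rw [Submodule.span_le]
      intro v hv
      have h1 : HasFDerivWithinAt φ (fderiv ℝ φ x₀) Γ x₀ :=
        ((hφ.contDiffAt (hU.mem_nhds hxU)).differentiableAt (by norm_num)).hasFDerivAt.hasFDerivWithinAt
      have h2 : HasFDerivWithinAt φ (0 : E3 →L[ℝ] ℝ) Γ x₀ := by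
        refine (hasFDerivWithinAt_const (0 : ℝ) (x₀ : E3) Γ).congr_of_eventuallyEq ?_ (hφ0 x₀ hxU)
        filter_upwards [inter_mem_nhdsWithin Γ (hU.mem_nhds hxU)] with z hz
        exact hφ0 ⟨z, hz.1⟩ hz.2
      have h3 := h1.unique_on h2 hv
      rw [hgd] at h3
      obtain ⟨u, hu⟩ := hι2 v h3
      exact ⟨u, hu⟩
    · rintro _ ⟨u, rfl⟩
      have h1 := hψstrict.hasFDerivAt.hasFDerivWithinAt (s := univ)
      have h2 := h1.mapsTo_tangent_cone (by simp : u ∈ tangentConeAt ℝ univ (0 : E2))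
      rw [hψ0] at h2
      refine Submodule.subset_span (tangentConeAt_mono ?_ h2)
      rintro _ ⟨z, -, rfl⟩
      exact (ψ z).2

/-! ### Continuity and local Lipschitz dependence of the particle paths. -/

namespace EvolvingSurface
variable (S : EvolvingSurface)

instance : CompactSpace S.Γ₀ := isCompact_iff_compactSpace.mp S.isClosedSurface.isCompact

/-- Projection of a time onto `[0, T]`. -/
def clamp (t : ℝ) : ℝ := projIcc 0 S.T S.T_pos.le t

theorem clamp_mem (t : ℝ) : S.clamp t ∈ Icc 0 S.T := (projIcc 0 S.T S.T_pos.le t).2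

theorem clamp_of_mem {t : ℝ} (ht : t ∈ Icc 0 S.T) : S.clamp t = t := by
  rw [clamp, projIcc_of_mem _ ht]

theorem continuous_clamp : Continuous S.clamp := continuous_subtype_val.comp continuous_projIcc

/-- The spatial derivative of the velocity field. -/
def dw (x : E3) (t : ℝ) : E3 →L[ℝ] E3 := fderiv ℝ (fun x => S.w x t) x

theorem hasFDerivAt_w_partial {x : E3} {t : ℝ} (hx : x ∈ S.Ω) (ht : t ∈ Icc 0 S.T) :
    HasFDerivAt (fun x => S.w x t)
      ((fderivWithin ℝ (fun p : E3 × ℝ => S.w p.1 p.2) (S.Ω ×ˢ Icc 0 S.T) (x, t)).comp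
        (ContinuousLinearMap.inl ℝ E3 ℝ)) x := by
  have h1 := (S.contDiffOn_w.differentiableOn (by norm_num) (x, t) ⟨hx, ht⟩).hasFDerivWithinAt
  have h2 : HasFDerivWithinAt (fun x : E3 => (x, t)) (ContinuousLinearMap.inl ℝ E3 ℝ) S.Ω x :=
    (hasFDerivAt_prodMk_left x t).hasFDerivWithinAt
  have hm : MapsTo (fun x : E3 => (x, t)) S.Ω (S.Ω ×ˢ Icc 0 S.T) := fun y hy => ⟨hy, ht⟩
  have h3 := h1.comp x h2 hm
  exact h3.hasFDerivAt (S.isOpen_Ω.mem_nhds hx)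

theorem hasFDerivAt_w {x : E3} {t : ℝ} (hx : x ∈ S.Ω) (ht : t ∈ Icc 0 S.T) :
    HasFDerivAt (fun x => S.w x t) (S.dw x t) x :=
  (S.hasFDerivAt_w_partial hx ht).differentiableAt.hasFDerivAt

theorem continuousOn_dw :
    ContinuousOn (fun p : E3 × ℝ => S.dw p.1 p.2) (S.Ω ×ˢ Icc 0 S.T) := by
  have hu : UniqueDiffOn ℝ (S.Ω ×ˢ Icc 0 S.T) :=
    S.isOpen_Ω.uniqueDiffOn.prod (uniqueDiffOn_Icc S.T_pos)
  have h := S.contDiffOn_w.continuousOn_fderivWithin hu (by norm_num)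
  refine (h.clm_comp continuousOn_const).congr (f := fun p => (fderivWithin ℝ
    (fun p : E3 × ℝ => S.w p.1 p.2) (S.Ω ×ˢ Icc 0 S.T) p).comp (ContinuousLinearMap.inl ℝ E3 ℝ)) ?_
  intro p hp
  exact (S.hasFDerivAt_w_partial hp.1 hp.2).fderiv

theorem continuousOn_path (y : S.Γ₀) : ContinuousOn (S.Φ y) (Icc 0 S.T) :=
  fun t ht => (S.flow_ode y y.2 t ht).continuousWithinAt

theorem path_mem (y : S.Γ₀) {t : ℝ} (ht : t ∈ Icc 0 S.T) : S.Φ y t ∈ S.Ω := S.flow_mem y y.2 t ht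

/-- The spatial derivative of `w` is uniformly continuous on a compact tube about the path of `x₀`,
so by the mean value inequality `w(·, t)` is close to its linearization at the path, uniformly in
`t`. -/
theorem exists_tube (x₀ : S.Γ₀) {ε : ℝ} (hε : 0 < ε) :
    ∃ r > 0, ∀ t ∈ Icc 0 S.T, ∀ a ∈ Metric.closedBall (S.Φ x₀ t) r,
      ∀ b ∈ Metric.closedBall (S.Φ x₀ t) r,
        a ∈ S.Ω ∧ ‖S.w a t - S.w b t - S.dw (S.Φ x₀ t) t (a - b)‖ ≤ ε * ‖a - b‖ := by
  have hK : IsCompact (S.Φ x₀ '' Icc 0 S.T) := isCompact_Icc.image_of_continuousOn (S.continuousOn_path x₀)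
  obtain ⟨r₀, hr₀, hsub⟩ := hK.exists_cthickening_subset_open S.isOpen_Ω
    (by rintro _ ⟨t, ht, rfl⟩; exact S.path_mem x₀ ht)
  have hmem : ∀ t ∈ Icc 0 S.T, ∀ v ∈ Metric.closedBall (0 : E3) r₀, S.Φ x₀ t + v ∈ S.Ω := by
    intro t ht v hv
    refine hsub (Metric.mem_cthickening_of_dist_le _ (S.Φ x₀ t) _ _ ⟨t, ht, rfl⟩ ?_)
    simpa [dist_eq_norm] using hv
  have hcont : ContinuousOn (fun q : ℝ × E3 => S.dw (S.Φ x₀ q.1 + q.2) q.1)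
      (Icc 0 S.T ×ˢ Metric.closedBall 0 r₀) := by
    refine S.continuousOn_dw.comp (f := fun q : ℝ × E3 => (S.Φ x₀ q.1 + q.2, q.1)) ?_ ?_
    · refine ContinuousOn.prodMk ?_ continuousOn_fst
      exact ((S.continuousOn_path x₀).comp continuousOn_fst fun q hq => hq.1).add continuousOn_snd
    · exact fun q hq => ⟨hmem q.1 hq.1 q.2 hq.2, hq.1⟩
  have huc := (isCompact_Icc.prod (isCompact_closedBall (0 : E3) r₀)).uniformContinuousOn_of_continuous hcont
  rw [Metric.uniformContinuousOn_iff_le] at huc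
  obtain ⟨δ, hδ, hδε⟩ := huc ε hε
  refine ⟨min r₀ δ, lt_min hr₀ hδ, fun t ht a ha b hb => ?_⟩
  have hin : ∀ c ∈ Metric.closedBall (S.Φ x₀ t) (min r₀ δ), c ∈ S.Ω ∧
      ‖S.dw c t - S.dw (S.Φ x₀ t) t‖ ≤ ε := by
    intro c hc
    have hc1 : ‖c - S.Φ x₀ t‖ ≤ min r₀ δ := by simpa [dist_eq_norm] using hc
    have hc0 : c - S.Φ x₀ t ∈ Metric.closedBall (0 : E3) r₀ := by
      simpa using hc1.trans (min_le_left _ _)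
    have h1 := hmem t ht _ hc0
    have h2 := hδε (t, c - S.Φ x₀ t) ⟨ht, hc0⟩ (t, 0) ⟨ht, by simpa using hr₀.le⟩ (by
      simpa [Prod.dist_eq, dist_eq_norm, hδ.le] using hc1.trans (min_le_right _ _))
    rw [add_sub_cancel] at h1
    refine ⟨h1, ?_⟩
    simpa [dist_eq_norm] using h2
  refine ⟨(hin a ha).1, ?_⟩
  exact (convex_closedBall (S.Φ x₀ t) (min r₀ δ)).norm_image_sub_le_of_norm_hasFDerivWithin_le'
    (f := fun x => S.w x t) (f' := fun x => S.dw x t)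
    (fun c hc => (S.hasFDerivAt_w (hin c hc).1 ht).hasFDerivWithinAt) (fun c hc => (hin c hc).2) hb ha

theorem exists_bound_dw_path (x₀ : S.Γ₀) : ∃ L : ℝ, 0 ≤ L ∧ ∀ t ∈ Icc 0 S.T, ‖S.dw (S.Φ x₀ t) t‖ ≤ L := by
  have h : ContinuousOn (fun t => S.dw (S.Φ x₀ t) t) (Icc 0 S.T) :=
    S.continuousOn_dw.comp (f := fun t => (S.Φ x₀ t, t))
      ((S.continuousOn_path x₀).prodMk continuousOn_id) fun t ht => ⟨S.path_mem x₀ ht, ht⟩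
  obtain ⟨L, hL⟩ := isCompact_Icc.exists_bound_of_continuousOn h
  exact ⟨max L 0, le_max_right _ _, fun t ht => (hL t ht).trans (le_max_left _ _)⟩

theorem path_hasDerivWithinAt_Ici (y : S.Γ₀) {t b : ℝ} (hb : b ≤ S.T) (ht : t ∈ Ico 0 b) :
    HasDerivWithinAt (S.Φ y) (S.w (S.Φ y t) t) (Ici t) t :=
  (S.flow_ode y y.2 t ⟨ht.1, ht.2.le.trans hb⟩).mono_of_mem_nhdsWithin
    (Icc_mem_nhdsGE_of_mem ⟨ht.1, ht.2.trans_le hb⟩)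

/-- Gronwall's inequality inside the tube, together with a first-exit argument showing that paths
starting close to `x₀` never leave it. The free radius `ρ` allows a narrower tube to be prescribed
later. -/
theorem exists_dist_path_le (x₀ : S.Γ₀) :
    ∃ r > 0, ∃ C : ℝ, 0 < C ∧ ∀ ρ, 0 < ρ → ρ ≤ r → ∀ y y' : S.Γ₀, C * dist y x₀ < ρ →
      C * dist y' x₀ < ρ → ∀ t ∈ Icc 0 S.T, S.Φ y t ∈ Metric.ball (S.Φ x₀ t) ρ ∧
        dist (S.Φ y t) (S.Φ y' t) ≤ C * dist y y' := by
  obtain ⟨r, hr, htube⟩ := S.exists_tube x₀ one_pos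
  obtain ⟨L, hL0, hL⟩ := S.exists_bound_dw_path x₀
  set K : ℝ≥0 := ⟨L + 1, by linarith⟩ with hK
  have hlip : ∀ t ∈ Icc 0 S.T, LipschitzOnWith K (fun x => S.w x t) (Metric.closedBall (S.Φ x₀ t) r) := by
    intro t ht
    refine LipschitzOnWith.of_dist_le_mul fun a ha b hb => ?_
    obtain ⟨-, h⟩ := htube t ht a ha b hb
    have h1 := norm_le_norm_add_norm_sub' (S.w a t - S.w b t) (S.dw (S.Φ x₀ t) t (a - b))
    have h2 := (S.dw (S.Φ x₀ t) t).le_opNorm (a - b)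
    have h3 := mul_le_mul_of_nonneg_right (hL t ht) (norm_nonneg (a - b))
    rw [dist_eq_norm, dist_eq_norm]
    have hKc : (K : ℝ) = L + 1 := rfl
    rw [hKc]
    linarith
  have hC : ∀ t ∈ Icc 0 S.T, Real.exp (K * t) ≤ Real.exp (K * S.T) := by
    intro t ht
    gcongr
    exact ht.2
  have key : ∀ b ∈ Icc 0 S.T, ∀ y y' : S.Γ₀,
      (∀ t ∈ Ico 0 b, S.Φ y t ∈ Metric.closedBall (S.Φ x₀ t) r) →
      (∀ t ∈ Ico 0 b, S.Φ y' t ∈ Metric.closedBall (S.Φ x₀ t) r) →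
      dist (S.Φ y b) (S.Φ y' b) ≤ Real.exp (K * S.T) * dist y y' := by
    intro b hb y y' hy hy'
    have := dist_le_of_trajectories_ODE_of_mem (v := fun t x => S.w x t) (K := K)
      (s := fun t => Metric.closedBall (S.Φ x₀ t) r) (δ := dist y y')
      (fun t ht => hlip t ⟨ht.1, ht.2.le.trans hb.2⟩)
      ((S.continuousOn_path y).mono (Icc_subset_Icc_right hb.2))
      (fun t ht => S.path_hasDerivWithinAt_Ici y hb.2 ht) hy
      ((S.continuousOn_path y').mono (Icc_subset_Icc_right hb.2))
      (fun t ht => S.path_hasDerivWithinAt_Ici y' hb.2 ht) hy'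
      (by rw [S.flow_zero y y.2, S.flow_zero y' y'.2]; exact le_rfl) b ⟨hb.1, le_rfl⟩
    rw [sub_zero] at this
    refine this.trans ?_
    rw [mul_comm]
    gcongr
    exact hb.2
  have stay : ∀ ρ, 0 < ρ → ρ ≤ r → ∀ y : S.Γ₀, Real.exp (K * S.T) * dist y x₀ < ρ →
      ∀ t ∈ Icc 0 S.T, S.Φ y t ∈ Metric.ball (S.Φ x₀ t) ρ := by
    intro ρ hρ hρr y hy t ht
    by_contra hcon
    -- The least element of this compact set is the first exit time. Up to then the path is in the
    -- tube, so Gronwall applies and keeps the distance below `ρ`, a contradiction.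
    set B := {s ∈ Icc 0 S.T | ρ ≤ dist (S.Φ y s) (S.Φ x₀ s)} with hB
    have hBc : IsCompact B := by
      refine isCompact_Icc.of_isClosed_subset ?_ (fun s hs => hs.1)
      have hd : ContinuousOn (fun s => dist (S.Φ y s) (S.Φ x₀ s)) (Icc 0 S.T) :=
        continuous_dist.comp_continuousOn ((S.continuousOn_path y).prodMk (S.continuousOn_path x₀))
      exact hd.preimage_isClosed_of_isClosed isClosed_Icc isClosed_Ici
    obtain ⟨s, hsB, hsmin⟩ := hBc.exists_isLeast ⟨t, ht, by simpa using hcon⟩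
    have h1 : ∀ τ ∈ Ico 0 s, S.Φ y τ ∈ Metric.closedBall (S.Φ x₀ τ) r := by
      intro τ hτ
      by_contra hτc
      have : τ ∈ B := ⟨⟨hτ.1, hτ.2.le.trans hsB.1.2⟩, hρr.trans (by simpa using (not_le.mp hτc).le)⟩
      exact absurd (hsmin this) (not_le.mpr hτ.2)
    have h2 := key s hsB.1 y x₀ h1 (fun τ _ => Metric.mem_closedBall_self hr.le)
    exact absurd (hsB.2.trans h2) (not_le.mpr hy)
  refine ⟨r, hr, Real.exp (K * S.T), Real.exp_pos _, fun ρ hρ hρr y y' hy hy' t ht =>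
    ⟨stay ρ hρ hρr y hy t ht, key t ht y y' ?_ ?_⟩⟩
  · exact fun τ hτ => Metric.ball_subset_closedBall
      (Metric.ball_subset_ball hρr (stay ρ hρ hρr y hy τ ⟨hτ.1, hτ.2.le.trans ht.2⟩))
  · exact fun τ hτ => Metric.ball_subset_closedBall
      (Metric.ball_subset_ball hρr (stay ρ hρ hρr y' hy' τ ⟨hτ.1, hτ.2.le.trans ht.2⟩))

/-- The particle path of `y ∈ Γ₀`, extended as a constant outside `[0, T]`. -/
def flow (y : S.Γ₀) (t : ℝ) : E3 := S.Φ y (S.clamp t)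

theorem flow_of_mem (y : S.Γ₀) {t : ℝ} (ht : t ∈ Icc 0 S.T) : S.flow y t = S.Φ y t := by
  rw [flow, S.clamp_of_mem ht]

theorem flow_mem_Ω (y : S.Γ₀) (t : ℝ) : S.flow y t ∈ S.Ω := S.path_mem y (S.clamp_mem t)

theorem exists_lipschitz_flow (x₀ : S.Γ₀) :
    ∃ U ∈ 𝓝 x₀, ∃ C : ℝ≥0, ∀ t, LipschitzOnWith C (fun y => S.flow y t) U := by
  obtain ⟨r, hr, C, hC, h⟩ := S.exists_dist_path_le x₀
  have hball : ∀ y ∈ Metric.ball x₀ (r / C), C * dist y x₀ < r := by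
    intro y hy
    rw [mul_comm]
    exact (lt_div_iff₀ hC).mp hy
  refine ⟨_, Metric.ball_mem_nhds x₀ (div_pos hr hC), ⟨C, hC.le⟩, fun t => ?_⟩
  refine LipschitzOnWith.of_dist_le_mul fun y hy y' hy' => ?_
  exact (h r hr le_rfl y y' (hball y hy) (hball y' hy') _ (S.clamp_mem t)).2

theorem continuous_flow : Continuous fun p : S.Γ₀ × ℝ => S.flow p.1 p.2 := by
  rw [continuous_iff_continuousAt]
  rintro ⟨x₀, t₀⟩
  obtain ⟨U, hU, C, hC⟩ := S.exists_lipschitz_flow x₀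
  have hpath : Continuous (S.flow x₀) :=
    (S.continuousOn_path x₀).comp_continuous S.continuous_clamp S.clamp_mem
  rw [ContinuousAt, tendsto_iff_dist_tendsto_zero]
  have hb : Tendsto (fun p : S.Γ₀ × ℝ => C * dist p.1 x₀ + dist (S.flow x₀ p.2) (S.flow x₀ t₀))
      (𝓝 (x₀, t₀)) (𝓝 0) := by
    have : Continuous (fun p : S.Γ₀ × ℝ => C * dist p.1 x₀ + dist (S.flow x₀ p.2) (S.flow x₀ t₀)) := by
      fun_prop
    simpa using this.tendsto (x₀, t₀)
  refine squeeze_zero' (Eventually.of_forall fun _ => dist_nonneg) ?_ hb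
  filter_upwards [prod_mem_nhds hU univ_mem] with p hp
  refine (dist_triangle _ (S.flow x₀ p.2) _).trans ?_
  gcongr
  exact (hC p.2).dist_le_mul p.1 hp.1 x₀ (mem_of_mem_nhds hU)

end EvolvingSurface

/-! ### Differentiability and injectivity of the flow. -/

/-- The family is one curve in the Banach algebra `C(X, R)`. Solving a single equation there makes
the solutions jointly continuous in parameter and time. Composing with `c` extends them to all
times. -/
theorem exists_fundamental_solution_param {X R : Type*} [TopologicalSpace X] [CompactSpace X]
    [NormedRing R] [NormedAlgebra ℝ R] [CompleteSpace R] {A : X → ℝ → R} {T : ℝ} (hT : 0 ≤ T)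
    (hA : Continuous fun p : X × ℝ => A p.1 p.2) {c : ℝ → ℝ} (hc : Continuous c)
    (hc1 : ∀ t, c t ∈ Icc 0 T) (hc2 : ∀ t ∈ Icc 0 T, c t = t) :
    ∃ M N : X → ℝ → R, (∀ y, M y 0 = 1) ∧
    (∀ y, ∀ t ∈ Icc 0 T, HasDerivWithinAt (M y) (A y t * M y t) (Icc 0 T) t) ∧
    (∀ y t, N y t * M y t = 1) ∧ Continuous (fun p : X × ℝ => M p.1 p.2) ∧
    Continuous (fun p : X × ℝ => N p.1 p.2) := by
  let B : C(ℝ, C(X, R)) := ContinuousMap.curry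
    ⟨fun p : ℝ × X => A p.2 p.1, hA.comp continuous_swap⟩
  obtain ⟨M, N, hM0, hM, hNM, hN⟩ :=
    exists_fundamental_solution (R := C(X, R)) (A := B) hT (B.continuous.continuousOn (s := Icc 0 T))
  have h0 : (0 : ℝ) ∈ Icc 0 T := ⟨le_rfl, hT⟩
  have hev : ∀ F : ℝ → C(X, R), ContinuousOn F (Icc 0 T) →
      Continuous (fun p : X × ℝ => F (c p.2) p.1) := by
    intro F hF
    have h1 : Continuous (fun t => F (c t)) := hF.comp_continuous hc hc1
    have h2 : Continuous (fun q : C(X, R) × X => q.1 q.2) := continuous_eval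
    exact h2.comp ((h1.comp continuous_snd).prodMk continuous_fst)
  refine ⟨fun y t => M (c t) y, fun y t => N (c t) y, fun y => ?_, fun y t ht => ?_,
    fun y t => ?_, hev M fun t ht => (hM t ht).continuousWithinAt, hev N hN⟩
  · simp only [hc2 0 h0, hM0, ContinuousMap.one_apply]
  · have h1 := ((ContinuousMap.evalCLM ℝ y).hasFDerivAt (x := M t)).comp_hasDerivWithinAt t (hM t ht)
    have h2 : HasDerivWithinAt (fun t => M t y) (A y t * M t y) (Icc 0 T) t := h1
    simp only [hc2 t ht]
    refine h2.congr (fun s hs => ?_) ?_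
    · simp only [hc2 s hs]
    · simp only [hc2 t ht]
  · have := congrArg (fun F : C(X, R) => F y) (hNM _ (hc1 t))
    simpa using this

namespace EvolvingSurface
variable (S : EvolvingSurface)

/-- The spatial derivative of the velocity along the particle paths. -/
def dwFlow (y : S.Γ₀) (t : ℝ) : E3 →L[ℝ] E3 := S.dw (S.flow y t) (S.clamp t)

theorem continuous_dwFlow : Continuous fun p : S.Γ₀ × ℝ => S.dwFlow p.1 p.2 :=
  S.continuousOn_dw.comp_continuous
    (S.continuous_flow.prodMk (S.continuous_clamp.comp continuous_snd))
    fun p => ⟨S.flow_mem_Ω p.1 p.2, S.clamp_mem p.2⟩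

theorem exists_flowDeriv : ∃ M N : S.Γ₀ → ℝ → E3 →L[ℝ] E3, (∀ y, M y 0 = 1) ∧
    (∀ y, ∀ t ∈ Icc 0 S.T, HasDerivWithinAt (M y) (S.dwFlow y t * M y t) (Icc 0 S.T) t) ∧
    (∀ y t, N y t * M y t = 1) ∧ Continuous (fun p : S.Γ₀ × ℝ => M p.1 p.2) ∧
    Continuous (fun p : S.Γ₀ × ℝ => N p.1 p.2) :=
  exists_fundamental_solution_param S.T_pos.le S.continuous_dwFlow S.continuous_clamp S.clamp_mem
    fun _ => S.clamp_of_mem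

/-- The derivative of the flow with respect to the initial position. -/
def flowDeriv : S.Γ₀ → ℝ → E3 →L[ℝ] E3 := S.exists_flowDeriv.choose

/-- The inverse of the derivative of the flow with respect to the initial position. -/
def flowDerivInv : S.Γ₀ → ℝ → E3 →L[ℝ] E3 := S.exists_flowDeriv.choose_spec.choose

theorem flowDeriv_zero (y : S.Γ₀) : S.flowDeriv y 0 = 1 :=
  S.exists_flowDeriv.choose_spec.choose_spec.1 y

theorem hasDerivWithinAt_flowDeriv (y : S.Γ₀) {t : ℝ} (ht : t ∈ Icc 0 S.T) :
    HasDerivWithinAt (S.flowDeriv y) (S.dwFlow y t * S.flowDeriv y t) (Icc 0 S.T) t :=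
  S.exists_flowDeriv.choose_spec.choose_spec.2.1 y t ht

theorem flowDerivInv_flowDeriv (y : S.Γ₀) (t : ℝ) (v : E3) :
    S.flowDerivInv y t (S.flowDeriv y t v) = v :=
  congrArg (fun F : E3 →L[ℝ] E3 => F v) (S.exists_flowDeriv.choose_spec.choose_spec.2.2.1 y t)

theorem continuous_flowDerivInv : Continuous (fun p : S.Γ₀ × ℝ => S.flowDerivInv p.1 p.2) :=
  S.exists_flowDeriv.choose_spec.choose_spec.2.2.2.2

theorem flowDeriv_injective (y : S.Γ₀) (t : ℝ) : Function.Injective (S.flowDeriv y t) :=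
  (show Function.LeftInverse (S.flowDerivInv y t) _ from S.flowDerivInv_flowDeriv y t).injective

theorem flowDeriv_flowDerivInv (y : S.Γ₀) (t : ℝ) (v : E3) :
    S.flowDeriv y t (S.flowDerivInv y t v) = v := by
  obtain ⟨u, rfl⟩ := (LinearMap.injective_iff_surjective (f := (S.flowDeriv y t).toLinearMap)).mp
    (S.flowDeriv_injective y t) v
  exact congrArg _ (S.flowDerivInv_flowDeriv y t u)

/-- Strict differentiability of the flow along `Γ₀`, uniformly in time. The error satisfies the
variational equation up to a source that is small relative to `dist y y'`, and it starts at zero, so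
Gronwall bounds it. -/
theorem exists_flow_sub_le (x₀ : S.Γ₀) {ε : ℝ} (hε : 0 < ε) :
    ∃ U ∈ 𝓝 x₀, ∀ y ∈ U, ∀ y' ∈ U, ∀ t ∈ Icc 0 S.T,
      ‖S.flow y t - S.flow y' t - S.flowDeriv x₀ t ((y : E3) - y')‖ ≤ ε * dist y y' := by
  obtain ⟨r, hr, C, hC, hstay⟩ := S.exists_dist_path_le x₀
  obtain ⟨L, hL0, hL⟩ := S.exists_bound_dw_path x₀
  set K := L + 1 with hK
  have hKpos : 0 < K := by linarith
  -- `G` collects the losses: `C` from the distance of the two paths and `exp(K T)/K` from Gronwall.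
  -- A tube with accuracy `ε / G` therefore ends with accuracy `ε`.
  set G := C / K * (Real.exp (K * S.T)) with hG
  have hGpos : 0 < G := by positivity
  obtain ⟨r', hr', htube⟩ := S.exists_tube x₀ (div_pos hε hGpos)
  set ρ := min r r' with hρ
  have hρ0 : 0 < ρ := lt_min hr hr'
  have hball : ∀ y ∈ Metric.ball x₀ (ρ / C), C * dist y x₀ < ρ := by
    intro y hy
    rw [mul_comm]
    exact (lt_div_iff₀ hC).mp hy
  refine ⟨_, Metric.ball_mem_nhds x₀ (div_pos hρ0 hC), fun y hy y' hy' t ht => ?_⟩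
  have hs := hstay ρ hρ0 (min_le_left _ _) y y' (hball y hy) (hball y' hy')
  have hs' := hstay ρ hρ0 (min_le_left _ _) y' y (hball y' hy') (hball y hy)
  have htr : ∀ s ∈ Icc 0 S.T, ‖S.w (S.Φ y s) s - S.w (S.Φ y' s) s -
      S.dw (S.Φ x₀ s) s (S.Φ y s - S.Φ y' s)‖ ≤ ε / G * (C * dist y y') := by
    intro s hs0
    have h1 := (htube s hs0 _ (Metric.ball_subset_closedBall (Metric.ball_subset_ball (min_le_right _ _)
      (hs s hs0).1)) _ (Metric.ball_subset_closedBall (Metric.ball_subset_ball (min_le_right _ _)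
      (hs' s hs0).1))).2
    refine h1.trans ?_
    rw [← dist_eq_norm]
    gcongr
    exact (hs s hs0).2
  set h : ℝ → E3 := fun s => S.Φ y s - S.Φ y' s - S.flowDeriv x₀ s ((y : E3) - y') with hh
  have hder : ∀ s ∈ Icc 0 S.T, HasDerivWithinAt h (S.w (S.Φ y s) s - S.w (S.Φ y' s) s -
      S.dw (S.Φ x₀ s) s (S.flowDeriv x₀ s ((y : E3) - y'))) (Icc 0 S.T) s := by
    intro s hs0
    have h1 := (S.hasDerivWithinAt_flowDeriv x₀ hs0).clm_apply
      (hasDerivWithinAt_const s (Icc 0 S.T) ((y : E3) - y'))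
    have h2 := ((S.flow_ode y y.2 s hs0).sub (S.flow_ode y' y'.2 s hs0)).sub h1
    convert! h2 using 1
    simp [dwFlow, S.flow_of_mem x₀ hs0, S.clamp_of_mem hs0]
  have hgr := norm_le_gronwallBound_of_norm_deriv_right_le (f := h) (δ := 0) (K := K)
    (ε := ε / G * (C * dist y y')) (a := 0) (b := S.T)
    (fun s hs0 => (hder s hs0).continuousWithinAt)
    (fun s hs0 => (hder s ⟨hs0.1, hs0.2.le⟩).mono_of_mem_nhdsWithin (Icc_mem_nhdsGE_of_mem hs0))
    (by simp [hh, S.flow_zero y y.2, S.flow_zero y' y'.2, S.flowDeriv_zero]) ?_ t ht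
  · rw [S.flow_of_mem y ht, S.flow_of_mem y' ht]
    refine hgr.trans ?_
    rw [gronwallBound_of_K_ne_0 hKpos.ne']
    simp only [zero_mul, zero_add, sub_zero]
    have hexp : Real.exp (K * t) - 1 ≤ Real.exp (K * S.T) := by
      have : Real.exp (K * t) ≤ Real.exp (K * S.T) := by
        gcongr
        exact ht.2
      linarith
    calc ε / G * (C * dist y y') / K * (Real.exp (K * t) - 1)
        ≤ ε / G * (C * dist y y') / K * Real.exp (K * S.T) := by gcongr
      _ = ε / G * G * dist y y' := by rw [hG]; ring
      _ = ε * dist y y' := by rw [div_mul_cancel₀ _ hGpos.ne']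
  · intro s hs0
    have hs1 : s ∈ Icc 0 S.T := ⟨hs0.1, hs0.2.le⟩
    have e1 : S.w (S.Φ y s) s - S.w (S.Φ y' s) s -
        S.dw (S.Φ x₀ s) s (S.flowDeriv x₀ s ((y : E3) - y')) =
        S.dw (S.Φ x₀ s) s (h s) + (S.w (S.Φ y s) s - S.w (S.Φ y' s) s -
          S.dw (S.Φ x₀ s) s (S.Φ y s - S.Φ y' s)) := by
      simp only [hh, map_sub]
      abel
    rw [e1]
    refine (norm_add_le _ _).trans (add_le_add ?_ (htr s hs1))
    refine ((S.dw (S.Φ x₀ s) s).le_opNorm _).trans ?_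
    gcongr
    exact (hL s hs1).trans (by linarith)

theorem flow_clamp (y : S.Γ₀) (t : ℝ) : S.flow y (S.clamp t) = S.flow y t := by
  rw [S.flow_of_mem y (S.clamp_mem t), flow]

/-- Backward uniqueness: `w` is Lipschitz in space on the compact set swept by the surface, so paths
that meet at one time agree at all earlier times and share their starting point. -/
theorem flow_injective (t : ℝ) : Function.Injective fun y => S.flow y t := by
  have hloc : LocallyLipschitzOn (S.Ω ×ˢ Icc 0 S.T) (fun p : E3 × ℝ => S.w p.1 p.2) := by
    rintro ⟨x, t⟩ hp
    obtain ⟨r, hr, hball⟩ := Metric.isOpen_iff.mp S.isOpen_Ω x hp.1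
    have hsub : Metric.ball x r ×ˢ Icc 0 S.T ⊆ S.Ω ×ˢ Icc 0 S.T := prod_mono hball subset_rfl
    have h1 : ContDiffWithinAt ℝ 1 (fun p : E3 × ℝ => S.w p.1 p.2) (Metric.ball x r ×ˢ Icc 0 S.T) (x, t) :=
      ((S.contDiffOn_w (x, t) hp).mono hsub).of_le (by norm_num)
    obtain ⟨K, s, hs, hK⟩ := h1.exists_lipschitzOnWith ((convex_ball x r).prod (convex_Icc 0 S.T))
    refine ⟨K, s, ?_, hK⟩
    have hs' : s ∈ 𝓝[(Metric.ball x r ×ˢ univ) ∩ (S.Ω ×ˢ Icc 0 S.T)] (x, t) := by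
      refine nhdsWithin_mono _ ?_ hs
      rintro q ⟨⟨h1, -⟩, -, h2⟩
      exact ⟨h1, h2⟩
    rwa [inter_comm, nhdsWithin_inter_of_mem'] at hs'
    exact mem_nhdsWithin_of_mem_nhds (prod_mem_nhds (Metric.ball_mem_nhds x hr) univ_mem)
  have hKc : IsCompact ((fun p : S.Γ₀ × ℝ => (S.flow p.1 p.2, p.2)) '' (univ ×ˢ Icc 0 S.T)) :=
    (isCompact_univ.prod isCompact_Icc).image (S.continuous_flow.prodMk continuous_snd)
  obtain ⟨K, hK⟩ := (hloc.mono (t := S.Ω ×ˢ Icc 0 S.T) (s := (fun p : S.Γ₀ × ℝ =>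
    (S.flow p.1 p.2, p.2)) '' (univ ×ˢ Icc 0 S.T)) (by
      rintro _ ⟨p, hp, rfl⟩
      exact ⟨S.flow_mem_Ω _ _, hp.2⟩)).exists_lipschitzOnWith_of_compact hKc
  intro y y' hyy'
  have hc := S.clamp_mem t
  have hlip : ∀ s ∈ Ioc 0 (S.clamp t), LipschitzOnWith K (fun x => S.w x s) (range fun y => S.flow y s) := by
    intro s hs
    have hs' : s ∈ Icc 0 S.T := ⟨hs.1.le, hs.2.trans hc.2⟩
    rintro _ ⟨a, rfl⟩ _ ⟨b, rfl⟩
    have := hK ⟨(a, s), ⟨mem_univ _, hs'⟩, rfl⟩ ⟨(b, s), ⟨mem_univ _, hs'⟩, rfl⟩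
    simpa [Prod.edist_eq] using this
  have hIic : ∀ y : S.Γ₀, ∀ s ∈ Ioc 0 (S.clamp t),
      HasDerivWithinAt (S.Φ y) (S.w (S.Φ y s) s) (Iic s) s := by
    intro y s hs
    exact (S.flow_ode y y.2 s ⟨hs.1.le, hs.2.trans hc.2⟩).mono_of_mem_nhdsWithin
      (Icc_mem_nhdsLE_of_mem ⟨hs.1, hs.2.trans hc.2⟩)
  have hmem : ∀ y : S.Γ₀, ∀ s ∈ Ioc 0 (S.clamp t), S.Φ y s ∈ range fun y => S.flow y s := by
    intro y s hs
    exact ⟨y, S.flow_of_mem y ⟨hs.1.le, hs.2.trans hc.2⟩⟩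
  have := ODE_solution_unique_of_mem_Icc_left hlip
    ((S.continuousOn_path y).mono (Icc_subset_Icc_right hc.2)) (hIic y) (hmem y)
    ((S.continuousOn_path y').mono (Icc_subset_Icc_right hc.2)) (hIic y') (hmem y') hyy'
    (show (0 : ℝ) ∈ Icc 0 (S.clamp t) from ⟨le_rfl, hc.1⟩)
  rw [S.flow_zero y y.2, S.flow_zero y' y'.2] at this
  exact Subtype.ext this

theorem range_flow {t : ℝ} (ht : t ∈ Icc 0 S.T) : range (fun y => S.flow y t) = S.Γ t := by
  ext x
  simp only [mem_range, Subtype.exists, Γ, mem_image, flow]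
  simp only [S.clamp_of_mem ht, exists_prop]

theorem isClosedEmbedding_flow (t : ℝ) : IsClosedEmbedding fun y => S.flow y t :=
  Continuous.isClosedEmbedding (S.continuous_flow.comp (by fun_prop : Continuous fun y : S.Γ₀ => (y, t)))
    (S.flow_injective t)

end EvolvingSurface

/-! ### Moving tangent planes and the evolution of the area element. -/

theorem trace_smulRight_comp {E : Type*} [NormedAddCommGroup E] [InnerProductSpace ℝ E]
    [FiniteDimensional ℝ E] (f : E →L[ℝ] ℝ) (c : E) (A : E →L[ℝ] E) :
    LinearMap.trace ℝ E ((f.smulRight c).comp A).toLinearMap = f (A c) := by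
  have : ((f.smulRight c).comp A).toLinearMap = LinearMap.smulRight (f.comp A).toLinearMap c := by
    ext v; rfl
  rw [this, LinearMap.trace_smulRight]
  rfl

theorem starProjection_orthogonal_singleton (v : E3) :
    (Submodule.span ℝ {v})ᗮ.starProjection =
      ContinuousLinearMap.id ℝ E3 - (‖v‖ ^ 2)⁻¹ • (innerSL ℝ v).smulRight v := by
  ext1 x
  rw [Submodule.starProjection_orthogonal]
  simp only [sub_apply, ContinuousLinearMap.id_apply, smul_apply,
    ContinuousLinearMap.smulRight_apply, innerSL_apply_apply, Submodule.starProjection_singleton]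
  rw [smul_smul, div_eq_inv_mul]
  rfl

/-- The trace of a linear map over the plane spanned by two vectors, in terms of these vectors. -/
theorem trace_starProjection_comp_mul_gram2 (a b : E3) (A : E3 →L[ℝ] E3) (hab : gram2 a b ≠ 0) :
    LinearMap.trace ℝ E3 ((Submodule.span ℝ {a, b}).starProjection.comp A).toLinearMap * gram2 a b =
      inner ℝ a (A a) * ‖b‖ ^ 2 + ‖a‖ ^ 2 * inner ℝ b (A b) -
        inner ℝ a b * (inner ℝ (A a) b + inner ℝ a (A b)) := by
  set G := gram2 a b with hG
  -- `f` and `g` are the coordinates with respect to `a`, `b` of the orthogonal projection onto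
  -- their span, from Cramer's rule for the Gram matrix.
  let f : E3 →L[ℝ] ℝ := G⁻¹ • (‖b‖ ^ 2 • innerSL ℝ a - inner ℝ a b • innerSL ℝ b)
  let g : E3 →L[ℝ] ℝ := G⁻¹ • (‖a‖ ^ 2 • innerSL ℝ b - inner ℝ a b • innerSL ℝ a)
  have hf : ∀ v, f v = G⁻¹ * (‖b‖ ^ 2 * inner ℝ a v - inner ℝ a b * inner ℝ b v) := fun v => rfl
  have hg : ∀ v, g v = G⁻¹ * (‖a‖ ^ 2 * inner ℝ b v - inner ℝ a b * inner ℝ a v) := fun v => rfl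
  have hP : (Submodule.span ℝ {a, b}).starProjection = f.smulRight a + g.smulRight b := by
    ext1 v
    refine Submodule.eq_starProjection_of_mem_of_inner_eq_zero ?_ ?_
    · exact Submodule.mem_span_pair.mpr ⟨f v, g v, rfl⟩
    · intro w hw
      obtain ⟨s, t, rfl⟩ := Submodule.mem_span_pair.mp hw
      have hba : inner ℝ b a = inner ℝ a b := real_inner_comm _ _
      have hva : inner ℝ v a = inner ℝ a v := real_inner_comm _ _
      have hvb : inner ℝ v b = inner ℝ b v := real_inner_comm _ _
      have haa : inner ℝ a a = ‖a‖ ^ 2 := real_inner_self_eq_norm_sq a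
      have hbb : inner ℝ b b = ‖b‖ ^ 2 := real_inner_self_eq_norm_sq b
      simp only [add_apply, ContinuousLinearMap.smulRight_apply, inner_sub_left,
        inner_add_left, inner_add_right, inner_smul_left, inner_smul_right, RCLike.conj_to_real,
        hba, hva, hvb, haa, hbb, hf, hg]
      have hG' : G = ‖a‖ ^ 2 * ‖b‖ ^ 2 - inner ℝ a b ^ 2 := rfl
      field_simp
      rw [hG']
      ring
  rw [hP, ContinuousLinearMap.add_comp]
  have : LinearMap.trace ℝ E3 (((f.smulRight a).comp A + (g.smulRight b).comp A).toLinearMap) =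
      LinearMap.trace ℝ E3 ((f.smulRight a).comp A).toLinearMap +
      LinearMap.trace ℝ E3 ((g.smulRight b).comp A).toLinearMap := map_add _ _ _
  rw [this, trace_smulRight_comp, trace_smulRight_comp, hf, hg, real_inner_comm b (A a)]
  field_simp
  ring

namespace EvolvingSurface
variable (S : EvolvingSurface)

/-- A chart of the initial surface about one of its points. -/
def chart (y : S.Γ₀) : SurfaceChart S.Γ₀ y := (S.isClosedSurface.nonempty_chart y).some

/-- The differential of the flow on the tangent plane of the initial surface. -/
def tangentMap (y : S.Γ₀) (t : ℝ) : E2 →L[ℝ] E3 :=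
  (S.flowDeriv y t).comp (S.chart y).ι.toContinuousLinearMap

theorem tangentMap_injective (y : S.Γ₀) (t : ℝ) : Function.Injective (S.tangentMap y t) :=
  (S.flowDeriv_injective y t).comp (S.chart y).ι.injective

theorem isLittleO_flow (y : S.Γ₀) {t : ℝ} (ht : t ∈ Icc 0 S.T) :
    (fun q : S.Γ₀ × S.Γ₀ => S.flow q.1 t - S.flow q.2 t - S.flowDeriv y t ((q.1 : E3) - q.2))
      =o[𝓝 (y, y)] fun q : S.Γ₀ × S.Γ₀ => (q.1 : E3) - q.2 := by
  rw [Asymptotics.isLittleO_iff]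
  intro ε hε
  obtain ⟨U, hU, h⟩ := S.exists_flow_sub_le y hε
  filter_upwards [prod_mem_nhds hU hU] with q hq
  rw [← dist_eq_norm (q.1 : E3)]
  exact h q.1 hq.1 q.2 hq.2 t ht

/-- A chain rule carried out on the remainder estimates, since the flow is defined only on `Γ₀` and
has no derivative in the ambient space. -/
theorem hasStrictFDerivAt_flow_chart (y : S.Γ₀) {t : ℝ} (ht : t ∈ Icc 0 S.T) :
    HasStrictFDerivAt (fun z => S.flow ((S.chart y).ψ z) t) (S.tangentMap y t) 0 := by
  have hψ := (S.chart y).hasStrictFDerivAt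
  have htend : Tendsto (fun p : E2 × E2 => ((S.chart y).ψ p.1, (S.chart y).ψ p.2))
      (𝓝 ((0 : E2), (0 : E2))) (𝓝 (y, y)) := by
    have : Continuous (fun p : E2 × E2 => ((S.chart y).ψ p.1, (S.chart y).ψ p.2)) :=
      ((S.chart y).continuous_ψ.comp continuous_fst).prodMk
        ((S.chart y).continuous_ψ.comp continuous_snd)
    simpa [(S.chart y).ψ_zero] using this.tendsto (0, 0)
  have h1 := ((S.isLittleO_flow y ht).comp_tendsto htend).trans_isBigO hψ.isBigO_sub
  have h2 := ((S.flowDeriv y t).isBigO_comp _ _).trans_isLittleO hψ.isLittleO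
  refine HasStrictFDerivAt.of_isLittleO ((h1.add h2).congr_left fun p => ?_)
  simp [tangentMap]

/-- Because `flowDeriv` has a left inverse, `y' - y` is bounded by the displacement of the images,
so the remainder of the flow is also small relative to that displacement. The embedding identifies
the neighbourhood filters. -/
theorem hasFDerivWithinAt_invFun_flow (y : S.Γ₀) {t : ℝ} (ht : t ∈ Icc 0 S.T) :
    HasFDerivWithinAt (fun x => ((Function.extend (fun y => S.flow y t) Subtype.val 0 x : E3)))
      (S.flowDerivInv y t) (S.Γ t) (S.flow y t) := by
  have hext : ∀ y : S.Γ₀, Function.extend (fun y => S.flow y t) Subtype.val 0 (S.flow y t) = (y : E3) :=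
    fun y => (S.flow_injective t).extend_apply _ _ y
  have ho : (fun y' : S.Γ₀ => S.flow y' t - S.flow y t - S.flowDeriv y t ((y' : E3) - y))
      =o[𝓝 y] fun y' : S.Γ₀ => (y' : E3) - y := by
    have htend : Tendsto (fun y' : S.Γ₀ => (y', y)) (𝓝 y) (𝓝 (y, y)) :=
      (by fun_prop : Continuous fun y' : S.Γ₀ => (y', y)).tendsto y
    exact (S.isLittleO_flow y ht).comp_tendsto htend
  have hO : (fun y' : S.Γ₀ => (y' : E3) - y) =O[𝓝 y] fun y' => S.flowDeriv y t ((y' : E3) - y) := by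
    refine ((S.flowDerivInv y t).isBigO_comp (fun y' : S.Γ₀ => S.flowDeriv y t ((y' : E3) - y))
      (𝓝 y)).congr_left fun y' => ?_
    exact S.flowDerivInv_flowDeriv y t _
  have hO2 : (fun y' : S.Γ₀ => (y' : E3) - y) =O[𝓝 y] fun y' => S.flow y' t - S.flow y t := by
    refine hO.trans ((ho.trans_isBigO hO).right_isBigO_add.congr_right fun y' => ?_)
    simp
  refine HasFDerivWithinAt.of_isLittleO ?_
  rw [← S.range_flow ht, ← (S.isClosedEmbedding_flow t).isInducing.map_nhds_eq]
  rw [Asymptotics.isLittleO_map]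
  refine ((((S.flowDerivInv y t).isBigO_comp _ _).trans_isLittleO ho).neg_left.trans_isBigO
    hO2).congr_left fun y' => ?_
  simp only [Function.comp, hext, map_sub, S.flowDerivInv_flowDeriv]
  abel

theorem flow_mem_Γ (y : S.Γ₀) {t : ℝ} (ht : t ∈ Icc 0 S.T) : S.flow y t ∈ S.Γ t := by
  rw [← S.range_flow ht]; exact ⟨y, rfl⟩

/-- Tangent vectors of `Γ(t)` are pulled back by the derivative of the inverse flow and tangent
vectors of `Γ₀` are pushed forward through the chart, which gives the two inclusions. -/
theorem span_tangentCone_flow (y : S.Γ₀) {t : ℝ} (ht : t ∈ Icc 0 S.T) :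
    Submodule.span ℝ (tangentConeAt ℝ (S.Γ t) (S.flow y t)) =
      LinearMap.range (S.tangentMap y t).toLinearMap := by
  apply le_antisymm
  · rw [Submodule.span_le]
    intro v hv
    have h1 := (S.hasFDerivWithinAt_invFun_flow y ht).mapsTo_tangent_cone hv
    have hsub : (fun x => ((Function.extend (fun y => S.flow y t) Subtype.val 0 x : E3))) '' S.Γ t ⊆ S.Γ₀ := by
      rintro _ ⟨x, hx, rfl⟩
      rw [← S.range_flow ht] at hx
      obtain ⟨y', rfl⟩ := hx
      simp only [(S.flow_injective t).extend_apply]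
      exact y'.2
    have h2 := Submodule.subset_span (R := ℝ) (tangentConeAt_mono hsub h1)
    rw [(S.flow_injective t).extend_apply, (S.chart y).span_tangentCone] at h2
    obtain ⟨u, hu⟩ := h2
    refine ⟨u, ?_⟩
    change S.flowDeriv y t ((S.chart y).ι u) = v
    change (S.chart y).ι u = _ at hu
    rw [hu, S.flowDeriv_flowDerivInv]
  · rintro _ ⟨u, rfl⟩
    have h1 := (S.hasStrictFDerivAt_flow_chart y ht).hasFDerivAt.hasFDerivWithinAt (s := univ)
    have h2 := h1.mapsTo_tangent_cone (by simp : u ∈ tangentConeAt ℝ univ (0 : E2))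
    rw [(S.chart y).ψ_zero] at h2
    refine Submodule.subset_span (tangentConeAt_mono ?_ h2)
    rintro _ ⟨z, -, rfl⟩
    exact S.flow_mem_Γ _ ht

/-- The tangential projection of the moving surface, along the flow. -/
def projFlow (y : S.Γ₀) (t : ℝ) : E3 →L[ℝ] E3 := tangentProj (S.Γ (S.clamp t)) (S.flow y t)

/-- Normals are transported by the inverse transpose of the flow derivative. Locally this provides a
continuous nonvanishing normal field, hence continuity of the tangential projection. -/
theorem exists_projFlow_eq (x₀ : S.Γ₀) : ∃ U : Set S.Γ₀, IsOpen U ∧ x₀ ∈ U ∧ ∃ ν : S.Γ₀ → ℝ → E3,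
    ContinuousOn (fun p : S.Γ₀ × ℝ => ν p.1 p.2) (U ×ˢ univ) ∧ ∀ y ∈ U, ∀ t, ν y t ≠ 0 ∧
      S.projFlow y t = ContinuousLinearMap.id ℝ E3 - (‖ν y t‖ ^ 2)⁻¹ • (innerSL ℝ (ν y t)).smulRight (ν y t) := by
  obtain ⟨U, hU, hxU, n, hn, hnU⟩ := S.isClosedSurface.exists_normal x₀.2
  refine ⟨Subtype.val ⁻¹' U, hU.preimage continuous_subtype_val, hxU,
    fun y t => ContinuousLinearMap.adjoint (S.flowDerivInv y (S.clamp t)) (n y), ?_, ?_⟩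
  · have h1 : Continuous (fun p : S.Γ₀ × ℝ =>
        ContinuousLinearMap.adjoint (S.flowDerivInv p.1 (S.clamp p.2))) :=
      (ContinuousLinearMap.adjoint (𝕜 := ℝ) (E := E3) (F := E3)).continuous.comp
        (S.continuous_flowDerivInv.comp
          (continuous_fst.prodMk (S.continuous_clamp.comp continuous_snd)))
    have h2 : ContinuousOn (fun p : S.Γ₀ × ℝ => n p.1) ((Subtype.val ⁻¹' U) ×ˢ univ) :=
      hn.comp (continuous_subtype_val.comp continuous_fst).continuousOn fun p hp => hp.1
    exact h1.continuousOn.clm_apply h2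
  · intro y hy t
    obtain ⟨hn0, hperp⟩ := hnU y ⟨y.2, hy⟩
    set ν := ContinuousLinearMap.adjoint (S.flowDerivInv y (S.clamp t)) (n y) with hν
    have hν0 : ν ≠ 0 := by
      intro h0
      apply hn0
      refine ext_inner_right ℝ fun v => ?_
      rw [← S.flowDerivInv_flowDeriv y (S.clamp t) v, ← ContinuousLinearMap.adjoint_inner_left,
        ← hν, h0, inner_zero_left, inner_zero_left]
    refine ⟨hν0, ?_⟩
    have hperp' : ∀ u, inner ℝ (n y) ((S.chart y).ι u) = 0 := by
      intro u
      have : (S.chart y).ι u ∈ Submodule.span ℝ (tangentConeAt ℝ S.Γ₀ (y : E3)) := by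
        rw [(S.chart y).span_tangentCone]; exact ⟨u, rfl⟩
      have hle : Submodule.span ℝ (tangentConeAt ℝ S.Γ₀ (y : E3)) ≤ (Submodule.span ℝ {n y})ᗮ := by
        rw [Submodule.span_le]
        exact fun v hv => Submodule.mem_orthogonal_singleton_iff_inner_right.mpr (hperp v hv)
      exact Submodule.mem_orthogonal_singleton_iff_inner_right.mp (hle this)
    have hspan : Submodule.span ℝ (tangentConeAt ℝ (S.Γ (S.clamp t)) (S.flow y t)) =
        (Submodule.span ℝ {ν})ᗮ := by
      rw [← S.flow_clamp, S.span_tangentCone_flow y (S.clamp_mem t)]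
      have : Fact (Module.finrank ℝ E3 = 2 + 1) := ⟨by simp⟩
      refine Submodule.eq_of_le_of_finrank_eq ?_ ?_
      · rintro _ ⟨u, rfl⟩
        rw [Submodule.mem_orthogonal_singleton_iff_inner_right, hν,
          ContinuousLinearMap.adjoint_inner_left]
        change inner ℝ (n y) (S.flowDerivInv y (S.clamp t)
          (S.flowDeriv y (S.clamp t) ((S.chart y).ι u))) = 0
        rw [S.flowDerivInv_flowDeriv, hperp']
      · rw [Submodule.finrank_orthogonal_span_singleton (n := 2) hν0,
          LinearMap.finrank_range_of_inj (S.tangentMap_injective y _)]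
        simp
    rw [projFlow, tangentProj]
    simp only [hspan]
    exact starProjection_orthogonal_singleton ν

theorem continuous_projFlow : Continuous fun p : S.Γ₀ × ℝ => S.projFlow p.1 p.2 := by
  rw [continuous_iff_continuousAt]
  rintro ⟨x₀, t₀⟩
  obtain ⟨U, hU, hxU, ν, hν, hνU⟩ := S.exists_projFlow_eq x₀
  have hnh : U ×ˢ univ ∈ 𝓝 (x₀, t₀) := prod_mem_nhds (hU.mem_nhds hxU) univ_mem
  have hat : ContinuousAt (fun p : S.Γ₀ × ℝ => ν p.1 p.2) (x₀, t₀) := hν.continuousAt hnh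
  have h0 : ‖ν x₀ t₀‖ ^ 2 ≠ 0 := pow_ne_zero 2 (norm_ne_zero_iff.mpr (hνU x₀ hxU t₀).1)
  have hc : ContinuousAt (fun p : S.Γ₀ × ℝ => ContinuousLinearMap.id ℝ E3 - (‖ν p.1 p.2‖ ^ 2)⁻¹ •
      (innerSL ℝ (ν p.1 p.2)).smulRight (ν p.1 p.2)) (x₀, t₀) := by
    refine continuousAt_const.sub ((((hat.norm).pow 2).inv₀ h0).smul ?_)
    have h1 : ContinuousAt (fun p : S.Γ₀ × ℝ => innerSL ℝ (ν p.1 p.2)) (x₀, t₀) :=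
      (innerSL ℝ (E := E3)).continuous.continuousAt.comp hat
    have h2 : ContinuousAt (fun p : S.Γ₀ × ℝ =>
        ContinuousLinearMap.smulRightL ℝ E3 E3 (innerSL ℝ (ν p.1 p.2))) (x₀, t₀) :=
      (ContinuousLinearMap.smulRightL ℝ E3 E3).continuous.continuousAt.comp h1
    exact h2.clm_apply hat
  refine hc.congr ?_
  filter_upwards [hnh] with p hp
  exact (hνU p.1 hp.1 p.2).2.symm

/-- The surface divergence of the velocity along the flow. -/
def divFlow (y : S.Γ₀) (t : ℝ) : ℝ := S.divW (S.flow y t, S.clamp t)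

theorem continuous_divFlow : Continuous fun p : S.Γ₀ × ℝ => S.divFlow p.1 p.2 := by
  have h1 : Continuous fun p : S.Γ₀ × ℝ => (S.projFlow p.1 p.2).comp (S.dwFlow p.1 p.2) :=
    S.continuous_projFlow.clm_comp S.continuous_dwFlow
  let tr : (E3 →L[ℝ] E3) →ₗ[ℝ] ℝ := LinearMap.trace ℝ E3 ∘ₗ ContinuousLinearMap.coeLM ℝ
  exact tr.continuous_of_finiteDimensional.comp h1

/-- The ratio of the area elements of `Γ(t)` and `Γ₀`. -/
def jac (y : S.Γ₀) (t : ℝ) : ℝ := Real.exp (∫ s in (0 : ℝ)..t, S.divFlow y s)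

theorem jac_pos (y : S.Γ₀) (t : ℝ) : 0 < S.jac y t := Real.exp_pos _

theorem continuous_jac : Continuous fun p : S.Γ₀ × ℝ => S.jac p.1 p.2 :=
  Real.continuous_exp.comp
    (intervalIntegral.continuous_parametric_primitive_of_continuous S.continuous_divFlow)

theorem hasDerivAt_jac (y : S.Γ₀) (t : ℝ) : HasDerivAt (S.jac y) (S.divFlow y t * S.jac y t) t := by
  have hc : Continuous (S.divFlow y) :=
    S.continuous_divFlow.comp (f := fun t : ℝ => (y, t)) (continuous_const.prodMk continuous_id)
  have := (hc.integral_hasStrictDerivAt 0 t).hasDerivAt.exp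
  rwa [mul_comm] at this

/-- Liouville's formula: the Gram determinant of two transported tangent vectors satisfies `G' = 2
div_Γ w G`, by the trace formula over the plane they span. The square of `jac` solves the same
equation with the same initial value 1. -/
theorem areaFactor_tangentMap (y : S.Γ₀) {t : ℝ} (ht : t ∈ Icc 0 S.T) :
    areaFactor (S.tangentMap y t) = S.jac y t := by
  set a : ℝ → E3 := fun t => S.tangentMap y t (EuclideanSpace.single 0 1) with ha
  set b : ℝ → E3 := fun t => S.tangentMap y t (EuclideanSpace.single 1 1) with hb
  have hv : ∀ u : E2, ∀ t ∈ Icc 0 S.T, HasDerivWithinAt (fun t => S.tangentMap y t u)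
      (S.dwFlow y t (S.tangentMap y t u)) (Icc 0 S.T) t := by
    intro u t ht
    have := (S.hasDerivWithinAt_flowDeriv y ht).clm_apply
      (hasDerivWithinAt_const t (Icc 0 S.T) ((S.chart y).ι u))
    simpa [tangentMap] using this
  have hG0 : ∀ t ∈ Icc 0 S.T, gram2 (a t) (b t) ≠ 0 := by
    intro t ht h0
    have := areaFactor_pos _ (S.tangentMap_injective y t)
    rw [areaFactor] at this
    exact absurd (Real.sqrt_pos.mp this) (by simp only [ha, hb] at h0; rw [h0]; exact lt_irrefl _)
  have hspan : ∀ t, LinearMap.range (S.tangentMap y t).toLinearMap = Submodule.span ℝ {a t, b t} := by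
    intro t
    rw [← Submodule.map_top, ← (EuclideanSpace.basisFun (Fin 2) ℝ).toBasis.span_eq, Submodule.map_span]
    congr 1
    ext v
    simp [Fin.exists_fin_two, ha, hb, eq_comm]
  have hGd : ∀ t ∈ Icc 0 S.T, HasDerivWithinAt (fun t => gram2 (a t) (b t))
      (2 * (S.divFlow y t * gram2 (a t) (b t))) (Icc 0 S.T) t := by
    intro t ht
    have h1 := hv (EuclideanSpace.single 0 1) t ht
    have h2 := hv (EuclideanSpace.single 1 1) t ht
    have htr := trace_starProjection_comp_mul_gram2 (a t) (b t) (S.dwFlow y t) (hG0 t ht)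
    have hdiv : S.divFlow y t = LinearMap.trace ℝ E3
        ((Submodule.span ℝ {a t, b t}).starProjection.comp (S.dwFlow y t)).toLinearMap := by
      rw [divFlow, divW, surfaceDiv, tangentProj]
      simp only [S.clamp_of_mem ht]
      simp only [S.span_tangentCone_flow y ht, hspan, dwFlow, dw, S.clamp_of_mem ht]
    rw [hdiv, htr]
    have h3 := ((h1.norm_sq.mul h2.norm_sq).sub ((h1.inner ℝ h2).pow 2))
    refine h3.congr_deriv ?_
    simp only [ha, hb]
    rw [real_inner_comm (S.tangentMap y t (EuclideanSpace.single 1 1))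
      (S.dwFlow y t (S.tangentMap y t (EuclideanSpace.single 0 1)))]
    push_cast
    ring
  have hq : ∀ t ∈ Icc 0 S.T, HasDerivWithinAt (fun t => gram2 (a t) (b t) * (S.jac y t ^ 2)⁻¹) 0
      (Icc 0 S.T) t := by
    intro t ht
    have hj := (((S.hasDerivAt_jac y t).hasDerivWithinAt (s := Icc 0 S.T)).pow 2).inv
      (pow_ne_zero 2 (S.jac_pos y t).ne')
    refine ((hGd t ht).mul hj).congr_deriv ?_
    have := (S.jac_pos y t).ne'
    simp only [Pi.pow_apply, Pi.inv_apply]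
    field_simp
    push_cast
    ring
  have hconst := constant_of_has_deriv_right_zero
    (fun t ht => (hq t ht).continuousWithinAt)
    (fun t ht => ((hq t (Ico_subset_Icc_self ht)).mono_of_mem_nhdsWithin
      (Icc_mem_nhdsGE_of_mem ht))) t ht
  have hg0 : gram2 (a 0) (b 0) = 1 := by
    have : ∀ u, S.tangentMap y 0 u = (S.chart y).ι u := fun u => by
      simp [tangentMap, S.flowDeriv_zero]
    simp only [ha, hb, this, LinearIsometry.gram2_map]
    simp [gram2, EuclideanSpace.inner_single_left]
  have hj0 : S.jac y 0 = 1 := by simp [jac]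
  have hjp := S.jac_pos y t
  simp only [hg0, hj0] at hconst
  have hfin : gram2 (a t) (b t) = S.jac y t ^ 2 := by
    field_simp at hconst
    linarith
  rw [areaFactor]
  change Real.sqrt (gram2 (a t) (b t)) = _
  rw [hfin, Real.sqrt_sq hjp.le]

end EvolvingSurface

/-! ### The area formula for the flow and the space-time measure. -/

theorem areaFactor_isometry (ι : E2 →ₗᵢ[ℝ] E3) : areaFactor ι.toContinuousLinearMap = 1 := by
  simp [areaFactor, gram2, EuclideanSpace.inner_single_left]

namespace EvolvingSurface
variable (S : EvolvingSurface)

/-- The surface measure on the initial surface. -/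
def surfMeasure : Measure S.Γ₀ := μHE[2]

theorem surfMeasure_apply (A : Set S.Γ₀) : S.surfMeasure A = (μHE[2] : Measure E3) (Subtype.val '' A) :=
  (isometry_subtype_coe.euclideanHausdorffMeasure_image A).symm

/-- The coordinates of the chart about `x₀`. -/
def coord (x₀ : S.Γ₀) (x : E3) : E2 :=
  ContinuousLinearMap.adjoint (S.chart x₀).ι.toContinuousLinearMap (x - x₀)

theorem continuous_coord (x₀ : S.Γ₀) : Continuous (S.coord x₀) :=
  (ContinuousLinearMap.continuous _).comp (continuous_id.sub continuous_const)

theorem coord_self (x₀ : S.Γ₀) : S.coord x₀ x₀ = 0 := by simp [coord]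

theorem image_coord {x₀ : S.Γ₀} {A : Set S.Γ₀} (hA : A ⊆ (S.chart x₀).V) :
    (S.chart x₀).ψ '' ((fun y : S.Γ₀ => S.coord x₀ y) '' A) = A := by
  rw [image_image]
  conv_rhs => rw [← image_id A]
  exact image_congr fun y hy => (S.chart x₀).ψ_coord y (hA hy)

theorem exists_surfMeasure_compare (x₀ : S.Γ₀) {c : ℝ≥0} (hc : 1 < c) :
    ∃ W ∈ 𝓝 (0 : E2), ∀ B ⊆ W, S.surfMeasure ((S.chart x₀).ψ '' B) ≤ c * volume B ∧
      volume B ≤ c * S.surfMeasure ((S.chart x₀).ψ '' B) := by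
  obtain ⟨W, hW, h⟩ := (S.chart x₀).hasStrictFDerivAt.exists_hausdorff_image_le
    (S.chart x₀).ι.injective hc
  refine ⟨W, hW, fun B hB => ?_⟩
  have := h B hB
  rw [areaFactor_isometry, ENNReal.ofReal_one, one_mul] at this
  simpa only [S.surfMeasure_apply, image_image] using this

theorem coord_preimage_mem_nhds (x₀ : S.Γ₀) {W : Set E2} (hW : W ∈ 𝓝 (0 : E2)) :
    (fun y : S.Γ₀ => S.coord x₀ y) ⁻¹' W ∩ (S.chart x₀).V ∈ 𝓝 x₀ := by
  refine inter_mem ?_ ((S.chart x₀).isOpen_V.mem_nhds (S.chart x₀).mem_V)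
  have h : ContinuousAt (fun y : S.Γ₀ => S.coord x₀ y) x₀ :=
    ((S.continuous_coord x₀).comp continuous_subtype_val).continuousAt
  exact h (by simpa [S.coord_self] using hW)

instance : IsFiniteMeasure S.surfMeasure := by
  have : IsLocallyFiniteMeasure S.surfMeasure := by
    refine ⟨fun x₀ => ?_⟩
    obtain ⟨W, hW, h⟩ := S.exists_surfMeasure_compare x₀ (c := 2) (by norm_num)
    have hW' := inter_mem hW (Metric.ball_mem_nhds (0 : E2) one_pos)
    refine ⟨_, S.coord_preimage_mem_nhds x₀ hW', ?_⟩
    rw [← S.image_coord (x₀ := x₀) inter_subset_right]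
    refine (h _ ?_).1.trans_lt ?_
    · rintro _ ⟨y, hy, rfl⟩
      exact hy.1.1
    · refine ENNReal.mul_lt_top (by simp) ((measure_mono ?_).trans_lt
        (measure_ball_lt_top (x := (0 : E2)) (r := 1)))
      rintro _ ⟨y, hy, rfl⟩
      exact hy.1.2
  exact CompactSpace.isFiniteMeasure

instance : S.surfMeasure.IsOpenPosMeasure := by
  refine ⟨fun U hU ⟨x₀, hx₀⟩ h0 => ?_⟩
  obtain ⟨W, hW, h⟩ := S.exists_surfMeasure_compare x₀ (c := 2) (by norm_num)
  have hUW : (S.chart x₀).ψ ⁻¹' U ∩ W ∈ 𝓝 (0 : E2) := by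
    refine inter_mem ?_ hW
    refine (S.chart x₀).continuous_ψ.continuousAt (hU.mem_nhds ?_)
    rwa [(S.chart x₀).ψ_zero]
  have h1 := (h ((S.chart x₀).ψ ⁻¹' U ∩ W) inter_subset_right).2
  have h2 : S.surfMeasure ((S.chart x₀).ψ '' ((S.chart x₀).ψ ⁻¹' U ∩ W)) = 0 := by
    refine measure_mono_null ?_ h0
    rintro _ ⟨z, hz, rfl⟩
    exact hz.1
  rw [h2, mul_zero] at h1
  exact (Measure.measure_pos_of_mem_nhds volume hUW).not_ge h1

/-- Lipschitz charts map null sets to null sets; this carries Rademacher's theorem from the plane to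
the surface. -/
theorem surfMeasure_chart_null (x₀ : S.Γ₀) {Z : Set E2} (hZ : volume Z = 0) :
    S.surfMeasure ((fun y : S.Γ₀ => S.coord x₀ y) ⁻¹' Z ∩ (S.chart x₀).V) = 0 := by
  rw [← S.image_coord (x₀ := x₀) inter_subset_right]
  set B := (fun y : S.Γ₀ => S.coord x₀ y) '' ((fun y : S.Γ₀ => S.coord x₀ y) ⁻¹' Z ∩ (S.chart x₀).V)
  have hB : B ⊆ Metric.ball 0 (S.chart x₀).r := by
    rintro _ ⟨y, hy, rfl⟩
    rw [mem_ball_zero_iff]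
    exact (S.chart x₀).norm_coord_lt y hy.2
  have hBZ : B ⊆ Z := by
    rintro _ ⟨y, hy, rfl⟩
    exact hy.1
  have := hausdorff_image_le_of_edist_le (f := (S.chart x₀).ψ) (g := (id : E2 → E2)) (B := B) (d := 2)
    (fun a ha b hb => (S.chart x₀).lipschitzOnWith.dist_le_mul a (hB ha) b (hB hb))
  rw [image_id, EuclideanSpace.euclideanHausdorffMeasure_eq_volume, measure_mono_null hBZ hZ,
    mul_zero] at this
  exact le_antisymm this bot_le

theorem comap_flow_apply (t : ℝ) (A : Set S.Γ₀) :
    (μHE[2] : Measure E3).comap (fun y => S.flow y t) A =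
      (μHE[2] : Measure E3) ((fun y => S.flow y t) '' A) :=
  (S.isClosedEmbedding_flow t).measurableEmbedding.comap_apply _ _

theorem measurable_jac (t : ℝ) : Measurable fun y => S.jac y t :=
  (S.continuous_jac.comp (f := fun y : S.Γ₀ => (y, t)) (continuous_id.prodMk continuous_const)).measurable

/-- The three factors `c` come from comparing `Γ₀` with the chart plane, comparing the chart plane
with `Γ(t)`, and replacing `jac` by its value at `x₀`. -/
theorem exists_area_compare (x₀ : S.Γ₀) {t : ℝ} (ht : t ∈ Icc 0 S.T) {c : ℝ≥0} (hc : 1 < c) :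
    ∃ V ∈ 𝓝 x₀, ∀ A ⊆ V, MeasurableSet A →
      (μHE[2] : Measure E3).comap (fun y => S.flow y t) A ≤
        c ^ 3 * (S.surfMeasure.withDensity fun y => ENNReal.ofReal (S.jac y t)) A ∧
      (S.surfMeasure.withDensity fun y => ENNReal.ofReal (S.jac y t)) A ≤
        c ^ 3 * (μHE[2] : Measure E3).comap (fun y => S.flow y t) A := by
  obtain ⟨W₁, hW₁, h₁⟩ := S.exists_surfMeasure_compare x₀ hc
  obtain ⟨W₂, hW₂, h₂⟩ := (S.hasStrictFDerivAt_flow_chart x₀ ht).exists_hausdorff_image_le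
    (S.tangentMap_injective x₀ t) hc
  rw [S.areaFactor_tangentMap x₀ ht] at h₂
  have hc' : (1 : ℝ) < c := by exact_mod_cast hc
  have hJ : {y : S.Γ₀ | S.jac y t < c * S.jac x₀ t ∧ S.jac x₀ t < c * S.jac y t} ∈ 𝓝 x₀ := by
    have hcont : Continuous fun y => S.jac y t :=
      S.continuous_jac.comp (f := fun y : S.Γ₀ => (y, t)) (continuous_id.prodMk continuous_const)
    have hp := S.jac_pos x₀ t
    exact ((isOpen_lt hcont continuous_const).inter
      (isOpen_lt continuous_const (continuous_const.mul hcont))).mem_nhds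
        ⟨lt_mul_of_one_lt_left hp hc', lt_mul_of_one_lt_left hp hc'⟩
  refine ⟨_, inter_mem hJ (S.coord_preimage_mem_nhds x₀ (inter_mem hW₁ hW₂)), fun A hA hAm => ?_⟩
  set B := (fun y : S.Γ₀ => S.coord x₀ y) '' A with hB
  have hAB : (S.chart x₀).ψ '' B = A := S.image_coord fun y hy => (hA hy).2.2
  have hBW : B ⊆ W₁ ∩ W₂ := by
    rintro _ ⟨y, hy, rfl⟩
    exact (hA hy).2.1
  obtain ⟨a1, a2⟩ := h₁ B (hBW.trans inter_subset_left)
  obtain ⟨b1, b2⟩ := h₂ B (hBW.trans inter_subset_right)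
  have himg : (fun z => S.flow ((S.chart x₀).ψ z) t) '' B = (fun y => S.flow y t) '' A := by
    conv_rhs => rw [← hAB, image_image]
  rw [himg, ← S.comap_flow_apply t] at b1 b2
  rw [hAB] at a1 a2
  rw [withDensity_apply _ hAm]
  have hofc : ENNReal.ofReal c = c := ENNReal.ofReal_coe_nnreal
  have j1 : ∫⁻ y in A, ENNReal.ofReal (S.jac y t) ∂S.surfMeasure ≤
      c * ENNReal.ofReal (S.jac x₀ t) * S.surfMeasure A := by
    rw [← setLIntegral_const]
    refine setLIntegral_mono measurable_const fun y hy => ?_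
    rw [← hofc, ← ENNReal.ofReal_mul (by positivity)]
    exact ENNReal.ofReal_le_ofReal (hA hy).1.1.le
  have j2 : ENNReal.ofReal (S.jac x₀ t) * S.surfMeasure A ≤
      c * ∫⁻ y in A, ENNReal.ofReal (S.jac y t) ∂S.surfMeasure := by
    rw [← setLIntegral_const, ← lintegral_const_mul _ (S.measurable_jac t).ennreal_ofReal]
    refine setLIntegral_mono ((S.measurable_jac t).ennreal_ofReal.const_mul _) fun y hy => ?_
    rw [← hofc, ← ENNReal.ofReal_mul (by positivity)]
    exact ENNReal.ofReal_le_ofReal (hA hy).1.2.le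
  constructor
  · calc _ ≤ (c : ℝ≥0∞) * (ENNReal.ofReal (S.jac x₀ t) * volume B) := b1
      _ ≤ c * (ENNReal.ofReal (S.jac x₀ t) * (c * S.surfMeasure A)) := by gcongr
      _ = c ^ 2 * (ENNReal.ofReal (S.jac x₀ t) * S.surfMeasure A) := by ring
      _ ≤ c ^ 2 * (c * ∫⁻ y in A, ENNReal.ofReal (S.jac y t) ∂S.surfMeasure) := by gcongr
      _ = _ := by ring
  · calc _ ≤ (c : ℝ≥0∞) * ENNReal.ofReal (S.jac x₀ t) * S.surfMeasure A := j1
      _ ≤ c * ENNReal.ofReal (S.jac x₀ t) * (c * volume B) := by gcongr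
      _ = c ^ 2 * (ENNReal.ofReal (S.jac x₀ t) * volume B) := by ring
      _ ≤ c ^ 2 * (c * (μHE[2] : Measure E3).comap (fun y => S.flow y t) A) := by gcongr
      _ = _ := by ring

theorem comap_flow_eq_withDensity {t : ℝ} (ht : t ∈ Icc 0 S.T) :
    (μHE[2] : Measure E3).comap (fun y => S.flow y t) =
      S.surfMeasure.withDensity fun y => ENNReal.ofReal (S.jac y t) := by
  -- The local comparison costs the cube of its constant, so it is used with the cube root.
  have hroot : ∀ c : ℝ≥0, 1 < c → ∃ d : ℝ≥0, 1 < d ∧ d ^ 3 = c := by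
    intro c hc
    refine ⟨c ^ (1 / 3 : ℝ), NNReal.one_lt_rpow hc (by norm_num), ?_⟩
    rw [← NNReal.rpow_natCast, ← NNReal.rpow_mul]
    norm_num
  apply le_antisymm
  · refine Measure.le_of_locally_le fun c hc x => ?_
    obtain ⟨d, hd, rfl⟩ := hroot c hc
    obtain ⟨V, hV, h⟩ := S.exists_area_compare x ht hd
    exact ⟨V, hV, fun A hA hAm => by simpa using (h A hA hAm).1⟩
  · refine Measure.le_of_locally_le fun c hc x => ?_
    obtain ⟨d, hd, rfl⟩ := hroot c hc
    obtain ⟨V, hV, h⟩ := S.exists_area_compare x ht hd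
    exact ⟨V, hV, fun A hA hAm => by simpa using (h A hA hAm).2⟩

theorem restrict_Γ_eq_map {t : ℝ} (ht : t ∈ Icc 0 S.T) :
    (μHE[2] : Measure E3).restrict (S.Γ t) =
      (S.surfMeasure.withDensity fun y => ENNReal.ofReal (S.jac y t)).map fun y => S.flow y t := by
  rw [← S.comap_flow_eq_withDensity ht, (S.isClosedEmbedding_flow t).measurableEmbedding.map_comap,
    S.range_flow ht]

/-- Integration over the moving surface, pulled back to the initial surface. -/
theorem surfaceIntegral_eq {t : ℝ} (ht : t ∈ Icc 0 S.T) (g : E3 → ℝ) :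
    surfaceIntegral (S.Γ t) g = ∫ y, S.jac y t * g (S.flow y t) ∂S.surfMeasure := by
  rw [surfaceIntegral, S.restrict_Γ_eq_map ht,
    (S.isClosedEmbedding_flow t).measurableEmbedding.integral_map,
    integral_withDensity_eq_integral_toReal_smul (S.measurable_jac t).ennreal_ofReal (by simp)]
  simp only [ENNReal.toReal_ofReal (S.jac_pos _ t).le, smul_eq_mul]

/-- The space-time flow. -/
def stFlow (p : S.Γ₀ × ℝ) : E3 × ℝ := (S.flow p.1 p.2, p.2)

theorem continuous_stFlow : Continuous S.stFlow := S.continuous_flow.prodMk continuous_snd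

theorem stFlow_injective : Function.Injective S.stFlow := by
  rintro ⟨y, t⟩ ⟨y', t'⟩ h
  simp only [stFlow, Prod.mk.injEq] at h
  obtain ⟨h1, rfl⟩ := h
  rw [S.flow_injective t h1]

theorem measurableEmbedding_stFlow : MeasurableEmbedding S.stFlow :=
  S.continuous_stFlow.measurableEmbedding S.stFlow_injective

/-- The measure `ds dt` on the space-time manifold, pulled back by the flow, up to its density
`jac`. -/
def baseMeasure : Measure (S.Γ₀ × ℝ) := S.surfMeasure.prod (volume.restrict (Ioc 0 S.T))

instance : IsFiniteMeasure S.baseMeasure := by unfold baseMeasure; infer_instance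

theorem measurable_jac_uncurry : Measurable fun p : S.Γ₀ × ℝ => ENNReal.ofReal (S.jac p.1 p.2) :=
  S.continuous_jac.measurable.ennreal_ofReal

theorem stMeasure_eq :
    S.stMeasure = (S.baseMeasure.withDensity fun p => ENNReal.ofReal (S.jac p.1 p.2)).map S.stFlow := by
  have hms : ∀ t : ℝ, Measurable fun y : S.Γ₀ => S.stFlow (y, t) := fun t =>
    (S.continuous_stFlow.comp (f := fun y : S.Γ₀ => (y, t))
      (continuous_id.prodMk continuous_const)).measurable
  have hmt : ∀ t : ℝ, Measurable fun x : E3 => (x, t) := fun t => by fun_prop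
  -- A measurable version of the kernel in `stMeasure`, equal to it for times in `(0, T]`.
  -- Evaluating `bind` requires such measurability.
  let κ : ℝ → Measure (E3 × ℝ) := fun t =>
    (S.surfMeasure.withDensity fun y => ENNReal.ofReal (S.jac y t)).map fun y => S.stFlow (y, t)
  have hκs : ∀ t, ∀ s, MeasurableSet s → κ t s = ∫⁻ y,
      (S.stFlow ⁻¹' s).indicator (fun p => ENNReal.ofReal (S.jac p.1 p.2)) (y, t) ∂S.surfMeasure := by
    intro t s hs
    simp only [κ]
    rw [Measure.map_apply (hms t) hs, withDensity_apply _ (hms t hs),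
      ← lintegral_indicator (hms t hs)]
    rfl
  have hmeas : ∀ s : Set (E3 × ℝ), MeasurableSet s → Measurable
      ((S.stFlow ⁻¹' s).indicator (fun p => ENNReal.ofReal (S.jac p.1 p.2))) := fun s hs =>
    S.measurable_jac_uncurry.indicator (S.continuous_stFlow.measurable hs)
  have hκm : Measurable κ := by
    refine Measure.measurable_of_measurable_coe _ fun s hs => ?_
    simp only [hκs _ s hs]
    exact (hmeas s hs).lintegral_prod_left'
  have hκ : (fun t => ((μHE[2] : Measure E3).restrict (S.Γ t)).map (fun x => (x, t)))
      =ᵐ[volume.restrict (Ioc 0 S.T)] κ := by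
    filter_upwards [ae_restrict_mem measurableSet_Ioc] with t ht
    rw [S.restrict_Γ_eq_map (Ioc_subset_Icc_self ht), Measure.map_map (hmt t)
      (S.isClosedEmbedding_flow t).continuous.measurable]
    rfl
  ext s hs
  rw [stMeasure, Measure.bind_congr_right hκ, Measure.bind_apply hs hκm.aemeasurable,
    Measure.map_apply S.continuous_stFlow.measurable hs,
    withDensity_apply _ (S.continuous_stFlow.measurable hs),
    ← lintegral_indicator (S.continuous_stFlow.measurable hs), baseMeasure,
    lintegral_prod_symm' _ (hmeas s hs)]
  simp only [hκs _ s hs]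

end EvolvingSurface

/-! ### Tangential gradients of Lipschitz functions. -/

theorem measurable_clm_apply_E2 {α : Type*} [MeasurableSpace α] {A : α → E2 →L[ℝ] E3} {g : α → E2}
    (hA : Measurable A) (hg : Measurable g) : Measurable fun a => A a (g a) := by
  have h : ∀ a, A a (g a) = ∑ i, g a i • A a (EuclideanSpace.single i 1) := by
    intro a
    conv_lhs => rw [← (EuclideanSpace.basisFun (Fin 2) ℝ).sum_repr (g a), map_sum]
    simp
  simp only [h]
  refine Finset.measurable_sum _ fun i _ => ?_
  exact ((by fun_prop : Measurable fun v : E2 => v i).comp hg).smul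
    ((ContinuousLinearMap.measurable_apply _).comp hA)

/-- The tangential gradient can be computed with any derivative within the surface. -/
theorem tangentGrad_eq {Γ : Set E3} {g : E3 → ℝ} {x : E3} {D : E3 →L[ℝ] ℝ}
    (h : HasFDerivWithinAt g D Γ x) :
    tangentGrad Γ g x = tangentProj Γ x ((InnerProductSpace.toDual ℝ E3).symm D) := by
  rw [tangentGrad, tangentProj, ← sub_eq_zero, ← map_sub, Submodule.starProjection_apply_eq_zero_iff,
    Submodule.mem_orthogonal']
  intro w hw
  have hle : Submodule.span ℝ (tangentConeAt ℝ Γ x) ≤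
      LinearMap.ker (fderivWithin ℝ g Γ x - D).toLinearMap := by
    rw [Submodule.span_le]
    intro v hv
    have := h.differentiableWithinAt.hasFDerivWithinAt.unique_on h hv
    simp [this]
  have := hle hw
  rw [inner_sub_left, gradientWithin, InnerProductSpace.toDual_symm_apply,
    InnerProductSpace.toDual_symm_apply]
  simpa using this

theorem tangentGrad_add {Γ : Set E3} {f g : E3 → ℝ} {x : E3} (hf : DifferentiableWithinAt ℝ f Γ x)
    (hg : DifferentiableWithinAt ℝ g Γ x) :
    tangentGrad Γ (fun x => f x + g x) x = tangentGrad Γ f x + tangentGrad Γ g x := by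
  rw [tangentGrad_eq hf.hasFDerivWithinAt, tangentGrad_eq hg.hasFDerivWithinAt,
    tangentGrad_eq (hf.hasFDerivWithinAt.fun_add hg.hasFDerivWithinAt), map_add, map_add]

theorem tangentGrad_const_mul {Γ : Set E3} {f : E3 → ℝ} {x : E3} (hf : DifferentiableWithinAt ℝ f Γ x)
    (c : ℝ) : tangentGrad Γ (fun x => c * f x) x = c • tangentGrad Γ f x := by
  rw [tangentGrad_eq hf.hasFDerivWithinAt, tangentGrad_eq (hf.hasFDerivWithinAt.const_mul c)]
  simp

namespace EvolvingSurface
variable (S : EvolvingSurface)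

/-- A function on the space-time cylinder over the initial surface that is continuous, Lipschitz in
space locally uniformly, and Lipschitz in time uniformly on `[0, T]`. -/
structure IsLipschitzOnCylinder (H : S.Γ₀ → ℝ → ℝ) : Prop where
  continuous : Continuous fun p : S.Γ₀ × ℝ => H p.1 p.2
  space : ∀ x₀, ∃ U ∈ 𝓝 x₀, ∃ C : ℝ≥0, ∀ t, LipschitzOnWith C (fun y => H y t) U
  time : ∃ C : ℝ≥0, ∀ y, LipschitzOnWith C (H y) (Icc 0 S.T)

variable {S}

theorem hasFDerivWithinAt_of_chart {x₀ y : S.Γ₀} (hy : y ∈ (S.chart x₀).V) {t : ℝ}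
    (ht : t ∈ Icc 0 S.T) {h : E3 → ℝ} {H : S.Γ₀ → ℝ} (hH : ∀ y, h (S.flow y t) = H y)
    {D : E2 →L[ℝ] ℝ} (hD : HasFDerivAt (fun z => H ((S.chart x₀).ψ z)) D (S.coord x₀ y)) :
    HasFDerivWithinAt h (D.comp ((ContinuousLinearMap.adjoint
      (S.chart x₀).ι.toContinuousLinearMap).comp (S.flowDerivInv y t))) (S.Γ t) (S.flow y t) := by
  have hext : ∀ y : S.Γ₀, Function.extend (fun y => S.flow y t) Subtype.val 0 (S.flow y t) = (y : E3) :=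
    fun y => (S.flow_injective t).extend_apply _ _ y
  have h1 := (S.hasFDerivWithinAt_invFun_flow y ht).sub_const (x₀ : E3)
  have h2 := (ContinuousLinearMap.adjoint
      (S.chart x₀).ι.toContinuousLinearMap).hasFDerivAt.comp_hasFDerivWithinAt _ h1
  have hD' : HasFDerivAt (fun z => H ((S.chart x₀).ψ z)) D ((ContinuousLinearMap.adjoint
      (S.chart x₀).ι.toContinuousLinearMap) ((Function.extend (fun y => S.flow y t) Subtype.val 0
      (S.flow y t) : E3) - x₀)) := by
    rw [hext]; exact hD
  have h3 := HasFDerivAt.comp_hasFDerivWithinAt (S.flow y t) (show HasFDerivAt _ _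
    ((ContinuousLinearMap.adjoint (S.chart x₀).ι.toContinuousLinearMap ∘ fun x =>
      Function.extend (fun y => S.flow y t) Subtype.val 0 x - (x₀ : E3)) (S.flow y t)) from hD') h2
  refine h3.congr_of_eventuallyEq ?_ ?_
  · rw [← S.range_flow ht, ← (S.isClosedEmbedding_flow t).isInducing.map_nhds_eq]
    rw [EventuallyEq, eventually_map]
    filter_upwards [(S.chart x₀).isOpen_V.mem_nhds hy] with y' hy'
    simp only [Function.comp, hext, hH, (S.chart x₀).ψ_coord y' hy']
  · simp only [Function.comp, hext, hH, (S.chart x₀).ψ_coord y hy]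

/-- For each fixed time, Rademacher's theorem applies in the chart; Fubini then makes the
exceptional set null in space-time. Off it, the tangential gradient is a continuous matrix field
applied to the plane gradient, which gives both measurability and boundedness. -/
theorem exists_local_grad {u : E3 × ℝ → ℝ} {H : S.Γ₀ → ℝ → ℝ} (hH : S.IsLipschitzOnCylinder H)
    {I : Set ℝ} (hI : MeasurableSet I) (hIT : I ⊆ Icc 0 S.T) (hu : ∀ t ∈ I, ∀ y, u (S.flow y t, t) = H y t) (x₀ : S.Γ₀) :
    ∃ V ∈ 𝓝 x₀, ∃ C : ℝ,
      AEStronglyMeasurable (fun p => S.grad u (S.stFlow p)) (S.baseMeasure.restrict (V ×ˢ I)) ∧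
      ∀ᵐ p ∂S.baseMeasure.restrict (V ×ˢ I), ‖S.grad u (S.stFlow p)‖ ≤ C ∧
        DifferentiableWithinAt ℝ (fun x => u (x, p.2)) (S.Γ p.2) (S.flow p.1 p.2) := by
  obtain ⟨U, hU, C, hC⟩ := hH.space x₀
  set c := S.chart x₀ with hc
  have hψU : c.ψ ⁻¹' U ∈ 𝓝 (0 : E2) :=
    c.continuous_ψ.continuousAt (by rw [c.ψ_zero]; exact hU)
  obtain ⟨ρ, hρ, hρsub⟩ := Metric.mem_nhds_iff.mp (inter_mem hψU (Metric.ball_mem_nhds (0 : E2) c.r_pos))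
  set B := Metric.ball (0 : E2) ρ with hB
  let A : ℝ → E2 → ℝ := fun t z => H (c.ψ z) t
  have hA : Continuous A.uncurry :=
    hH.continuous.comp ((c.continuous_ψ.comp continuous_snd).prodMk continuous_fst)
  have hAlip : ∀ t, LipschitzOnWith (C * 2) (A t) B := by
    intro t
    exact (hC t).comp (c.lipschitzOnWith.mono fun z hz => (hρsub hz).2) fun z hz => (hρsub hz).1
  set V : Set S.Γ₀ := (fun y : S.Γ₀ => S.coord x₀ y) ⁻¹' B ∩ c.V with hV
  have hVn : V ∈ 𝓝 x₀ := S.coord_preimage_mem_nhds x₀ (Metric.ball_mem_nhds 0 hρ)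
  have hcoord : Continuous fun y : S.Γ₀ => S.coord x₀ y :=
    (S.continuous_coord x₀).comp continuous_subtype_val
  have hVm : MeasurableSet V :=
    ((Metric.isOpen_ball.preimage hcoord).inter c.isOpen_V).measurableSet
  have hm : Measurable fun p : S.Γ₀ × ℝ => (p.2, S.coord x₀ p.1) :=
    (continuous_snd.prodMk (hcoord.comp continuous_fst)).measurable
  set Dset : Set (S.Γ₀ × ℝ) := {p | DifferentiableAt ℝ (A p.2) (S.coord x₀ p.1)} with hDset
  have hDm : MeasurableSet Dset := hm (measurableSet_of_differentiableAt_with_param ℝ hA)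
  have hnull : S.baseMeasure ((V ×ˢ univ) \ Dset) = 0 := by
    rw [baseMeasure, Measure.prod_apply_symm ((hVm.prod MeasurableSet.univ).diff hDm)]
    refine (lintegral_eq_zero_iff (measurable_measure_prodMk_right
      ((hVm.prod MeasurableSet.univ).diff hDm))).mpr (Eventually.of_forall fun t => ?_)
    have hZ : volume {z | z ∈ B ∧ ¬ DifferentiableAt ℝ (A t) z} = 0 := by
      have h := (hAlip t).ae_differentiableWithinAt_of_mem (μ := volume)
      rw [ae_iff] at h
      refine measure_mono_null ?_ h
      rintro z ⟨hz, hzd⟩ hcon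
      exact hzd ((hcon hz).differentiableAt (Metric.isOpen_ball.mem_nhds hz))
    refine measure_mono_null ?_ (S.surfMeasure_chart_null x₀ hZ)
    rintro y ⟨⟨hyV, -⟩, hyD⟩
    exact ⟨⟨hyV.1, hyD⟩, hyV.2⟩
  have hae : ∀ᵐ p ∂S.baseMeasure.restrict (V ×ˢ I), p ∈ V ×ˢ I ∧ p ∈ Dset := by
    rw [ae_restrict_iff' (hVm.prod hI)]
    have : ∀ᵐ p ∂S.baseMeasure, p ∉ (V ×ˢ univ) \ Dset := measure_eq_zero_iff_ae_notMem.mp hnull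
    filter_upwards [this] with p hp hpV
    refine ⟨hpV, ?_⟩
    by_contra h
    exact hp ⟨⟨hpV.1, mem_univ _⟩, h⟩
  let K : S.Γ₀ × ℝ → E2 →L[ℝ] E3 := fun p => (S.projFlow p.1 p.2).comp
    (ContinuousLinearMap.adjoint ((ContinuousLinearMap.adjoint c.ι.toContinuousLinearMap).comp
      (S.flowDerivInv p.1 p.2)))
  have hK : Continuous K := by
    refine S.continuous_projFlow.clm_comp ?_
    exact (ContinuousLinearMap.adjoint (𝕜 := ℝ) (E := E3) (F := E2)).continuous.comp
      (continuous_const.clm_comp S.continuous_flowDerivInv)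
  let g : S.Γ₀ × ℝ → E2 := fun p =>
    (InnerProductSpace.toDual ℝ E2).symm (fderiv ℝ (A p.2) (S.coord x₀ p.1))
  have hg : Measurable g :=
    (InnerProductSpace.toDual ℝ E2).symm.continuous.measurable.comp
      ((measurable_fderiv_with_param ℝ hA).comp hm)
  have hgrad : ∀ p ∈ V ×ˢ I, p ∈ Dset → S.grad u (S.stFlow p) = K p (g p) ∧
      DifferentiableWithinAt ℝ (fun x => u (x, p.2)) (S.Γ p.2) (S.flow p.1 p.2) := by
    intro p hp hpD
    have ht := hIT hp.2
    have hd := hasFDerivWithinAt_of_chart hp.1.2 ht (h := fun x => u (x, p.2)) (hu p.2 hp.2) hpD.hasFDerivAt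
    refine ⟨?_, hd.differentiableWithinAt⟩
    rw [grad]
    simp only [stFlow]
    rw [tangentGrad_eq hd]
    simp only [K, ContinuousLinearMap.comp_apply, projFlow, S.clamp_of_mem ht]
    congr 1
    refine ext_inner_right ℝ fun v => ?_
    rw [InnerProductSpace.toDual_symm_apply, ContinuousLinearMap.adjoint_inner_left,
      InnerProductSpace.toDual_symm_apply]
    rfl
  obtain ⟨CK, hCK⟩ := (isCompact_univ.prod (isCompact_Icc (a := (0 : ℝ)) (b := S.T))).exists_bound_of_continuousOn
    (hK.continuousOn (s := (univ : Set S.Γ₀) ×ˢ Icc 0 S.T))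
  refine ⟨V, hVn, CK * (C * 2 : ℝ≥0), ?_, ?_⟩
  · refine (measurable_clm_apply_E2 hK.measurable hg).aestronglyMeasurable.congr ?_
    filter_upwards [hae] with p hp using (hgrad p hp.1 hp.2).1.symm
  · filter_upwards [hae] with p hp
    obtain ⟨h1, h2⟩ := hgrad p hp.1 hp.2
    refine ⟨?_, h2⟩
    rw [h1]
    have h3 : ‖g p‖ ≤ (C * 2 : ℝ≥0) := by
      simp only [g, LinearIsometryEquiv.norm_map]
      exact norm_fderiv_le_of_lipschitzOn ℝ (Metric.isOpen_ball.mem_nhds hp.1.1.1) (hAlip p.2)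
    have h4 := hCK p ⟨mem_univ _, hIT hp.1.2⟩
    calc ‖K p (g p)‖ ≤ ‖K p‖ * ‖g p‖ := (K p).le_opNorm _
      _ ≤ CK * (C * 2 : ℝ≥0) := by
        gcongr
        exact (norm_nonneg _).trans h4

theorem exists_grad_bound {u : E3 × ℝ → ℝ} {H : S.Γ₀ → ℝ → ℝ} (hH : S.IsLipschitzOnCylinder H)
    {I : Set ℝ} (hI : MeasurableSet I) (hIT : I ⊆ Icc 0 S.T) (hu : ∀ t ∈ I, ∀ y, u (S.flow y t, t) = H y t) :
    ∃ C : ℝ,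
      AEStronglyMeasurable (fun p => S.grad u (S.stFlow p)) (S.baseMeasure.restrict (univ ×ˢ I)) ∧
      ∀ᵐ p ∂S.baseMeasure.restrict (univ ×ˢ I), ‖S.grad u (S.stFlow p)‖ ≤ C ∧
        DifferentiableWithinAt ℝ (fun x => u (x, p.2)) (S.Γ p.2) (S.flow p.1 p.2) := by
  refine IsCompact.induction_on (isCompact_univ (X := S.Γ₀)) (p := fun V => ∃ C : ℝ,
      AEStronglyMeasurable (fun p => S.grad u (S.stFlow p)) (S.baseMeasure.restrict (V ×ˢ I)) ∧
      ∀ᵐ p ∂S.baseMeasure.restrict (V ×ˢ I), ‖S.grad u (S.stFlow p)‖ ≤ C ∧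
        DifferentiableWithinAt ℝ (fun x => u (x, p.2)) (S.Γ p.2) (S.flow p.1 p.2)) ?_ ?_ ?_ ?_
  · exact ⟨0, by simp⟩
  · rintro s t hst ⟨C, h1, h2⟩
    have hsub : s ×ˢ I ⊆ t ×ˢ I := prod_mono hst subset_rfl
    exact ⟨C, h1.mono_set hsub, ae_restrict_of_ae_restrict_of_subset hsub h2⟩
  · rintro s t ⟨C, h1, h2⟩ ⟨C', h1', h2'⟩
    refine ⟨max C C', ?_, ?_⟩
    · rw [union_prod, aestronglyMeasurable_union_iff]
      exact ⟨h1, h1'⟩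
    · rw [union_prod, ae_restrict_union_iff]
      constructor
      · filter_upwards [h2] with p hp using ⟨hp.1.trans (le_max_left _ _), hp.2⟩
      · filter_upwards [h2'] with p hp using ⟨hp.1.trans (le_max_right _ _), hp.2⟩
  · intro x _
    obtain ⟨V, hV, h⟩ := exists_local_grad hH hI hIT hu x
    exact ⟨V, mem_nhdsWithin_of_mem_nhds hV, h⟩

end EvolvingSurface

/-! ### Local Lipschitz continuity of piecewise affine functions. -/

theorem IsTetrahedralTriangulation.exists_tetrahedron {Ω : Set E3} {K : Geometry.SimplicialComplex ℝ E3}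
    (hK : IsTetrahedralTriangulation Ω K) {x : E3} (hx : x ∈ closure Ω) :
    ∃ s ∈ K.faces, s.card = 4 ∧ x ∈ convexHull ℝ (s : Set E3) := by
  rw [← hK.space_eq, Geometry.SimplicialComplex.mem_space_iff] at hx
  obtain ⟨s, hs, hxs⟩ := hx
  obtain ⟨t, ht, hst, htc⟩ := hK.pure s hs
  exact ⟨t, ht, htc, convexHull_mono (by exact_mod_cast hst) hxs⟩

theorem isClosed_convexHull_finset (s : Finset E3) : IsClosed (convexHull ℝ (s : Set E3)) :=
  (s.finite_toSet.isCompact_convexHull ℝ).isClosed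

/-- A continuous piecewise affine function is Lipschitz along segments. -/
theorem piecewiseAffine_lipschitz_segment {Ω : Set E3} {K : Geometry.SimplicialComplex ℝ E3}
    (hK : IsTetrahedralTriangulation Ω K) {φ : E3 → ℝ} (hφ : φ ∈ piecewiseAffine K) :
    ∃ C : ℝ≥0, ∀ x y, segment ℝ x y ⊆ Ω → dist (φ x) (φ y) ≤ C * dist x y := by
  have hL : ∀ s ∈ K.faces, ∃ C : ℝ, s.card = 4 → ∀ x ∈ convexHull ℝ (s : Set E3),
      ∀ y ∈ convexHull ℝ (s : Set E3), φ x - φ y ≤ C * ‖x - y‖ := by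
    intro s hs
    by_cases hc : s.card = 4
    · obtain ⟨L, hL⟩ := hφ.2 s hs hc
      refine ⟨‖LinearMap.toContinuousLinearMap L.linear‖, fun _ x hx y hy => ?_⟩
      rw [hL hx, hL hy]
      have h1 : L x - L y = LinearMap.toContinuousLinearMap L.linear (x - y) := by
        simp only [LinearMap.coe_toContinuousLinearMap']
        exact (L.linearMap_vsub x y).symm
      rw [h1]
      exact (le_abs_self _).trans (by rw [← Real.norm_eq_abs]; exact ContinuousLinearMap.le_opNorm _ _)
    · exact ⟨0, fun h => absurd h hc⟩
  choose! C hC using hL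
  obtain ⟨C₀, hC₀⟩ := (hK.finite.image C).bddAbove
  set C₁ : ℝ≥0 := Real.toNNReal C₀ with hC₁
  have hCle : ∀ s ∈ K.faces, C s ≤ C₁ := fun s hs =>
    (hC₀ ⟨s, hs, rfl⟩).trans (Real.le_coe_toNNReal _)
  have key : ∀ x y, segment ℝ x y ⊆ Ω → φ y - φ x ≤ C₁ * dist x y := by
    intro x y hxy
    set γ : ℝ → E3 := fun s => AffineMap.lineMap x y s with hγ
    have hγc : Continuous γ := AffineMap.lineMap_continuous
    have hγmem : ∀ s ∈ Icc (0 : ℝ) 1, γ s ∈ Ω := by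
      intro s hs
      refine hxy ?_
      rw [segment_eq_image_lineMap]
      exact ⟨s, hs, rfl⟩
    have hγd : ∀ s z, ‖γ z - γ s‖ = |z - s| * dist x y := by
      intro s z
      rw [← dist_eq_norm, dist_lineMap_lineMap, Real.dist_eq]
    have hcont : ContinuousOn (fun s => φ (γ s)) (Icc 0 1) := by
      refine hφ.1.comp hγc.continuousOn fun s hs => ?_
      rw [hK.space_eq]
      exact subset_closure (hγmem s hs)
    -- It suffices that at each parameter `s` the right slopes are frequently below every `r` larger
    -- than the claimed constant, so no subdivision of the segment by the tetrahedra is needed.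
    have := image_le_of_liminf_slope_right_le_deriv_boundary (f := fun s => φ (γ s)) (a := 0) (b := 1)
      (B := fun s => φ x + s * (C₁ * dist x y)) (B' := fun _ => C₁ * dist x y) hcont
      (by simp [hγ]) (by fun_prop)
      (fun s _ => by
        have := ((hasDerivAt_id s).mul_const (C₁ * dist x y)).const_add (φ x)
        simpa using this.hasDerivWithinAt) ?_ (right_mem_Icc.mpr zero_le_one)
    · simp only [hγ, AffineMap.lineMap_apply_one, one_mul] at this
      linarith
    · intro s hs r hr
      by_contra hnf
      rw [not_frequently] at hnf
      have hnear : ∀ᶠ z in 𝓝[>] s, z ∈ Ioo s 1 := Ioo_mem_nhdsGT hs.2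
      -- A tetrahedron met by `γ z` for `z` arbitrarily close to `s` from the right is closed, so it
      -- also contains `γ s`, and its affine function bounds the slope. If no slope were small,
      -- every one of the finitely many tetrahedra would thus be avoided near `s`, although together
      -- they cover `Ω`.
      have hev : ∀ σ ∈ K.faces, ∀ᶠ z in 𝓝[>] s, ¬ (σ.card = 4 ∧ γ z ∈ convexHull ℝ (σ : Set E3)) := by
        intro σ hσ
        by_contra hcon
        have hfr : ∃ᶠ z in 𝓝[>] s, σ.card = 4 ∧ γ z ∈ convexHull ℝ (σ : Set E3) := hcon
        have hs' : γ s ∈ convexHull ℝ (σ : Set E3) :=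
          (isClosed_convexHull_finset σ).mem_of_frequently_of_tendsto (hfr.mono fun z hz => hz.2)
            (hγc.continuousAt.tendsto.mono_left nhdsWithin_le_nhds)
        obtain ⟨z, ⟨hc4, hz⟩, hz1, hz2⟩ := (hfr.and_eventually (hnear.and hnf)).exists
        apply hz2
        have h1 := hC σ hσ hc4 _ hz _ hs'
        rw [hγd, abs_of_pos (sub_pos.mpr hz1.1)] at h1
        refine lt_of_le_of_lt ?_ hr
        rw [slope_def_field, div_le_iff₀ (sub_pos.mpr hz1.1)]
        have h2 := hCle σ hσ
        have h3 : 0 ≤ (z - s) * dist x y := mul_nonneg (sub_pos.mpr hz1.1).le dist_nonneg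
        nlinarith
      have hall := (hK.finite.eventually_all).mpr hev
      obtain ⟨z, hz1, hz2⟩ := (hnear.and hall).exists
      obtain ⟨σ, hσ, hc4, hmem⟩ := hK.exists_tetrahedron (x := γ z)
        (subset_closure (hγmem z ⟨hs.1.trans hz1.1.le, hz1.2.le⟩))
      exact hz2 σ hσ ⟨hc4, hmem⟩
  refine ⟨C₁, fun x y hxy => ?_⟩
  rw [Real.dist_eq, abs_le]
  have h1 := key x y hxy
  have h2 := key y x (by rwa [segment_symm])
  rw [dist_comm y x] at h2
  constructor <;> linarith

theorem piecewiseAffine_locallyLipschitzOn {Ω : Set E3} (hΩ : IsOpen Ω)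
    {K : Geometry.SimplicialComplex ℝ E3} (hK : IsTetrahedralTriangulation Ω K) {φ : E3 → ℝ}
    (hφ : φ ∈ piecewiseAffine K) : LocallyLipschitzOn Ω φ := by
  obtain ⟨C, hC⟩ := piecewiseAffine_lipschitz_segment hK hφ
  intro x hx
  obtain ⟨r, hr, hball⟩ := Metric.isOpen_iff.mp hΩ x hx
  refine ⟨C, _, mem_nhdsWithin_of_mem_nhds (Metric.ball_mem_nhds x hr), ?_⟩
  refine LipschitzOnWith.of_dist_le_mul fun a ha b hb => hC a b ?_
  exact ((convex_ball x r).segment_subset ha hb).trans hball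

theorem piecewiseAffine_add {K : Geometry.SimplicialComplex ℝ E3} {φ ψ : E3 → ℝ}
    (hφ : φ ∈ piecewiseAffine K) (hψ : ψ ∈ piecewiseAffine K) :
    (fun x => φ x + ψ x) ∈ piecewiseAffine K := by
  refine ⟨hφ.1.add hψ.1, fun s hs hc => ?_⟩
  obtain ⟨L, hL⟩ := hφ.2 s hs hc
  obtain ⟨L', hL'⟩ := hψ.2 s hs hc
  exact ⟨L + L', fun x hx => by simp [hL hx, hL' hx]⟩

theorem piecewiseAffine_const_mul {K : Geometry.SimplicialComplex ℝ E3} {φ : E3 → ℝ}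
    (hφ : φ ∈ piecewiseAffine K) (c : ℝ) : (fun x => c * φ x) ∈ piecewiseAffine K := by
  refine ⟨continuousOn_const.mul hφ.1, fun s hs hc => ?_⟩
  obtain ⟨L, hL⟩ := hφ.2 s hs hc
  exact ⟨c • L, fun x hx => by simp [hL hx]⟩

theorem piecewiseAffine_zero {K : Geometry.SimplicialComplex ℝ E3} :
    (fun _ => (0 : ℝ)) ∈ piecewiseAffine K :=
  ⟨continuousOn_const, fun _ _ _ => ⟨AffineMap.const ℝ E3 0, fun _ _ => rfl⟩⟩

/-! ### Finite element functions in particle coordinates, and the topology of the space-time flow.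
-/

namespace EvolvingSurface
variable (S : EvolvingSurface)

/-- The set that is swept by the moving surface. -/
def swept : Set E3 := (fun p : S.Γ₀ × ℝ => S.flow p.1 p.2) '' (univ ×ˢ Icc 0 S.T)

theorem isCompact_swept : IsCompact S.swept :=
  (isCompact_univ.prod isCompact_Icc).image S.continuous_flow

theorem flow_mem_swept (y : S.Γ₀) (t : ℝ) : S.flow y t ∈ S.swept :=
  ⟨(y, S.clamp t), ⟨mem_univ _, S.clamp_mem t⟩, S.flow_clamp y t⟩

theorem swept_subset : S.swept ⊆ S.Ω := by
  rintro _ ⟨p, -, rfl⟩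
  exact S.flow_mem_Ω _ _

theorem exists_lipschitz_flow_time : ∃ C : ℝ≥0, ∀ y, LipschitzOnWith C (S.flow y) (Icc 0 S.T) := by
  have hc : Continuous fun p : S.Γ₀ × ℝ => S.w (S.flow p.1 p.2) (S.clamp p.2) :=
    S.contDiffOn_w.continuousOn.comp_continuous
      (S.continuous_flow.prodMk (S.continuous_clamp.comp continuous_snd))
      fun p => ⟨S.flow_mem_Ω p.1 p.2, S.clamp_mem p.2⟩
  obtain ⟨C, hC⟩ := (isCompact_univ.prod (isCompact_Icc (a := (0 : ℝ)) (b := S.T))).exists_bound_of_continuousOn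
    (hc.continuousOn (s := (univ : Set S.Γ₀) ×ˢ Icc 0 S.T))
  refine ⟨Real.toNNReal C, fun y => ?_⟩
  have h := (convex_Icc (0 : ℝ) S.T).lipschitzOnWith_of_nnnorm_hasDerivWithin_le
    (f := S.Φ y) (f' := fun t => S.w (S.Φ y t) t) (C := Real.toNNReal C)
    (fun t ht => S.flow_ode y y.2 t ht) (fun t ht => ?_)
  · intro s hs t ht
    rw [S.flow_of_mem y hs, S.flow_of_mem y ht]
    exact h hs ht
  · have := hC (y, t) ⟨mem_univ _, ht⟩
    simp only [S.flow_of_mem y ht, S.clamp_of_mem ht] at this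
    rw [← NNReal.coe_le_coe]
    exact this.trans (Real.le_coe_toNNReal C)

variable {S}

theorem IsLipschitzOnCylinder.of_lipschitzOn {φ : E3 → ℝ} {C : ℝ≥0} (hφ : LipschitzOnWith C φ S.swept) :
    S.IsLipschitzOnCylinder fun y t => φ (S.flow y t) := by
  refine ⟨?_, fun x₀ => ?_, ?_⟩
  · exact hφ.continuousOn.comp_continuous S.continuous_flow fun p => S.flow_mem_swept _ _
  · obtain ⟨U, hU, D, hD⟩ := S.exists_lipschitz_flow x₀
    exact ⟨U, hU, C * D, fun t => hφ.comp (hD t) fun y _ => S.flow_mem_swept _ _⟩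
  · obtain ⟨D, hD⟩ := S.exists_lipschitz_flow_time
    exact ⟨C * D, fun y => hφ.comp (hD y) fun t _ => S.flow_mem_swept _ _⟩

theorem IsLipschitzOnCylinder.add {F G : S.Γ₀ → ℝ → ℝ} (hF : S.IsLipschitzOnCylinder F)
    (hG : S.IsLipschitzOnCylinder G) : S.IsLipschitzOnCylinder fun y t => F y t + G y t := by
  refine ⟨hF.continuous.add hG.continuous, fun x₀ => ?_, ?_⟩
  · obtain ⟨U, hU, C, hC⟩ := hF.space x₀
    obtain ⟨U', hU', C', hC'⟩ := hG.space x₀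
    exact ⟨U ∩ U', inter_mem hU hU', C + C', fun t =>
      ((hC t).mono inter_subset_left).add ((hC' t).mono inter_subset_right)⟩
  · obtain ⟨C, hC⟩ := hF.time
    obtain ⟨C', hC'⟩ := hG.time
    exact ⟨C + C', fun y => (hC y).add (hC' y)⟩

theorem IsLipschitzOnCylinder.exists_bound {F : S.Γ₀ → ℝ → ℝ} (hF : S.IsLipschitzOnCylinder F) :
    ∃ C : ℝ, 0 ≤ C ∧ ∀ y, ∀ t ∈ Icc 0 S.T, |F y t| ≤ C := by
  obtain ⟨C, hC⟩ := (isCompact_univ.prod (isCompact_Icc (a := (0 : ℝ)) (b := S.T))).exists_bound_of_continuousOn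
    (hF.continuous.continuousOn (s := (univ : Set S.Γ₀) ×ˢ Icc 0 S.T))
  exact ⟨max C 0, le_max_right _ _, fun y t ht => (hC (y, t) ⟨mem_univ _, ht⟩).trans (le_max_left _ _)⟩

theorem IsLipschitzOnCylinder.clamp_mul_of_lipschitzOn {φ : E3 → ℝ} {C : ℝ≥0} (hφ : LipschitzOnWith C φ S.swept) :
    S.IsLipschitzOnCylinder fun y t => S.clamp t * φ (S.flow y t) := by
  have hF := IsLipschitzOnCylinder.of_lipschitzOn hφ
  refine ⟨(S.continuous_clamp.comp continuous_snd).mul hF.continuous, fun x₀ => ?_, ?_⟩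
  · obtain ⟨U, hU, D, hD⟩ := hF.space x₀
    refine ⟨U, hU, Real.toNNReal S.T * D, fun t => LipschitzOnWith.of_dist_le_mul fun a ha b hb => ?_⟩
    have h1 := (hD t).dist_le_mul a ha b hb
    have hc := S.clamp_mem t
    rw [Real.dist_eq] at h1 ⊢
    rw [← mul_sub, abs_mul, abs_of_nonneg hc.1, NNReal.coe_mul, Real.coe_toNNReal _ S.T_pos.le, mul_assoc]
    exact mul_le_mul hc.2 h1 (abs_nonneg _) S.T_pos.le
  · obtain ⟨D, hD⟩ := hF.time
    obtain ⟨B, hB0, hB⟩ := hF.exists_bound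
    refine ⟨Real.toNNReal S.T * D + Real.toNNReal B, fun y => LipschitzOnWith.of_dist_le_mul fun s hs t ht => ?_⟩
    have h1 := (hD y).dist_le_mul s hs t ht
    have h2 := hB y t ht
    rw [Real.dist_eq] at h1 ⊢
    rw [S.clamp_of_mem hs, S.clamp_of_mem ht]
    push_cast
    rw [Real.coe_toNNReal _ S.T_pos.le, Real.coe_toNNReal _ hB0]
    have e : s * φ (S.flow y s) - t * φ (S.flow y t) =
      s * (φ (S.flow y s) - φ (S.flow y t)) + (s - t) * φ (S.flow y t) := by ring
    rw [e]
    refine (abs_add_le _ _).trans ?_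
    rw [abs_mul, abs_mul, abs_of_nonneg hs.1, add_mul, Real.dist_eq] at *
    refine add_le_add ?_ ?_
    · rw [mul_assoc]
      exact mul_le_mul hs.2 h1 (abs_nonneg _) S.T_pos.le
    · rw [mul_comm]
      exact mul_le_mul_of_nonneg_right h2 (abs_nonneg _)

theorem isLipschitzOnCylinder_of_piecewiseAffine {K : Geometry.SimplicialComplex ℝ E3}
    (hK : IsTetrahedralTriangulation S.Ω K) {φ₀ φ₁ : E3 → ℝ} (hφ₀ : φ₀ ∈ piecewiseAffine K)
    (hφ₁ : φ₁ ∈ piecewiseAffine K) :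
    S.IsLipschitzOnCylinder fun y t => φ₀ (S.flow y t) + S.clamp t * φ₁ (S.flow y t) := by
  obtain ⟨C, hC⟩ := ((piecewiseAffine_locallyLipschitzOn S.isOpen_Ω hK hφ₀).mono
    S.swept_subset).exists_lipschitzOnWith_of_compact S.isCompact_swept
  obtain ⟨D, hD⟩ := ((piecewiseAffine_locallyLipschitzOn S.isOpen_Ω hK hφ₁).mono
    S.swept_subset).exists_lipschitzOnWith_of_compact S.isCompact_swept
  exact (IsLipschitzOnCylinder.of_lipschitzOn hC).add (IsLipschitzOnCylinder.clamp_mul_of_lipschitzOn hD)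

/-- A time interval is closed on the right, so `t` may be its endpoint; a neighbourhood still
contains a product with some `(l, t]`, which has positive measure. -/
theorem baseMeasure_pos {y₀ : S.Γ₀} {t a b : ℝ} (ht : t ∈ Ioc a b) (ha : 0 ≤ a) (hb : b ≤ S.T)
    {O : Set (S.Γ₀ × ℝ)} (hO : O ∈ 𝓝 (y₀, t)) : 0 < S.baseMeasure (O ∩ univ ×ˢ Ioc a b) := by
  obtain ⟨A, hA, J, hJ, hAJ⟩ := mem_nhds_prod_iff.mp hO
  have hJt : J ∩ Ioc a b ∈ 𝓝[≤] t := inter_mem (mem_nhdsWithin_of_mem_nhds hJ) (Ioc_mem_nhdsLE_of_mem ht)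
  obtain ⟨l, hl, hlJ⟩ := (mem_nhdsLE_iff_exists_Ioc_subset' (show a < t from ht.1)).mp hJt
  have hsub : A ×ˢ Ioc l t ⊆ O ∩ univ ×ˢ Ioc a b := fun p hp =>
    ⟨hAJ ⟨hp.1, (hlJ hp.2).1⟩, mem_univ _, (hlJ hp.2).2⟩
  refine lt_of_lt_of_le ?_ (measure_mono hsub)
  rw [baseMeasure, Measure.prod_prod]
  refine ENNReal.mul_pos (Measure.measure_pos_of_mem_nhds _ hA).ne' ?_
  rw [Measure.restrict_apply measurableSet_Ioc, inter_eq_left.mpr]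
  · simpa using hl
  · intro s hs
    have := (hlJ hs).2
    exact ⟨ha.trans_lt this.1, this.2.trans hb⟩

theorem stMeasure_eq_zero_iff {s : Set (E3 × ℝ)} (hs : MeasurableSet s) :
    S.stMeasure s = 0 ↔ S.baseMeasure (S.stFlow ⁻¹' s) = 0 := by
  rw [S.stMeasure_eq, Measure.map_apply S.continuous_stFlow.measurable hs]
  constructor
  · intro h
    refine withDensity_absolutelyContinuous' S.measurable_jac_uncurry.aemeasurable
      (Eventually.of_forall fun p => ?_) h
    simpa using S.jac_pos _ _
  · exact fun h => withDensity_absolutelyContinuous _ _ h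

end EvolvingSurface

namespace EvolvingSurface
variable (S : EvolvingSurface)

/-- The map is proper because `Γ₀` is compact. It transfers one-sided limits along the manifold to
limits on the cylinder. -/
theorem isClosedEmbedding_stFlow : IsClosedEmbedding S.stFlow := by
  refine .of_continuous_injective_isClosedMap S.continuous_stFlow S.stFlow_injective
    (IsProperMap.isClosedMap ?_)
  rw [isProperMap_iff_isCompact_preimage]
  refine ⟨S.continuous_stFlow, fun K hK => ?_⟩
  refine (isCompact_univ.prod (hK.image continuous_snd)).of_isClosed_subset
    (hK.isClosed.preimage S.continuous_stFlow) ?_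
  rintro ⟨y, t⟩ h
  exact ⟨mem_univ _, ⟨_, h, rfl⟩⟩

theorem stFlow_image {I : Set ℝ} (hI : I ⊆ Icc 0 S.T) : S.stFlow '' (univ ×ˢ I) = S.slab I := by
  ext ⟨x, t⟩
  constructor
  · rintro ⟨⟨y, s⟩, ⟨-, hs⟩, h⟩
    simp only [stFlow, Prod.mk.injEq] at h
    obtain ⟨rfl, rfl⟩ := h
    exact ⟨hs, S.flow_mem_Γ y (hI hs)⟩
  · rintro ⟨ht, hx⟩
    simp only at ht hx
    rw [← S.range_flow (hI ht)] at hx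
    obtain ⟨y, rfl⟩ := hx
    exact ⟨(y, t), ⟨mem_univ _, ht⟩, rfl⟩

theorem stFlow_mem_slab {I : Set ℝ} (hI : I ⊆ Icc 0 S.T) (p : S.Γ₀ × ℝ) : S.stFlow p ∈ S.slab I ↔ p.2 ∈ I :=
  ⟨fun h => h.1, fun h => ⟨h, S.flow_mem_Γ p.1 (hI h)⟩⟩

theorem nonempty_Γ₀ : Nonempty S.Γ₀ := S.isClosedSurface.isConnected.nonempty.to_subtype

variable {S}

theorem IsLipschitzOnCylinder.zero : S.IsLipschitzOnCylinder fun _ _ => 0 :=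
  ⟨continuous_const, fun _ => ⟨univ, univ_mem, 0, fun _ => (LipschitzWith.const 0).lipschitzOnWith⟩,
    0, fun _ => (LipschitzWith.const 0).lipschitzOnWith⟩

theorem IsLipschitzOnCylinder.const_mul {F : S.Γ₀ → ℝ → ℝ} (hF : S.IsLipschitzOnCylinder F) (c : ℝ) :
    S.IsLipschitzOnCylinder fun y t => c * F y t := by
  have key : ∀ {X : Type} [PseudoEMetricSpace X] {f : X → ℝ} {s : Set X} {C : ℝ≥0}, LipschitzOnWith C f s →
      LipschitzOnWith (‖c‖₊ * C) (fun x => c * f x) s := fun {X} _ {f s C} hf =>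
    (lipschitzWith_smul c).comp_lipschitzOnWith hf
  refine ⟨hF.continuous.const_mul c, fun x₀ => ?_, ?_⟩
  · obtain ⟨U, hU, C, hC⟩ := hF.space x₀
    exact ⟨U, hU, _, fun t => key (hC t)⟩
  · obtain ⟨C, hC⟩ := hF.time
    exact ⟨_, fun y => key (hC y)⟩

end EvolvingSurface

/-! ### Time slabs, active prisms and the finite element space. -/

namespace SpaceTimeMesh
variable {S : EvolvingSurface} (M : SpaceTimeMesh S)

theorem N_pos' : (0 : ℝ) < M.N := by exact_mod_cast M.N_pos

theorem step_pos : 0 < S.T / M.N := div_pos S.T_pos M.N_pos'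

@[simp] theorem node_zero : M.node 0 = 0 := by simp [node]

@[simp] theorem node_N : M.node M.N = S.T := by
  rw [node, mul_div_cancel₀]
  exact M.N_pos'.ne'

theorem node_strictMono : StrictMono M.node := fun a b h => by
  simp only [node]
  exact mul_lt_mul_of_pos_right (by exact_mod_cast h) M.step_pos

theorem node_nonneg (n : ℕ) : 0 ≤ M.node n := by
  rw [← M.node_zero]
  exact M.node_strictMono.monotone (Nat.zero_le n)

theorem node_le {n : ℕ} (hn : n ≤ M.N) : M.node n ≤ S.T := by
  rw [← M.node_N]
  exact M.node_strictMono.monotone hn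

theorem node_mem {n : ℕ} (hn : n ≤ M.N) : M.node n ∈ Icc 0 S.T := ⟨M.node_nonneg n, M.node_le hn⟩

theorem node_pred_lt {n : ℕ} (hn : n ∈ Finset.Icc 1 M.N) : M.node (n - 1) < M.node n := by
  have := (Finset.mem_Icc.mp hn).1
  exact M.node_strictMono (by omega)

theorem interval_subset {n : ℕ} (hn : n ∈ Finset.Icc 1 M.N) : M.interval n ⊆ Ioc 0 S.T := fun _ ht =>
  ⟨(M.node_nonneg _).trans_lt ht.1, ht.2.trans (M.node_le (Finset.mem_Icc.mp hn).2)⟩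

theorem interval_subset_Icc {n : ℕ} (hn : n ∈ Finset.Icc 1 M.N) : M.interval n ⊆ Icc 0 S.T :=
  (M.interval_subset hn).trans Ioc_subset_Icc_self

theorem exists_mem_interval {t : ℝ} (ht : t ∈ Ioc 0 S.T) : ∃ n ∈ Finset.Icc 1 M.N, t ∈ M.interval n := by
  have hex : ∃ n, t ≤ M.node n := ⟨M.N, by rw [M.node_N]; exact ht.2⟩
  classical
  have h0 : Nat.find hex ≠ 0 := fun h => by
    have := Nat.find_spec hex
    rw [h, M.node_zero] at this
    exact absurd ht.1 this.not_gt
  refine ⟨Nat.find hex, Finset.mem_Icc.mpr ⟨Nat.one_le_iff_ne_zero.mpr h0, Nat.find_min' hex ?_⟩, ?_, Nat.find_spec hex⟩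
  · rw [M.node_N]; exact ht.2
  · exact not_le.mp (Nat.find_min hex (by omega))

theorem le_node_iff {n k : ℕ} {t : ℝ} (hn : 1 ≤ n) (ht : t ∈ M.interval n) : t ≤ M.node k ↔ n ≤ k := by
  constructor
  · intro h
    by_contra hk
    have : M.node k ≤ M.node (n - 1) := M.node_strictMono.monotone (by omega)
    linarith [ht.1]
  · exact fun h => ht.2.trans (M.node_strictMono.monotone h)

theorem interval_unique {m n : ℕ} {t : ℝ} (hm : 1 ≤ m) (hn : 1 ≤ n) (htm : t ∈ M.interval m)
    (htn : t ∈ M.interval n) : m = n :=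
  le_antisymm ((M.le_node_iff hm htm).mp htn.2) ((M.le_node_iff hn htn).mp htm.2)

theorem interval_pairwiseDisjoint :
    (Finset.Icc 1 M.N : Set ℕ).PairwiseDisjoint M.interval := fun _ hm _ hn hmn =>
  disjoint_left.mpr fun _ htm htn => hmn
    (M.interval_unique (Finset.mem_Icc.mp hm).1 (Finset.mem_Icc.mp hn).1 htm htn)

theorem measurableSet_interval (n : ℕ) : MeasurableSet (M.interval n) := measurableSet_Ioc

/-- The space-time manifold is contained in the union of the active prisms. -/
theorem stFlow_mem_activeSlab {n : ℕ} (hn : n ∈ Finset.Icc 1 M.N) (y : S.Γ₀) {t : ℝ}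
    (ht : t ∈ M.interval n) : (S.flow y t, t) ∈ M.activeSlab n := by
  by_contra hcon
  have hK := M.isTriangulation n hn
  -- If the point were in no active prism, each prism would be null near it: a tetrahedron
  -- containing the point has an inactive, hence null, prism, and any other misses a neighbourhood.
  -- Finitely many such prisms cover the slab near the point, which contradicts positivity of the
  -- measure.
  have hbad : ∀ s ∈ (M.tri n).faces, ∃ O ∈ 𝓝 (y, t), s.card = 4 →
      S.baseMeasure (S.stFlow ⁻¹' (convexHull ℝ (s : Set E3) ×ˢ M.interval n) ∩ O) = 0 := by
    intro s hs
    by_cases hmem : S.flow y t ∈ convexHull ℝ (s : Set E3)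
    · refine ⟨univ, univ_mem, fun hc => ?_⟩
      rw [inter_univ, ← S.stMeasure_eq_zero_iff
        ((isClosed_convexHull_finset s).measurableSet.prod (M.measurableSet_interval n))]
      by_contra h
      exact hcon (mem_iUnion₂.mpr ⟨s, ⟨hs, hc, pos_iff_ne_zero.mpr h⟩, hmem, ht⟩)
    · refine ⟨(fun p : S.Γ₀ × ℝ => S.flow p.1 p.2) ⁻¹' (convexHull ℝ (s : Set E3))ᶜ,
        S.continuous_flow.continuousAt.preimage_mem_nhds
          ((isClosed_convexHull_finset s).isOpen_compl.mem_nhds hmem), fun _ => ?_⟩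
      convert! measure_empty (μ := S.baseMeasure)
      ext p
      simp only [mem_inter_iff, mem_preimage, mem_prod, mem_compl_iff, mem_empty_iff_false, iff_false]
      exact fun h => h.2 h.1.1
  choose! O hO hnull using hbad
  have hOn : (⋂ s ∈ (M.tri n).faces, O s) ∈ 𝓝 (y, t) := (biInter_mem hK.finite).mpr hO
  have hint := M.interval_subset hn
  have hpos := S.baseMeasure_pos ht (M.node_nonneg _) (M.node_le (Finset.mem_Icc.mp hn).2) hOn
  refine hpos.ne' (measure_mono_null (t := ⋃ s ∈ {s ∈ (M.tri n).faces | s.card = 4},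
    S.stFlow ⁻¹' (convexHull ℝ (s : Set E3) ×ˢ M.interval n) ∩ O s) ?_ ?_)
  · rintro p ⟨hp1, hp2⟩
    obtain ⟨s, hs, hc, hmem⟩ := hK.exists_tetrahedron (x := S.flow p.1 p.2)
      (subset_closure (S.flow_mem_Ω _ _))
    exact mem_iUnion₂.mpr ⟨s, ⟨hs, hc⟩, ⟨hmem, hp2.2⟩, mem_iInter₂.mp hp1 s hs⟩
  · rw [measure_biUnion_null_iff (hK.finite.subset fun s hs => hs.1).countable]
    exact fun s hs => hnull s hs.1 hs.2

/-- Functions that are of the form `φ₀(x) + t φ₁(x)` on the space-time manifold in the `n`-th time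
slab. -/
def IsFEOn (n : ℕ) (u : E3 × ℝ → ℝ) : Prop :=
  ∃ φ₀ ∈ piecewiseAffine (M.tri n), ∃ φ₁ ∈ piecewiseAffine (M.tri n),
    ∀ t ∈ M.interval n, ∀ y, u (S.flow y t, t) = φ₀ (S.flow y t) + t * φ₁ (S.flow y t)

theorem mem_manifold_iff {p : E3 × ℝ} : p ∈ S.manifold ↔ ∃ y : S.Γ₀, ∃ t ∈ Ioc 0 S.T, p = (S.flow y t, t) := by
  rw [EvolvingSurface.manifold, ← S.stFlow_image Ioc_subset_Icc_self]
  constructor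
  · rintro ⟨⟨y, t⟩, ⟨-, ht⟩, rfl⟩
    exact ⟨y, t, ht, rfl⟩
  · rintro ⟨y, t, ht, rfl⟩
    exact ⟨(y, t), ⟨mem_univ _, ht⟩, rfl⟩

/-- Since the manifold lies inside the active prisms, the restriction to these disappears from the
description of the traces. -/
theorem mem_surfaceSpace_iff {u : E3 × ℝ → ℝ} : u ∈ M.surfaceSpace ↔
    (∀ p ∉ S.manifold, u p = 0) ∧ ∀ n ∈ Finset.Icc 1 M.N, M.IsFEOn n u := by
  constructor
  · rintro ⟨v, hv, rfl⟩
    refine ⟨fun p hp => indicator_of_notMem hp v, fun n hn => ?_⟩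
    obtain ⟨φ₀, h₀, φ₁, h₁, h⟩ := hv n hn
    refine ⟨φ₀, h₀, φ₁, h₁, fun t ht y => ?_⟩
    rw [indicator_of_mem (mem_manifold_iff.mpr ⟨y, t, M.interval_subset hn ht, rfl⟩),
      h _ (M.stFlow_mem_activeSlab hn y ht)]
  · rintro ⟨h0, hu⟩
    choose! φ₀ h₀ φ₁ h₁ h using hu
    classical
    refine ⟨fun p => ∑ n ∈ Finset.Icc 1 M.N, if p.2 ∈ M.interval n then φ₀ n p.1 + p.2 * φ₁ n p.1 else 0,
      fun n hn => ⟨φ₀ n, h₀ n hn, φ₁ n, h₁ n hn, fun p hp => ?_⟩, ?_⟩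
    · obtain ⟨s, -, hps⟩ := mem_iUnion₂.mp hp
      beta_reduce
      rw [Finset.sum_eq_single_of_mem n hn, if_pos hps.2]
      intro m hm hmn
      rw [if_neg]
      exact fun hpm => hmn (M.interval_unique (Finset.mem_Icc.mp hm).1 (Finset.mem_Icc.mp hn).1 hpm hps.2)
    · funext p
      by_cases hp : p ∈ S.manifold
      · rw [indicator_of_mem hp]
        obtain ⟨y, t, ht, rfl⟩ := mem_manifold_iff.mp hp
        obtain ⟨n, hn, htn⟩ := M.exists_mem_interval ht
        rw [Finset.sum_eq_single_of_mem n hn, if_pos htn, h n hn t htn y]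
        intro m hm hmn
        rw [if_neg]
        exact fun hpm => hmn (M.interval_unique (Finset.mem_Icc.mp hm).1 (Finset.mem_Icc.mp hn).1 hpm htn)
      · rw [indicator_of_notMem hp, h0 p hp]

/-- The surface finite element space as a linear space. -/
def surfaceSubmodule : Submodule ℝ (E3 × ℝ → ℝ) where
  carrier := M.surfaceSpace
  add_mem' := by
    intro u v hu hv
    rw [mem_surfaceSpace_iff] at *
    refine ⟨fun p hp => by simp [hu.1 p hp, hv.1 p hp], fun n hn => ?_⟩
    obtain ⟨φ₀, h₀, φ₁, h₁, h⟩ := hu.2 n hn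
    obtain ⟨ψ₀, k₀, ψ₁, k₁, k⟩ := hv.2 n hn
    refine ⟨_, piecewiseAffine_add h₀ k₀, _, piecewiseAffine_add h₁ k₁, fun t ht y => ?_⟩
    rw [Pi.add_apply, h t ht y, k t ht y]
    ring
  zero_mem' := by
    rw [mem_surfaceSpace_iff]
    exact ⟨fun _ _ => rfl, fun n _ => ⟨_, piecewiseAffine_zero, _, piecewiseAffine_zero, by simp⟩⟩
  smul_mem' := by
    intro c u hu
    rw [mem_surfaceSpace_iff] at *
    refine ⟨fun p hp => by simp [hu.1 p hp], fun n hn => ?_⟩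
    obtain ⟨φ₀, h₀, φ₁, h₁, h⟩ := hu.2 n hn
    refine ⟨_, piecewiseAffine_const_mul h₀ c, _, piecewiseAffine_const_mul h₁ c, fun t ht y => ?_⟩
    rw [Pi.smul_apply, h t ht y, smul_eq_mul]
    ring

theorem mem_surfaceSubmodule {u : E3 × ℝ → ℝ} : u ∈ M.surfaceSubmodule ↔ u ∈ M.surfaceSpace := Iff.rfl

/-- Fixing for every point of the manifold a slab and a tetrahedron that contain it, each function
is determined by two affine functions for each of finitely many pairs of slab and tetrahedron. -/
instance finiteDimensional_surfaceSubmodule : FiniteDimensional ℝ M.surfaceSubmodule := by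
  classical
  let J : Set (ℕ × Finset E3) := {i | i.1 ∈ Finset.Icc 1 M.N ∧ i.2 ∈ (M.tri i.1).faces ∧ i.2.card = 4}
  have hJ : J.Finite := by
    refine ((Finset.Icc 1 M.N).finite_toSet.biUnion (t := fun n => Prod.mk n '' (M.tri n).faces)
      fun n hn => (M.isTriangulation n hn).finite.image _).subset ?_
    rintro ⟨n, s⟩ ⟨hn, hs, -⟩
    exact mem_iUnion₂.mpr ⟨n, hn, s, hs, rfl⟩
  have hloc : ∀ p ∈ S.manifold, ∃ i : J, p.2 ∈ M.interval i.1.1 ∧ p.1 ∈ convexHull ℝ (i.1.2 : Set E3) := by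
    intro p hp
    obtain ⟨y, t, ht, rfl⟩ := mem_manifold_iff.mp hp
    obtain ⟨n, hn, htn⟩ := M.exists_mem_interval ht
    obtain ⟨s, hs, hc, hmem⟩ := (M.isTriangulation n hn).exists_tetrahedron
      (subset_closure (S.flow_mem_Ω y t))
    exact ⟨⟨(n, s), hn, hs, hc⟩, htn, hmem⟩
  have : Nonempty J := by
    obtain ⟨y⟩ := S.nonempty_Γ₀
    exact ⟨(hloc (S.flow y S.T, S.T) (mem_manifold_iff.mpr
      ⟨y, S.T, right_mem_Ioc.mpr S.T_pos, rfl⟩)).choose⟩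
  choose! i hi1 hi2 using hloc
  have : Finite J := hJ
  let F : (J → (E3 →ᵃ[ℝ] ℝ) × (E3 →ᵃ[ℝ] ℝ)) →ₗ[ℝ] (E3 × ℝ → ℝ) :=
    { toFun := fun L p => if p ∈ S.manifold then (L (i p)).1 p.1 + p.2 * (L (i p)).2 p.1 else 0
      map_add' := fun L L' => by
        funext p
        simp only [Pi.add_apply, Prod.fst_add, Prod.snd_add, AffineMap.coe_add]
        split_ifs <;> ring
      map_smul' := fun c L => by
        funext p
        simp only [Pi.smul_apply, Prod.smul_fst, Prod.smul_snd, AffineMap.coe_smul, smul_eq_mul,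
          RingHom.id_apply]
        split_ifs <;> ring }
  refine Submodule.finiteDimensional_of_le (S₂ := LinearMap.range F) fun u hu => ?_
  rw [mem_surfaceSubmodule, mem_surfaceSpace_iff] at hu
  obtain ⟨h0, hu⟩ := hu
  choose! φ₀ h₀ φ₁ h₁ h using hu
  have hL₀ : ∀ j : J, ∃ L : E3 →ᵃ[ℝ] ℝ, EqOn (φ₀ j.1.1) L (convexHull ℝ (j.1.2 : Set E3)) := fun j =>
    (h₀ _ j.2.1).2 _ j.2.2.1 j.2.2.2
  have hL₁ : ∀ j : J, ∃ L : E3 →ᵃ[ℝ] ℝ, EqOn (φ₁ j.1.1) L (convexHull ℝ (j.1.2 : Set E3)) := fun j =>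
    (h₁ _ j.2.1).2 _ j.2.2.1 j.2.2.2
  choose L₀ hL₀ using hL₀
  choose L₁ hL₁ using hL₁
  refine ⟨fun j => (L₀ j, L₁ j), ?_⟩
  funext p
  by_cases hp : p ∈ S.manifold
  · simp only [F, LinearMap.coe_mk, AddHom.coe_mk, if_pos hp]
    rw [← hL₀ _ (hi2 p hp), ← hL₁ _ (hi2 p hp)]
    have := hi1 p hp
    generalize i p = j at *
    obtain ⟨y, t, ht, rfl⟩ := mem_manifold_iff.mp hp
    exact (h _ j.2.1 t this y).symm
  · simp only [F, LinearMap.coe_mk, AddHom.coe_mk, if_neg hp, h0 p hp]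

/-- The restriction of a finite element function to the first `k` time slabs. -/
def truncate (k : ℕ) (u : E3 × ℝ → ℝ) (p : E3 × ℝ) : ℝ :=
  {p : E3 × ℝ | p.2 ≤ M.node k}.indicator u p

/-- No continuity is required across the time nodes, so zero may be chosen on all later slabs. -/
theorem truncate_mem {u : E3 × ℝ → ℝ} (hu : u ∈ M.surfaceSpace) (k : ℕ) : M.truncate k u ∈ M.surfaceSpace := by
  rw [mem_surfaceSpace_iff] at *
  refine ⟨fun p hp => by simp [truncate, indicator_apply, hu.1 p hp], fun n hn => ?_⟩
  have h1 := (Finset.mem_Icc.mp hn).1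
  by_cases hk : n ≤ k
  · obtain ⟨φ₀, h₀, φ₁, h₁, h⟩ := hu.2 n hn
    refine ⟨φ₀, h₀, φ₁, h₁, fun t ht y => ?_⟩
    rw [truncate, indicator_of_mem, h t ht y]
    exact (M.le_node_iff h1 ht).mpr hk
  · refine ⟨_, piecewiseAffine_zero, _, piecewiseAffine_zero, fun t ht y => ?_⟩
    rw [truncate, indicator_of_notMem]
    · simp
    · exact fun h => hk ((M.le_node_iff h1 ht).mp h)

/-! ### Lifts to the cylinder over the initial surface, and one-sided traces. -/

/-- `H n` represents the function `u` on the `n`-th time slab in the particle coordinates, and is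
Lipschitz up to the boundary of the slab. -/
structure IsLift (u : E3 × ℝ → ℝ) (H : ℕ → S.Γ₀ → ℝ → ℝ) : Prop where
  lipschitz : ∀ n ∈ Finset.Icc 1 M.N, S.IsLipschitzOnCylinder (H n)
  eq : ∀ n ∈ Finset.Icc 1 M.N, ∀ t ∈ M.interval n, ∀ y, u (S.flow y t, t) = H n y t

theorem exists_isLift {u : E3 × ℝ → ℝ} (hu : u ∈ M.surfaceSpace) : ∃ H, M.IsLift u H := by
  rw [mem_surfaceSpace_iff] at hu
  obtain ⟨h0, hu⟩ := hu
  choose! φ₀ h₀ φ₁ h₁ h using hu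
  refine ⟨fun n y t => φ₀ n (S.flow y t) + S.clamp t * φ₁ n (S.flow y t), fun n hn =>
    EvolvingSurface.isLipschitzOnCylinder_of_piecewiseAffine (M.isTriangulation n hn) (h₀ n hn) (h₁ n hn),
    fun n hn t ht y => ?_⟩
  rw [h n hn t ht y, S.clamp_of_mem (M.interval_subset_Icc hn ht)]

variable {M}

theorem IsLift.add {u v : E3 × ℝ → ℝ} {H G : ℕ → S.Γ₀ → ℝ → ℝ} (hu : M.IsLift u H) (hv : M.IsLift v G) :
    M.IsLift (u + v) fun n y t => H n y t + G n y t :=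
  ⟨fun n hn => (hu.lipschitz n hn).add (hv.lipschitz n hn), fun n hn t ht y => by
    rw [Pi.add_apply, hu.eq n hn t ht y, hv.eq n hn t ht y]⟩

theorem IsLift.smul {u : E3 × ℝ → ℝ} {H : ℕ → S.Γ₀ → ℝ → ℝ} (hu : M.IsLift u H) (c : ℝ) :
    M.IsLift (c • u) fun n y t => c * H n y t :=
  ⟨fun n hn => (hu.lipschitz n hn).const_mul c, fun n hn t ht y => by
    rw [Pi.smul_apply, hu.eq n hn t ht y, smul_eq_mul]⟩

theorem IsLift.truncate {u : E3 × ℝ → ℝ} {H : ℕ → S.Γ₀ → ℝ → ℝ} (hu : M.IsLift u H) (k : ℕ) :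
    M.IsLift (M.truncate k u) fun n y t => if n ≤ k then H n y t else 0 := by
  refine ⟨fun n hn => ?_, fun n hn t ht y => ?_⟩
  · by_cases h : n ≤ k
    · simpa only [if_pos h] using hu.lipschitz n hn
    · simpa only [if_neg h] using EvolvingSurface.IsLipschitzOnCylinder.zero
  · have h1 := (Finset.mem_Icc.mp hn).1
    by_cases h : n ≤ k
    · rw [if_pos h, SpaceTimeMesh.truncate, indicator_of_mem, hu.eq n hn t ht y]
      exact (M.le_node_iff h1 ht).mpr h
    · rw [if_neg h, SpaceTimeMesh.truncate, indicator_of_notMem]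
      exact fun h' => h ((M.le_node_iff h1 ht).mp h')

/-- The lift is continuous up to the end of the slab and supplies the limit. `limUnder` is
meaningful only along a nontrivial filter, hence the instance assumption on `𝓝[I] t`. -/
theorem IsLift.limUnder_eq {u : E3 × ℝ → ℝ} {H : ℕ → S.Γ₀ → ℝ → ℝ} (hu : M.IsLift u H) {n : ℕ}
    (hn : n ∈ Finset.Icc 1 M.N) (y : S.Γ₀) {t : ℝ} {I : Set ℝ} (hI : I ⊆ Icc 0 S.T) [(𝓝[I] t).NeBot]
    (ht : ∀ᶠ s in 𝓝[I] t, s ∈ M.interval n) :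
    limUnder (𝓝[S.slab I] (S.flow y t, t)) u = H n y t := by
  have h : 𝓝[S.slab I] (S.flow y t, t) = (𝓝[univ ×ˢ I] (y, t)).map S.stFlow := by
    rw [S.isClosedEmbedding_stFlow.isEmbedding.map_nhdsWithin_eq, S.stFlow_image hI]
    rfl
  rw [nhdsWithin_prod_eq, nhdsWithin_univ] at h
  have hT : Tendsto u (𝓝[S.slab I] (S.flow y t, t)) (𝓝 (H n y t)) := by
    rw [h, tendsto_map'_iff]
    have hc : Tendsto (fun p : S.Γ₀ × ℝ => H n p.1 p.2) (𝓝 y ×ˢ 𝓝[I] t) (𝓝 (H n y t)) :=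
      ((hu.lipschitz n hn).continuous.tendsto (y, t)).mono_left (by
        rw [nhds_prod_eq]
        exact Filter.prod_mono_right _ nhdsWithin_le_nhds)
    refine hc.congr' ?_
    filter_upwards [ht.prod_inr (𝓝 y)] with p hp
    exact (hu.eq n hn p.2 hp p.1).symm
  have : (𝓝[S.slab I] (S.flow y t, t)).NeBot := by
    rw [h]
    infer_instance
  exact hT.limUnder_eq

theorem IsLift.traceLeft {u : E3 × ℝ → ℝ} {H : ℕ → S.Γ₀ → ℝ → ℝ} (hu : M.IsLift u H) {n : ℕ}
    (hn : n ∈ Finset.Icc 1 M.N) (y : S.Γ₀) :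
    M.traceLeft u n (S.flow y (M.node n)) = H n y (M.node n) := by
  have h1 := M.node_pred_lt hn
  have h0 : 0 < M.node n := (M.node_nonneg _).trans_lt h1
  have := right_nhdsWithin_Ioo_neBot h0
  refine hu.limUnder_eq hn y (fun t ht => ⟨ht.1.le, ht.2.le.trans (M.node_le (Finset.mem_Icc.mp hn).2)⟩) ?_
  filter_upwards [mem_nhdsWithin_of_mem_nhds (lt_mem_nhds h1), self_mem_nhdsWithin] with s hs hs'
  exact ⟨hs, hs'.2.le⟩

theorem IsLift.traceRight {u : E3 × ℝ → ℝ} {H : ℕ → S.Γ₀ → ℝ → ℝ} (hu : M.IsLift u H) {n : ℕ}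
    (hn : n ∈ Finset.Icc 1 M.N) (y : S.Γ₀) :
    M.traceRight u (n - 1) (S.flow y (M.node (n - 1))) = H n y (M.node (n - 1)) := by
  have h1 := M.node_pred_lt hn
  have hT := M.node_le (Finset.mem_Icc.mp hn).2
  have : (𝓝[Ioc (M.node (n - 1)) S.T] (M.node (n - 1))).NeBot := left_nhdsWithin_Ioc_neBot (h1.trans_le hT)
  refine hu.limUnder_eq hn y (fun t ht => ⟨(M.node_nonneg _).trans ht.1.le, ht.2⟩) ?_
  filter_upwards [mem_nhdsWithin_of_mem_nhds (gt_mem_nhds h1), self_mem_nhdsWithin] with s hs hs'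
  exact ⟨hs'.1, hs.le⟩

end SpaceTimeMesh

/-! ### Integrability and almost everywhere linearity of gradient and material derivative. -/

namespace EvolvingSurface
variable (S : EvolvingSurface)

theorem baseMeasure_restrict {I : Set ℝ} (hI : I ⊆ Ioc 0 S.T) (hm : MeasurableSet I) :
    S.baseMeasure.restrict (univ ×ˢ I) = S.surfMeasure.prod (volume.restrict I) := by
  rw [baseMeasure, ← Measure.prod_restrict, Measure.restrict_univ, Measure.restrict_restrict hm,
    inter_eq_left.mpr hI]

theorem ae_mem_Ioc : ∀ᵐ p ∂S.baseMeasure, p.2 ∈ Ioc 0 S.T := by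
  rw [baseMeasure]
  exact Measure.quasiMeasurePreserving_snd.ae (ae_restrict_mem measurableSet_Ioc)

theorem memLp_top_of_continuous {g : S.Γ₀ × ℝ → ℝ} (hg : Continuous g) : MemLp g ∞ S.baseMeasure := by
  obtain ⟨C, hC⟩ := (isCompact_univ.prod (isCompact_Icc (a := (0 : ℝ)) (b := S.T))).exists_bound_of_continuousOn
    (hg.continuousOn (s := (univ : Set S.Γ₀) ×ˢ Icc 0 S.T))
  refine memLp_top_of_bound hg.aestronglyMeasurable C ?_
  filter_upwards [S.ae_mem_Ioc] with p hp
  exact hC p ⟨mem_univ _, Ioc_subset_Icc_self hp⟩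

instance : IsFiniteMeasure S.stMeasure := by
  rw [stMeasure_eq]
  have := isFiniteMeasure_withDensity_ofReal (μ := S.baseMeasure) (f := fun p => S.jac p.1 p.2)
    ((S.memLp_top_of_continuous S.continuous_jac).integrable le_top).2
  infer_instance

theorem absolutelyContinuous_base :
    S.baseMeasure.withDensity (fun p => ENNReal.ofReal (S.jac p.1 p.2)) ≪ S.baseMeasure :=
  withDensity_absolutelyContinuous _ _

theorem ae_stMeasure {q : E3 × ℝ → Prop} (h : ∀ᵐ p ∂S.baseMeasure, q (S.stFlow p)) :
    ∀ᵐ p ∂S.stMeasure, q p := by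
  rw [S.stMeasure_eq, S.measurableEmbedding_stFlow.ae_map_iff]
  exact S.absolutelyContinuous_base.ae_le h

theorem ae_baseMeasure {q : E3 × ℝ → Prop} (h : ∀ᵐ p ∂S.stMeasure, q p) :
    ∀ᵐ p ∂S.baseMeasure, q (S.stFlow p) := by
  rw [S.stMeasure_eq, S.measurableEmbedding_stFlow.ae_map_iff] at h
  refine (withDensity_absolutelyContinuous' S.measurable_jac_uncurry.aemeasurable
      (Eventually.of_forall fun p => ?_)).ae_le h
  simpa using S.jac_pos _ _

theorem memLp_top_stMeasure {F : Type*} [NormedAddCommGroup F] {g : E3 × ℝ → F}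
    (h : MemLp (fun p => g (S.stFlow p)) ∞ S.baseMeasure) : MemLp g ∞ S.stMeasure := by
  rw [S.stMeasure_eq, S.measurableEmbedding_stFlow.memLp_map_measure_iff]
  refine ⟨h.1.mono_ac S.absolutelyContinuous_base, lt_of_le_of_lt ?_ h.2⟩
  simp only [eLpNorm_exponent_top]
  exact eLpNormEssSup_mono_measure _ S.absolutelyContinuous_base

theorem integral_stMeasure (g : E3 × ℝ → ℝ) :
    ∫ p, g p ∂S.stMeasure = ∫ p, S.jac p.1 p.2 * g (S.stFlow p) ∂S.baseMeasure := by
  rw [S.stMeasure_eq, S.measurableEmbedding_stFlow.integral_map,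
    integral_withDensity_eq_integral_toReal_smul S.measurable_jac_uncurry (by simp)]
  refine integral_congr_ae (Eventually.of_forall fun p => ?_)
  simp [ENNReal.toReal_ofReal (S.jac_pos _ _).le]

theorem measurableSet_slab {I : Set ℝ} (hI : I ⊆ Icc 0 S.T) (hm : MeasurableSet I) :
    MeasurableSet (S.slab I) := by
  rw [← S.stFlow_image hI]
  exact S.measurableEmbedding_stFlow.measurableSet_image.mpr (MeasurableSet.univ.prod hm)

theorem setIntegral_stMeasure {I : Set ℝ} (hI : I ⊆ Ioc 0 S.T) (hm : MeasurableSet I) (g : E3 × ℝ → ℝ) :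
    ∫ p in S.slab I, g p ∂S.stMeasure =
      ∫ p, S.jac p.1 p.2 * g (S.stFlow p) ∂S.surfMeasure.prod (volume.restrict I) := by
  have hI' := hI.trans Ioc_subset_Icc_self
  rw [← integral_indicator (S.measurableSet_slab hI' hm), S.integral_stMeasure,
    ← S.baseMeasure_restrict hI hm, ← integral_indicator (MeasurableSet.univ.prod hm)]
  refine integral_congr_ae (Eventually.of_forall fun p => ?_)
  by_cases h : p.2 ∈ I
  · simp [indicator_of_mem ((S.stFlow_mem_slab hI' p).mpr h), h]
  · simp [indicator_of_notMem (fun h' => h ((S.stFlow_mem_slab hI' p).mp h')), h]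

theorem memLp_divW : MemLp S.divW ∞ S.stMeasure := by
  refine S.memLp_top_stMeasure ((memLp_congr_ae ?_).mp (S.memLp_top_of_continuous S.continuous_divFlow))
  filter_upwards [S.ae_mem_Ioc] with p hp
  simp only [divFlow, stFlow, S.clamp_of_mem (Ioc_subset_Icc_self hp)]

/-- Injectivity of the flow makes the preimage chosen in `matDeriv` the actual starting point. -/
theorem invFunOn_flow (y : S.Γ₀) {t : ℝ} (ht : t ∈ Icc 0 S.T) :
    Function.invFunOn (fun y => S.Φ y t) S.Γ₀ (S.flow y t) = y := by
  have hex : ∃ z ∈ S.Γ₀, (fun y => S.Φ y t) z = S.flow y t := ⟨y, y.2, (S.flow_of_mem y ht).symm⟩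
  have h1 := Function.invFunOn_mem hex
  have h2 := Function.invFunOn_eq hex
  generalize Function.invFunOn (fun y => S.Φ y t) S.Γ₀ (S.flow y t) = z at *
  have h3 : S.flow ⟨z, h1⟩ t = S.flow y t := by rw [S.flow_of_mem ⟨z, h1⟩ ht]; exact h2
  exact congrArg Subtype.val (S.flow_injective t h3)

theorem baseMeasure_time_null (t : ℝ) : ∀ᵐ p ∂S.baseMeasure, p.2 ≠ t := by
  rw [baseMeasure]
  exact Measure.quasiMeasurePreserving_snd.ae (ae_restrict_of_ae (Measure.ae_ne volume t))

end EvolvingSurface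

namespace SpaceTimeMesh
variable {S : EvolvingSurface} (M : SpaceTimeMesh S)

theorem baseMeasure_eq_restrict :
    S.baseMeasure = S.baseMeasure.restrict (⋃ n ∈ Finset.Icc 1 M.N, univ ×ˢ M.interval n) := by
  refine (Measure.restrict_eq_self_of_ae_mem ?_).symm
  filter_upwards [S.ae_mem_Ioc] with p hp
  obtain ⟨n, hn, h⟩ := M.exists_mem_interval hp
  exact mem_iUnion₂.mpr ⟨n, hn, mem_univ _, h⟩

theorem ae_baseMeasure_of_slabs {q : S.Γ₀ × ℝ → Prop}
    (h : ∀ n ∈ Finset.Icc 1 M.N, ∀ᵐ p ∂S.baseMeasure.restrict (univ ×ˢ M.interval n), q p) :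
    ∀ᵐ p ∂S.baseMeasure, q p := by
  rw [M.baseMeasure_eq_restrict]
  exact (ae_restrict_biUnion_finset_iff _ _ _).mpr h

theorem memLp_top_of_slabs {F : Type*} [NormedAddCommGroup F] {g : E3 × ℝ → F}
    (h : ∀ n ∈ Finset.Icc 1 M.N, ∃ C : ℝ,
      AEStronglyMeasurable (fun p => g (S.stFlow p)) (S.baseMeasure.restrict (univ ×ˢ M.interval n)) ∧
      ∀ᵐ p ∂S.baseMeasure.restrict (univ ×ˢ M.interval n), ‖g (S.stFlow p)‖ ≤ C) :
    MemLp g ∞ S.stMeasure := by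
  choose! C hC using h
  obtain ⟨B, hB⟩ := ((Finset.Icc 1 M.N).finite_toSet.image C).bddAbove
  refine S.memLp_top_stMeasure (memLp_top_of_bound ?_ B (M.ae_baseMeasure_of_slabs fun n hn => ?_))
  · have h : ⋃ n ∈ Finset.Icc 1 M.N, (univ : Set S.Γ₀) ×ˢ M.interval n =
        ⋃ n : Finset.Icc 1 M.N, univ ×ˢ M.interval n := by
      ext
      simp only [mem_iUnion, Subtype.exists, exists_prop]
    rw [M.baseMeasure_eq_restrict, h, aestronglyMeasurable_iUnion_iff]
    exact fun n => (hC n n.2).1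
  · filter_upwards [(hC n hn).2] with p hp
    exact hp.trans (hB ⟨n, hn, rfl⟩)

theorem ae_mem_Ioo {n : ℕ} : ∀ᵐ p ∂S.baseMeasure.restrict (univ ×ˢ M.interval n),
    p.2 ∈ Ioo (M.node (n - 1)) (M.node n) := by
  filter_upwards [ae_restrict_of_ae (S.baseMeasure_time_null (M.node n)),
    ae_restrict_mem (MeasurableSet.univ.prod (M.measurableSet_interval n))] with p h1 h2
  exact ⟨h2.2.1, lt_of_le_of_ne h2.2.2 h1⟩

variable {M}
variable {u v : E3 × ℝ → ℝ} {H : ℕ → S.Γ₀ → ℝ → ℝ}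

theorem IsLift.memLp (hu : M.IsLift u H) : MemLp u ∞ S.stMeasure := by
  refine M.memLp_top_of_slabs fun n hn => ?_
  have hI := M.interval_subset_Icc hn
  obtain ⟨C, -, hC⟩ := (hu.lipschitz n hn).exists_bound
  have hae : ∀ᵐ p ∂S.baseMeasure.restrict (univ ×ˢ M.interval n), p.2 ∈ M.interval n ∧
      H n p.1 p.2 = u (S.stFlow p) := by
    filter_upwards [ae_restrict_mem (MeasurableSet.univ.prod (M.measurableSet_interval n))] with p hp
    exact ⟨hp.2, (hu.eq n hn p.2 hp.2 p.1).symm⟩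
  refine ⟨C, (hu.lipschitz n hn).continuous.aestronglyMeasurable.congr (hae.mono fun p hp => hp.2), ?_⟩
  filter_upwards [hae] with p hp
  rw [← hp.2]
  exact hC _ _ (hI hp.1)

theorem IsLift.memLp_grad (hu : M.IsLift u H) : MemLp (S.grad u) ∞ S.stMeasure := by
  refine M.memLp_top_of_slabs fun n hn => ?_
  obtain ⟨C, h1, h2⟩ := EvolvingSurface.exists_grad_bound (hu.lipschitz n hn)
    (M.measurableSet_interval n) (M.interval_subset_Icc hn) (hu.eq n hn)
  exact ⟨C, h1, h2.mono fun p hp => hp.1⟩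

theorem IsLift.ae_differentiableWithinAt (hu : M.IsLift u H) : ∀ᵐ p ∂S.stMeasure,
    DifferentiableWithinAt ℝ (fun x => u (x, p.2)) (S.Γ p.2) p.1 := by
  refine S.ae_stMeasure (M.ae_baseMeasure_of_slabs fun n hn => ?_)
  obtain ⟨C, h1, h2⟩ := EvolvingSurface.exists_grad_bound (hu.lipschitz n hn)
    (M.measurableSet_interval n) (M.interval_subset_Icc hn) (hu.eq n hn)
  exact h2.mono fun p hp => hp.2

/-- Times are interior to the slab, because at the right node a two-sided derivative would also see
the next slab. The excluded times form a null set. -/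
theorem IsLift.eventuallyEq_path (hu : M.IsLift u H) {n : ℕ} (hn : n ∈ Finset.Icc 1 M.N) (y : S.Γ₀) {t : ℝ}
    (ht : t ∈ Ioo (M.node (n - 1)) (M.node n)) :
    (fun s => u (S.Φ (Function.invFunOn (fun y => S.Φ y t) S.Γ₀ (S.flow y t)) s, s)) =ᶠ[𝓝 t] H n y := by
  rw [S.invFunOn_flow y (M.interval_subset_Icc hn (Ioo_subset_Ioc_self ht))]
  filter_upwards [Ioo_mem_nhds ht.1 ht.2] with s hs
  rw [← hu.eq n hn s (Ioo_subset_Ioc_self hs) y,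
    S.flow_of_mem y (M.interval_subset_Icc hn (Ioo_subset_Ioc_self hs))]

theorem IsLift.matDeriv_eq (hu : M.IsLift u H) {n : ℕ} (hn : n ∈ Finset.Icc 1 M.N) (y : S.Γ₀) {t : ℝ}
    (ht : t ∈ Ioo (M.node (n - 1)) (M.node n)) : S.matDeriv u (S.stFlow (y, t)) = deriv (H n y) t :=
  (hu.eventuallyEq_path hn y ht).deriv_eq

/-- One-dimensional Rademacher on every particle path, then Fubini with the paths as fibres. -/
theorem IsLift.ae_differentiableAt_lift (hu : M.IsLift u H) {n : ℕ} (hn : n ∈ Finset.Icc 1 M.N) :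
    ∀ᵐ p ∂S.baseMeasure.restrict (univ ×ˢ M.interval n), DifferentiableAt ℝ (H n p.1) p.2 := by
  have hL := hu.lipschitz n hn
  rw [S.baseMeasure_restrict (M.interval_subset hn) (M.measurableSet_interval n)]
  have hms := measurableSet_of_differentiableAt_with_param ℝ (f := H n) hL.continuous
  refine (Measure.ae_prod_mem_iff_ae_ae_mem hms).mpr (Eventually.of_forall fun y => ?_)
  obtain ⟨C, hC⟩ := hL.time
  have hsub : Ioo (M.node (n - 1)) (M.node n) ⊆ Icc 0 S.T :=
    Ioo_subset_Ioc_self.trans (M.interval_subset_Icc hn)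
  have h1 := ((hC y).mono hsub).ae_differentiableWithinAt_of_mem_real
  filter_upwards [ae_restrict_of_ae h1, ae_restrict_of_ae (Measure.ae_ne volume (M.node n)),
    ae_restrict_mem (M.measurableSet_interval n)] with t h2 h3 h4
  have h5 : t ∈ Ioo (M.node (n - 1)) (M.node n) := ⟨h4.1, lt_of_le_of_ne h4.2 h3⟩
  exact (h2 h5).differentiableAt (Ioo_mem_nhds h5.1 h5.2)

theorem IsLift.memLp_matDeriv (hu : M.IsLift u H) : MemLp (S.matDeriv u) ∞ S.stMeasure := by
  refine M.memLp_top_of_slabs fun n hn => ?_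
  have hL := hu.lipschitz n hn
  obtain ⟨C, hC⟩ := hL.time
  have hae : ∀ᵐ p ∂S.baseMeasure.restrict (univ ×ˢ M.interval n),
      p.2 ∈ Ioo (M.node (n - 1)) (M.node n) ∧ deriv (H n p.1) p.2 = S.matDeriv u (S.stFlow p) := by
    filter_upwards [M.ae_mem_Ioo] with p hp
    exact ⟨hp, (hu.matDeriv_eq hn p.1 hp).symm⟩
  refine ⟨C, (measurable_deriv_with_param (f := H n) hL.continuous).aestronglyMeasurable.congr
    (hae.mono fun p hp => hp.2), ?_⟩
  filter_upwards [hae] with p hp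
  rw [← hp.2]
  refine norm_deriv_le_of_lipschitzOn (s := Icc 0 S.T) ?_ (hC p.1)
  exact mem_of_superset (Ioo_mem_nhds hp.1.1 hp.1.2)
    (Ioo_subset_Ioc_self.trans (M.interval_subset_Icc hn))

theorem IsLift.ae_differentiableAt_path (hu : M.IsLift u H) : ∀ᵐ p ∂S.stMeasure, DifferentiableAt ℝ
    (fun s => u (S.Φ (Function.invFunOn (fun y => S.Φ y p.2) S.Γ₀ p.1) s, s)) p.2 := by
  refine S.ae_stMeasure (M.ae_baseMeasure_of_slabs fun n hn => ?_)
  filter_upwards [hu.ae_differentiableAt_lift hn, M.ae_mem_Ioo] with p h1 h2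
  exact (hu.eventuallyEq_path hn p.1 h2).differentiableAt_iff.mpr h1

variable {G : ℕ → S.Γ₀ → ℝ → ℝ}

theorem IsLift.grad_add (hu : M.IsLift u H) (hv : M.IsLift v G) :
    S.grad (u + v) =ᵐ[S.stMeasure] S.grad u + S.grad v := by
  filter_upwards [hu.ae_differentiableWithinAt, hv.ae_differentiableWithinAt] with p h1 h2
  exact tangentGrad_add h1 h2

theorem IsLift.grad_smul (hu : M.IsLift u H) (c : ℝ) :
    S.grad (c • u) =ᵐ[S.stMeasure] c • S.grad u := by
  filter_upwards [hu.ae_differentiableWithinAt] with p h1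
  exact tangentGrad_const_mul h1 c

theorem IsLift.matDeriv_add (hu : M.IsLift u H) (hv : M.IsLift v G) :
    S.matDeriv (u + v) =ᵐ[S.stMeasure] S.matDeriv u + S.matDeriv v := by
  filter_upwards [hu.ae_differentiableAt_path, hv.ae_differentiableAt_path] with p h1 h2
  exact deriv_fun_add h1 h2

theorem IsLift.matDeriv_smul (hu : M.IsLift u H) (c : ℝ) :
    S.matDeriv (c • u) =ᵐ[S.stMeasure] c • S.matDeriv u := by
  filter_upwards [hu.ae_differentiableAt_path] with p h1
  exact deriv_const_mul c h1

end SpaceTimeMesh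

/-! ### Integrals over time slices, and coercivity at a fixed time. -/

namespace EvolvingSurface
variable (S : EvolvingSurface)

theorem integrable_jac_mul {g : E3 × ℝ → ℝ} (hg : Integrable g S.stMeasure) :
    Integrable (fun p => S.jac p.1 p.2 * g (S.stFlow p)) S.baseMeasure := by
  rw [S.stMeasure_eq, S.measurableEmbedding_stFlow.integrable_map_iff,
    integrable_withDensity_iff_integrable_smul₀' S.measurable_jac_uncurry.aemeasurable (by simp)] at hg
  refine hg.congr (Eventually.of_forall fun p => ?_)
  simp [ENNReal.toReal_ofReal (S.jac_pos _ _).le]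

theorem integrableOn_surfaceIntegral {g : E3 × ℝ → ℝ} (hg : Integrable g S.stMeasure) :
    IntegrableOn (fun t => surfaceIntegral (S.Γ t) fun x => g (x, t)) (Ioc 0 S.T) := by
  refine (S.integrable_jac_mul hg).integral_prod_right.congr ?_
  filter_upwards [ae_restrict_mem measurableSet_Ioc] with t ht
  rw [S.surfaceIntegral_eq (Ioc_subset_Icc_self ht)]
  rfl

theorem setIntegral_slab {g : E3 × ℝ → ℝ} (hg : Integrable g S.stMeasure) {I : Set ℝ}
    (hI : I ⊆ Ioc 0 S.T) (hm : MeasurableSet I) :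
    ∫ p in S.slab I, g p ∂S.stMeasure = ∫ t in I, surfaceIntegral (S.Γ t) fun x => g (x, t) := by
  have hint := (S.integrable_jac_mul hg).restrict (s := univ ×ˢ I)
  rw [S.baseMeasure_restrict hI hm] at hint
  rw [S.setIntegral_stMeasure hI hm, integral_prod_symm _ hint]
  refine setIntegral_congr_fun hm fun t ht => ?_
  simp only [S.surfaceIntegral_eq (Ioc_subset_Icc_self (hI ht))]
  rfl

theorem ae_mem_manifold : ∀ᵐ p ∂S.stMeasure, p ∈ S.slab (Ioc 0 S.T) := by
  refine S.ae_stMeasure ?_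
  filter_upwards [S.ae_mem_Ioc] with p hp
  exact (S.stFlow_mem_slab Ioc_subset_Icc_self p).mpr hp

theorem integral_indicator_time (g : E3 × ℝ → ℝ) (τ : ℝ) :
    ∫ p, {p : E3 × ℝ | p.2 ≤ τ}.indicator g p ∂S.stMeasure =
      ∫ p in S.slab (Ioc 0 τ), g p ∂S.stMeasure := by
  rw [integral_indicator (measurableSet_le measurable_snd measurable_const)]
  refine setIntegral_congr_set ?_
  filter_upwards [S.ae_mem_manifold] with p hp
  exact propext ⟨fun h => ⟨⟨hp.1.1, h⟩, hp.2⟩, fun h => h.1.2⟩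

theorem integral_eq_setIntegral_slab (g : E3 × ℝ → ℝ) :
    ∫ p, g p ∂S.stMeasure = ∫ p in S.slab (Ioc 0 S.T), g p ∂S.stMeasure := by
  rw [Measure.restrict_eq_self_of_ae_mem S.ae_mem_manifold]

theorem integrable_of_memLp_top {g : E3 × ℝ → ℝ} (hg : MemLp g ∞ S.stMeasure) : Integrable g S.stMeasure :=
  hg.integrable le_top

theorem continuous_slice {H : S.Γ₀ × ℝ → ℝ} (hH : Continuous H) (t : ℝ) : Continuous fun y => H (y, t) :=
  hH.comp (f := fun y => (y, t)) (continuous_id.prodMk continuous_const)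

theorem integrable_of_continuous {g : S.Γ₀ → ℝ} (hg : Continuous g) : Integrable g S.surfMeasure :=
  hg.integrable_of_hasCompactSupport (HasCompactSupport.of_compactSpace g)

theorem continuous_jac_slice (t : ℝ) : Continuous fun y => S.jac y t := S.continuous_slice S.continuous_jac t

/-- The weighted inner product on the initial surface that corresponds to the `L²` inner product on
the surface at time `t`. -/
def sliceInner (t : ℝ) (a b : S.Γ₀ → ℝ) : ℝ := ∫ y, S.jac y t * (a y * b y) ∂S.surfMeasure

theorem integrable_slice {t : ℝ} {a b : S.Γ₀ → ℝ} (ha : Continuous a) (hb : Continuous b) :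
    Integrable (fun y => S.jac y t * (a y * b y)) S.surfMeasure :=
  S.integrable_of_continuous ((S.continuous_jac_slice t).mul (ha.mul hb))

theorem sliceInner_comm (t : ℝ) (a b : S.Γ₀ → ℝ) : S.sliceInner t a b = S.sliceInner t b a := by
  simp only [sliceInner, mul_comm (a _)]

theorem sliceInner_add_left {t : ℝ} {a b c : S.Γ₀ → ℝ} (ha : Continuous a) (hb : Continuous b)
    (hc : Continuous c) :
    S.sliceInner t (fun y => a y + b y) c = S.sliceInner t a c + S.sliceInner t b c := by
  rw [sliceInner, sliceInner, sliceInner, ← integral_add (S.integrable_slice ha hc) (S.integrable_slice hb hc)]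
  exact integral_congr_ae (Eventually.of_forall fun y => by ring)

theorem sliceInner_mul_left (t r : ℝ) (a c : S.Γ₀ → ℝ) :
    S.sliceInner t (fun y => r * a y) c = r * S.sliceInner t a c := by
  rw [sliceInner, sliceInner, ← integral_const_mul]
  exact integral_congr_ae (Eventually.of_forall fun y => by ring)

/-- The identity `2(a - b)a = a² + (a - b)² - b²`, which splits the jump terms. -/
theorem sliceInner_sub_left {t : ℝ} {a b : S.Γ₀ → ℝ} (ha : Continuous a) (hb : Continuous b) :
    2 * S.sliceInner t (fun y => a y - b y) a =
      S.sliceInner t a a + S.sliceInner t (fun y => a y - b y) (fun y => a y - b y) - S.sliceInner t b b := by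
  have h1 := S.integrable_slice (t := t) ha ha
  have h2 := S.integrable_slice (t := t) (a := fun y => a y - b y) (b := fun y => a y - b y)
    (ha.sub hb) (ha.sub hb)
  have h3 := S.integrable_slice (t := t) hb hb
  simp only [sliceInner]
  rw [← integral_const_mul, ← integral_add h1 h2, ← integral_sub (h1.fun_add h2) h3]
  exact integral_congr_ae (Eventually.of_forall fun y => by simp only; ring)

theorem surfaceIntegral_mul_eq {t : ℝ} (ht : t ∈ Icc 0 S.T) {ψ φ : E3 → ℝ} {a b : S.Γ₀ → ℝ}
    (ha : ∀ y, ψ (S.flow y t) = a y) (hb : ∀ y, φ (S.flow y t) = b y) :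
    surfaceIntegral (S.Γ t) (fun x => ψ x * φ x) = S.sliceInner t a b := by
  rw [S.surfaceIntegral_eq ht, sliceInner]
  simp only [ha, hb]

theorem surfaceArea_eq {t : ℝ} (ht : t ∈ Icc 0 S.T) : surfaceArea (S.Γ t) = ∫ y, S.jac y t ∂S.surfMeasure := by
  have := S.surfaceIntegral_eq ht fun _ => 1
  simpa [surfaceIntegral, surfaceArea] using this

theorem surfaceArea_pos {t : ℝ} (ht : t ∈ Icc 0 S.T) : 0 < surfaceArea (S.Γ t) := by
  rw [S.surfaceArea_eq ht]
  obtain ⟨y⟩ := S.nonempty_Γ₀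
  exact (S.continuous_jac_slice t).integral_pos_of_hasCompactSupport_nonneg_nonzero
    (HasCompactSupport.of_compactSpace _) (fun y => (S.jac_pos y t).le) (S.jac_pos y t).ne'

/-- The Friedrichs inequality makes the diffusion, the divergence term and the stabilization
together coercive on the surface at a fixed time. -/
theorem coercive_slice {t ν c c₀ σ : ℝ} (ht : t ∈ Icc 0 S.T) (hν : 0 < ν)
    (hF : IsFriedrichsConstant (S.Γ t) c) (hdiv : ∀ x ∈ S.Γ t, c₀ ≤ S.divW (x, t) + ν * c)
    (hσ : ν / 2 * (c / surfaceArea (S.Γ t)) ≤ σ) {g : E3 → ℝ} (hg : ∃ K, LipschitzOnWith K g (S.Γ t)) :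
    1 / 2 * (min ν c₀ * (surfaceIntegral (S.Γ t) (fun x => g x * g x) +
      surfaceIntegral (S.Γ t) fun x => ‖tangentGrad (S.Γ t) g x‖ ^ 2)) ≤
    ν * surfaceIntegral (S.Γ t) (fun x => ‖tangentGrad (S.Γ t) g x‖ ^ 2) +
      1 / 2 * surfaceIntegral (S.Γ t) (fun x => S.divW (x, t) * (g x * g x)) +
      σ * (surfaceIntegral (S.Γ t) g * surfaceIntegral (S.Γ t) g) := by
  have hA := S.surfaceArea_pos ht
  have hFg := hF g hg
  obtain ⟨K, hK⟩ := hg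
  set A := surfaceArea (S.Γ t) with hAdef
  set m := surfaceIntegral (S.Γ t) g with hm
  set G := surfaceIntegral (S.Γ t) (fun x => ‖tangentGrad (S.Γ t) g x‖ ^ 2) with hG
  have hG0 : 0 ≤ G := integral_nonneg fun x => by positivity
  have hgc : Continuous fun y : S.Γ₀ => g (S.flow y t) :=
    hK.continuousOn.comp_continuous (S.isClosedEmbedding_flow t).continuous fun y => S.flow_mem_Γ y ht
  have hdc : Continuous fun y : S.Γ₀ => S.divW (S.flow y t, t) := by
    have := S.continuous_slice S.continuous_divFlow t
    simpa only [divFlow, S.clamp_of_mem ht] using this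
  have hJ := S.continuous_jac_slice t
  have i1 : Integrable (fun y => S.jac y t * g (S.flow y t)) S.surfMeasure :=
    S.integrable_of_continuous (hJ.mul hgc)
  have i2 : Integrable (fun y => S.jac y t * (g (S.flow y t) * g (S.flow y t))) S.surfMeasure :=
    S.integrable_of_continuous (hJ.mul (hgc.mul hgc))
  have i3 : Integrable (fun y => S.jac y t * (S.divW (S.flow y t, t) * (g (S.flow y t) * g (S.flow y t))))
      S.surfMeasure := S.integrable_of_continuous (hJ.mul (hdc.mul (hgc.mul hgc)))
  have i4 : Integrable (fun y => S.jac y t) S.surfMeasure := S.integrable_of_continuous hJ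
  have e1 : ∫ y, S.jac y t * g (S.flow y t) ∂S.surfMeasure = m := (S.surfaceIntegral_eq ht _).symm
  set Q := surfaceIntegral (S.Γ t) (fun x => g x * g x) with hQ
  have e2 : ∫ y, S.jac y t * (g (S.flow y t) * g (S.flow y t)) ∂S.surfMeasure = Q :=
    (S.surfaceIntegral_eq ht fun x => g x * g x).symm
  set D := surfaceIntegral (S.Γ t) (fun x => S.divW (x, t) * (g x * g x)) with hD
  have e3 : ∫ y, S.jac y t * (S.divW (S.flow y t, t) * (g (S.flow y t) * g (S.flow y t))) ∂S.surfMeasure = D :=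
    (S.surfaceIntegral_eq ht fun x => S.divW (x, t) * (g x * g x)).symm
  have e4 : ∫ y, S.jac y t ∂S.surfMeasure = A := (S.surfaceArea_eq ht).symm
  -- The variance identity: the mean-square deviation is `∫g²` minus `(∫g)² / |Γ|`.
  have hvar : surfaceIntegral (S.Γ t) (fun x => (g x - 1 / A * m) ^ 2) = Q - m * m / A := by
    rw [S.surfaceIntegral_eq ht]
    have : ∀ y, S.jac y t * (g (S.flow y t) - 1 / A * m) ^ 2 =
        S.jac y t * (g (S.flow y t) * g (S.flow y t)) - 2 * (1 / A * m) * (S.jac y t * g (S.flow y t)) +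
          (1 / A * m) ^ 2 * S.jac y t := fun y => by ring
    simp only [this]
    have i5 : Integrable (fun y => S.jac y t * (g (S.flow y t) * g (S.flow y t)) -
        2 * (1 / A * m) * (S.jac y t * g (S.flow y t))) S.surfMeasure := i2.sub (i1.const_mul _)
    rw [integral_add i5 (i4.const_mul _), integral_sub i2 (i1.const_mul _),
      integral_const_mul, integral_const_mul, e1, e2, e4]
    field_simp
    ring
  have hQ0 : 0 ≤ Q := integral_nonneg fun x => mul_self_nonneg _
  have hlow : c₀ * Q ≤ D + ν * c * Q := by
    rw [← e2, ← e3, ← integral_const_mul, ← integral_const_mul, ← integral_add i3 (i2.const_mul _)]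
    refine integral_mono (i2.const_mul _) (i3.add (i2.const_mul _)) fun y => ?_
    have h1 := hdiv _ (S.flow_mem_Γ y ht)
    have h2 : 0 ≤ S.jac y t * (g (S.flow y t) * g (S.flow y t)) :=
      mul_nonneg (S.jac_pos _ _).le (mul_self_nonneg _)
    have := mul_le_mul_of_nonneg_right h1 h2
    simp only
    linarith
  rw [hvar] at hFg
  have h1 : ν / 2 * (c / A) * (m * m) ≤ σ * (m * m) := mul_le_mul_of_nonneg_right hσ (mul_self_nonneg _)
  -- Half of the diffusion pays for the Friedrichs inequality. The stabilization `h1` compensates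
  -- the mean value, and the other half keeps the gradient term.
  have h2 : ν / 2 * (c * (Q - m * m / A)) ≤ ν / 2 * G := mul_le_mul_of_nonneg_left hFg (by positivity)
  have h3 : ν / 2 * (c / A) * (m * m) = ν / 2 * (c * (m * m / A)) := by ring
  have h4 : min ν c₀ * Q ≤ c₀ * Q := mul_le_mul_of_nonneg_right (min_le_right _ _) hQ0
  have h5 : min ν c₀ * G ≤ ν * G := mul_le_mul_of_nonneg_right (min_le_left _ _) hG0
  linarith

end EvolvingSurface

/-! ### The transport formula on one time slab. -/

namespace EvolvingSurface
variable (S : EvolvingSurface)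

theorem absolutelyContinuous_jac (y : S.Γ₀) (a b : ℝ) : AbsolutelyContinuousOnInterval (S.jac y) a b := by
  have hc : Continuous fun t => S.divFlow y t * S.jac y t :=
    (S.continuous_divFlow.comp (f := fun t => (y, t)) (by fun_prop)).mul
      (S.continuous_jac.comp (f := fun t => (y, t)) (by fun_prop))
  obtain ⟨C, hC⟩ := (isCompact_uIcc (a := a) (b := b)).exists_bound_of_continuousOn hc.continuousOn
  refine LipschitzOnWith.absolutelyContinuousOnInterval (K := Real.toNNReal C)
    ((convex_uIcc a b).lipschitzOnWith_of_nnnorm_hasDerivWithin_le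
    (f' := fun t => S.divFlow y t * S.jac y t) (fun t _ => (S.hasDerivAt_jac y t).hasDerivWithinAt) fun t ht => ?_)
  rw [← NNReal.coe_le_coe]
  exact (hC t ht).trans (Real.le_coe_toNNReal C)

/-- In time the functions are only Lipschitz; the fundamental theorem of calculus holds because
products of absolutely continuous functions are absolutely continuous. -/
theorem IsLipschitzOnCylinder.integral_deriv_jac_mul {S : EvolvingSurface} {F : S.Γ₀ → ℝ → ℝ}
    (hF : S.IsLipschitzOnCylinder F) (y : S.Γ₀) {a b : ℝ} (ha : a ∈ Icc 0 S.T) (hb : b ∈ Icc 0 S.T) :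
    ∫ t in a..b, deriv (fun s => S.jac y s * (F y s * F y s)) t =
      S.jac y b * (F y b * F y b) - S.jac y a * (F y a * F y a) := by
  obtain ⟨C, hC⟩ := hF.time
  have h1 : AbsolutelyContinuousOnInterval (F y) a b :=
    ((hC y).mono (uIcc_subset_Icc ha hb)).absolutelyContinuousOnInterval
  exact ((S.absolutelyContinuous_jac y a b).mul (h1.mul h1)).integral_deriv_eq_sub

end EvolvingSurface

namespace SpaceTimeMesh
variable {S : EvolvingSurface} {M : SpaceTimeMesh S}
variable {u v : E3 × ℝ → ℝ} {H : ℕ → S.Γ₀ → ℝ → ℝ}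

theorem memLp_top_mul {g h : E3 × ℝ → ℝ} (hg : MemLp g ∞ S.stMeasure) (hh : MemLp h ∞ S.stMeasure) :
    MemLp (fun p => g p * h p) ∞ S.stMeasure := hh.mul hg

/-- Along each particle path `d/dt (jac H²) = jac (2 Ḣ H + div_Γ w H²)`. Integrating in time first
and then over `Γ₀` leaves the values at the two ends of the slab. -/
theorem IsLift.energy_slab (hu : M.IsLift u H) {n : ℕ} (hn : n ∈ Finset.Icc 1 M.N) :
    2 * ∫ p in S.slab (M.interval n), S.matDeriv u p * u p ∂S.stMeasure =
      S.sliceInner (M.node n) (fun y => H n y (M.node n)) (fun y => H n y (M.node n)) -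
      S.sliceInner (M.node (n - 1)) (fun y => H n y (M.node (n - 1))) (fun y => H n y (M.node (n - 1))) -
      ∫ p in S.slab (M.interval n), S.divW p * (u p * u p) ∂S.stMeasure := by
  have hI := M.interval_subset hn
  have hL := hu.lipschitz n hn
  have i1 := S.integrable_of_memLp_top (memLp_top_mul hu.memLp_matDeriv hu.memLp)
  have i2 := S.integrable_of_memLp_top (memLp_top_mul S.memLp_divW (memLp_top_mul hu.memLp hu.memLp))
  have i3 := (i1.const_mul 2).fun_add i2
  rw [eq_sub_iff_add_eq, ← integral_const_mul, ← integral_add (i1.const_mul 2).restrict i2.restrict,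
    S.setIntegral_stMeasure hI (M.measurableSet_interval n)]
  have hint := (S.integrable_jac_mul i3).restrict (s := univ ×ˢ M.interval n)
  have hae : ∀ᵐ p ∂S.baseMeasure.restrict (univ ×ˢ M.interval n),
      DifferentiableAt ℝ (H n p.1) p.2 ∧ p.2 ∈ Ioo (M.node (n - 1)) (M.node n) := by
    filter_upwards [hu.ae_differentiableAt_lift hn, M.ae_mem_Ioo] with p h1 h2 using ⟨h1, h2⟩
  rw [S.baseMeasure_restrict hI (M.measurableSet_interval n)] at hint hae
  have hcs : ∀ t, Continuous fun y => H n y t := fun t => S.continuous_slice hL.continuous t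
  rw [integral_prod _ hint, EvolvingSurface.sliceInner, EvolvingSurface.sliceInner,
    ← integral_sub (S.integrable_slice (hcs _) (hcs _)) (S.integrable_slice (hcs _) (hcs _))]
  refine integral_congr_ae ?_
  filter_upwards [Measure.ae_ae_of_ae_prod hae] with y hy
  have hN := (Finset.mem_Icc.mp hn).2
  rw [← hL.integral_deriv_jac_mul y (M.node_mem (n := n - 1) (by omega)) (M.node_mem hN),
    intervalIntegral.integral_of_le (M.node_pred_lt hn).le]
  refine integral_congr_ae ?_
  filter_upwards [hy] with t ht
  have hd := (S.hasDerivAt_jac y t).mul (ht.1.hasDerivAt.mul ht.1.hasDerivAt)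
  have hd' : HasDerivAt (fun s => S.jac y s * (H n y s * H n y s)) _ t := hd
  have htI := Ioo_subset_Ioc_self ht.2
  have e1 := hu.matDeriv_eq hn y ht.2
  have e2 : u (S.stFlow (y, t)) = H n y t := hu.eq n hn t htI y
  have e3 : S.divW (S.stFlow (y, t)) = S.divFlow y t := by
    simp only [EvolvingSurface.divFlow, EvolvingSurface.stFlow, S.clamp_of_mem (M.interval_subset_Icc hn htI)]
  rw [hd'.deriv]
  simp only [e1, e2, e3, Pi.mul_apply]
  ring

end SpaceTimeMesh

/-! ### The forms tested with functions cut off in time. -/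

namespace EvolvingSurface
variable (S : EvolvingSurface)

theorem tangentGrad_zero (Γ : Set E3) (x : E3) : tangentGrad Γ (fun _ => 0) x = 0 := by
  rw [tangentGrad_eq (hasFDerivWithinAt_const 0 x Γ)]
  simp

theorem slab_biUnion {ι : Type*} (s : Finset ι) (I : ι → Set ℝ) :
    S.slab (⋃ i ∈ s, I i) = ⋃ i ∈ s, S.slab (I i) := by
  ext p
  simp only [slab, mem_iUnion, mem_ofPred_eq, exists_prop]
  constructor
  · rintro ⟨⟨i, hi, h⟩, h'⟩
    exact ⟨i, hi, h, h'⟩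
  · rintro ⟨i, hi, h, h'⟩
    exact ⟨⟨i, hi, h⟩, h'⟩

theorem memLp_norm_sq {F : Type*} [NormedAddCommGroup F] {g : E3 × ℝ → F} (hg : MemLp g ∞ S.stMeasure) :
    MemLp (fun p => ‖g p‖ ^ 2) ∞ S.stMeasure := by
  simp only [sq]
  exact hg.norm.mul hg.norm

end EvolvingSurface

namespace SpaceTimeMesh
variable {S : EvolvingSurface} (M : SpaceTimeMesh S)

theorem iUnion_interval_le {k : ℕ} : ⋃ n ∈ Finset.Icc 1 k, M.interval n = Ioc 0 (M.node k) := by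
  induction k with
  | zero => simp
  | succ k ih =>
    rw [← Finset.insert_Icc_right_eq_Icc_add_one (by omega), Finset.set_biUnion_insert, ih, interval, union_comm,
      Nat.add_sub_cancel]
    exact Ioc_union_Ioc_eq_Ioc (M.node_nonneg k) (M.node_strictMono k.lt_succ_self).le

theorem integral_slab_eq_sum {g : E3 × ℝ → ℝ} (hg : Integrable g S.stMeasure) {k : ℕ} (hk : k ≤ M.N) :
    ∫ p in S.slab (Ioc 0 (M.node k)), g p ∂S.stMeasure =
      ∑ n ∈ Finset.Icc 1 k, ∫ p in S.slab (M.interval n), g p ∂S.stMeasure := by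
  have hsub : ∀ n ∈ Finset.Icc 1 k, n ∈ Finset.Icc 1 M.N := fun n hn => by
    simp only [Finset.mem_Icc] at *; omega
  rw [← M.iUnion_interval_le, S.slab_biUnion, integral_biUnion_finset]
  · exact fun n hn => S.measurableSet_slab (M.interval_subset_Icc (hsub n hn)) (M.measurableSet_interval n)
  · intro m hm n hn hmn
    exact disjoint_left.mpr fun p hp hp' =>
      disjoint_left.mp (M.interval_pairwiseDisjoint (hsub m hm) (hsub n hn) hmn) hp.1 hp'.1
  · exact fun n _ => hg.integrableOn

variable {M}
variable {u v : E3 × ℝ → ℝ} {H G : ℕ → S.Γ₀ → ℝ → ℝ}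

theorem IsLift.formDot_eq (hu : M.IsLift u H) (hv : M.IsLift v G) :
    M.formDot u v = ∫ p, S.matDeriv u p * v p ∂S.stMeasure := by
  rw [S.integral_eq_setIntegral_slab, ← M.node_N,
    M.integral_slab_eq_sum (S.integrable_of_memLp_top (memLp_top_mul hu.memLp_matDeriv hv.memLp)) le_rfl,
    formDot]

theorem IsLift.formDot_truncate (hu : M.IsLift u H) {k : ℕ} (hk : k ≤ M.N) :
    M.formDot u (M.truncate k u) =
      ∑ n ∈ Finset.Icc 1 k, ∫ p in S.slab (M.interval n), S.matDeriv u p * u p ∂S.stMeasure := by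
  rw [hu.formDot_eq (hu.truncate k), ← M.integral_slab_eq_sum
    (S.integrable_of_memLp_top (memLp_top_mul hu.memLp_matDeriv hu.memLp)) hk, ← S.integral_indicator_time]
  refine integral_congr_ae (Eventually.of_forall fun p => ?_)
  simp only [SpaceTimeMesh.truncate, indicator_apply]
  split_ifs <;> simp

variable (M) in
-- The cut-off is constant on each time slice, so it commutes with tangential differentiation.
theorem grad_truncate (k : ℕ) (u : E3 × ℝ → ℝ) (p : E3 × ℝ) :
    S.grad (M.truncate k u) p = {p : E3 × ℝ | p.2 ≤ M.node k}.indicator (S.grad u) p := by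
  by_cases h : p.2 ≤ M.node k
  · rw [indicator_of_mem (by exact h), EvolvingSurface.grad, EvolvingSurface.grad]
    congr 1
    funext x
    exact indicator_of_mem (by exact h) u
  · rw [indicator_of_notMem (by exact h), EvolvingSurface.grad]
    convert! EvolvingSurface.tangentGrad_zero (S.Γ p.2) p.1 using 2
    funext x
    exact indicator_of_notMem (by exact h) u

variable (M) in
theorem gradInner_truncate (k : ℕ) (u : E3 × ℝ → ℝ) : S.gradInner u (M.truncate k u) =
    ∫ p in S.slab (Ioc 0 (M.node k)), ‖S.grad u p‖ ^ 2 ∂S.stMeasure := by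
  rw [← S.integral_indicator_time, EvolvingSurface.gradInner]
  refine integral_congr_ae (Eventually.of_forall fun p => ?_)
  simp only [M.grad_truncate, indicator_apply]
  split_ifs <;> simp

variable (M) in
theorem inner0_divW_truncate (k : ℕ) (u : E3 × ℝ → ℝ) :
    S.inner0 (fun p => S.divW p * u p) (M.truncate k u) =
    ∫ p in S.slab (Ioc 0 (M.node k)), S.divW p * (u p * u p) ∂S.stMeasure := by
  rw [← S.integral_indicator_time, EvolvingSurface.inner0]
  refine integral_congr_ae (Eventually.of_forall fun p => ?_)
  simp only [SpaceTimeMesh.truncate, indicator_apply]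
  split_ifs <;> simp [mul_assoc]

variable (M) in
theorem bar_truncate (k : ℕ) (u : E3 × ℝ → ℝ) (t : ℝ) :
    S.bar (M.truncate k u) t = (Iic (M.node k)).indicator (S.bar u) t := by
  by_cases h : t ≤ M.node k
  · rw [indicator_of_mem (by exact h), EvolvingSurface.bar, EvolvingSurface.bar]
    congr 1
    funext x
    exact indicator_of_mem (by exact h) u
  · rw [indicator_of_notMem (by exact h), EvolvingSurface.bar, surfaceIntegral]
    convert! integral_zero E3 ℝ using 3
    exact indicator_of_notMem (by exact h) u

variable (M) in
theorem integral_bar_truncate {k : ℕ} (hk : k ≤ M.N) (u : E3 × ℝ → ℝ) :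
    ∫ t in (0 : ℝ)..S.T, S.bar u t * S.bar (M.truncate k u) t =
      ∫ t in Ioc 0 (M.node k), S.bar u t * S.bar u t := by
  rw [intervalIntegral.integral_of_le S.T_pos.le]
  have h : Ioc 0 (M.node k) = Ioc 0 S.T ∩ Iic (M.node k) := by
    rw [Ioc_inter_Iic, min_eq_right (M.node_le hk)]
  rw [h, ← setIntegral_indicator measurableSet_Iic]
  refine integral_congr_ae (Eventually.of_forall fun t => ?_)
  simp only [M.bar_truncate, indicator_apply]
  split_ifs <;> simp

theorem IsLift.exists_bound (hu : M.IsLift u H) :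
    ∃ C : ℝ, ∀ t ∈ Ioc 0 S.T, ∀ y, |u (S.flow y t, t)| ≤ C := by
  have h : ∀ n ∈ Finset.Icc 1 M.N, ∃ C : ℝ, ∀ t ∈ Icc 0 S.T, ∀ y, |H n y t| ≤ C := fun n hn => by
    obtain ⟨C, -, hC⟩ := (hu.lipschitz n hn).exists_bound
    exact ⟨C, fun t ht y => hC y t ht⟩
  choose! C hC using h
  obtain ⟨B, hB⟩ := ((Finset.Icc 1 M.N).finite_toSet.image C).bddAbove
  refine ⟨B, fun t ht y => ?_⟩
  obtain ⟨n, hn, h⟩ := M.exists_mem_interval ht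
  rw [hu.eq n hn t h y]
  exact (hC n hn t (Ioc_subset_Icc_self ht) y).trans (hB ⟨n, hn, rfl⟩)

theorem IsLift.memLp_bar (hu : M.IsLift u H) : MemLp (S.bar u) ∞ (volume.restrict (Ioc 0 S.T)) := by
  obtain ⟨C, hC⟩ := hu.exists_bound
  obtain ⟨B, hB⟩ := (isCompact_univ.prod (isCompact_Icc (a := (0 : ℝ)) (b := S.T))).exists_bound_of_continuousOn
    (S.continuous_jac.continuousOn (s := (univ : Set S.Γ₀) ×ˢ Icc 0 S.T))
  refine memLp_top_of_bound (S.integrableOn_surfaceIntegral (S.integrable_of_memLp_top hu.memLp)).1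
    (B * C * S.surfMeasure.real univ) ?_
  filter_upwards [ae_restrict_mem measurableSet_Ioc] with t ht
  rw [EvolvingSurface.bar, S.surfaceIntegral_eq (Ioc_subset_Icc_self ht)]
  refine norm_integral_le_of_norm_le_const (Eventually.of_forall fun y => ?_)
  rw [norm_mul]
  have h1 := hB (y, t) ⟨mem_univ _, Ioc_subset_Icc_self ht⟩
  exact mul_le_mul h1 (hC t ht y) (abs_nonneg _) ((norm_nonneg _).trans h1)

/-- The integrated form of `coercive_slice`. -/
theorem IsLift.coercive (hu : M.IsLift u H) {τ ν c₀ σ : ℝ} {cF : ℝ → ℝ} (hτ : τ ≤ S.T) (hν : 0 < ν)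
    (hcF : ∀ t ∈ Icc 0 S.T, 0 < cF t ∧ IsFriedrichsConstant (S.Γ t) (cF t))
    (hdiv : ∀ t ∈ Icc 0 S.T, ∀ x ∈ S.Γ t, c₀ ≤ S.divW (x, t) + ν * cF t)
    (hσ : ∀ t ∈ Icc 0 S.T, ν / 2 * (cF t / surfaceArea (S.Γ t)) ≤ σ)
    (hlip : ∀ t ∈ Ioc 0 S.T, ∃ K, LipschitzOnWith K (fun x => u (x, t)) (S.Γ t)) :
    1 / 2 * (min ν c₀ * (∫ p in S.slab (Ioc 0 τ), u p * u p ∂S.stMeasure +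
      ∫ p in S.slab (Ioc 0 τ), ‖S.grad u p‖ ^ 2 ∂S.stMeasure)) ≤
    ν * ∫ p in S.slab (Ioc 0 τ), ‖S.grad u p‖ ^ 2 ∂S.stMeasure +
      1 / 2 * ∫ p in S.slab (Ioc 0 τ), S.divW p * (u p * u p) ∂S.stMeasure +
      σ * ∫ t in Ioc 0 τ, S.bar u t * S.bar u t := by
  have hI : Ioc 0 τ ⊆ Ioc 0 S.T := Ioc_subset_Ioc_right hτ
  have i1 := S.integrable_of_memLp_top (memLp_top_mul hu.memLp hu.memLp)
  have i2 := S.integrable_of_memLp_top (S.memLp_norm_sq hu.memLp_grad)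
  have i3 := S.integrable_of_memLp_top (memLp_top_mul S.memLp_divW (memLp_top_mul hu.memLp hu.memLp))
  have j1 := (S.integrableOn_surfaceIntegral i1).mono_set hI
  have j2 := (S.integrableOn_surfaceIntegral i2).mono_set hI
  have j3 := (S.integrableOn_surfaceIntegral i3).mono_set hI
  have j4 : IntegrableOn (fun t => S.bar u t * S.bar u t) (Ioc 0 τ) :=
    IntegrableOn.mono_set (t := Ioc 0 S.T) ((hu.memLp_bar.mul hu.memLp_bar (r := ∞)).integrable le_top) hI
  rw [S.setIntegral_slab i1 hI measurableSet_Ioc, S.setIntegral_slab i2 hI measurableSet_Ioc,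
    S.setIntegral_slab i3 hI measurableSet_Ioc, ← integral_add j1 j2, ← integral_const_mul,
    ← integral_const_mul, ← integral_const_mul, ← integral_const_mul, ← integral_const_mul,
    ← integral_add (j2.const_mul ν) (j3.const_mul (1 / 2)),
    ← integral_add ((j2.const_mul ν).fun_add (j3.const_mul (1 / 2))) (j4.const_mul σ)]
  refine setIntegral_mono_on (((j1.fun_add j2).const_mul _).const_mul _)
    (((j2.const_mul ν).fun_add (j3.const_mul (1 / 2))).fun_add (j4.const_mul σ)) measurableSet_Ioc fun t ht => ?_
  have ht' := Ioc_subset_Icc_self (hI ht)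
  exact S.coercive_slice ht' hν (hcF t ht').2 (hdiv t ht') (hσ t ht') (hlip t (hI ht))

end SpaceTimeMesh

/-! ### Jump terms and the energy inequality. -/

namespace SpaceTimeMesh
variable {S : EvolvingSurface} {M : SpaceTimeMesh S}
variable {u v : E3 × ℝ → ℝ} {H G : ℕ → S.Γ₀ → ℝ → ℝ}

variable (M) in
/-- The values at the beginning of the `n`-th time slab, in particle coordinates. -/
def startValue (H : ℕ → S.Γ₀ → ℝ → ℝ) (n : ℕ) (y : S.Γ₀) : ℝ := H n y (M.node (n - 1))

variable (M) in
/-- The values at the end of the `n`-th time slab, in particle coordinates; zero for `n = 0`. -/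
def endValue (H : ℕ → S.Γ₀ → ℝ → ℝ) (n : ℕ) (y : S.Γ₀) : ℝ := if n = 0 then 0 else H n y (M.node n)

theorem IsLift.continuous_startValue (hu : M.IsLift u H) {n : ℕ} (hn : n ∈ Finset.Icc 1 M.N) :
    Continuous (M.startValue H n) := S.continuous_slice (hu.lipschitz n hn).continuous _

theorem IsLift.continuous_endValue (hu : M.IsLift u H) {n : ℕ} (hn : n ≤ M.N) :
    Continuous (M.endValue H n) := by
  unfold endValue
  split_ifs with h
  · exact continuous_const
  · exact S.continuous_slice (hu.lipschitz n (Finset.mem_Icc.mpr ⟨Nat.one_le_iff_ne_zero.mpr h, hn⟩)).continuous _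

/-- The value zero of `endValue` at index 0 makes one formula cover both interior jumps and the
convention at time zero. -/
theorem IsLift.jump_eq (hu : M.IsLift u H) {n : ℕ} (hn : n ∈ Finset.Icc 1 M.N) (y : S.Γ₀) :
    M.jump u (n - 1) (S.flow y (M.node (n - 1))) = M.startValue H n y - M.endValue H (n - 1) y := by
  have h1 := hu.traceRight hn y
  unfold jump endValue startValue
  split_ifs with h
  · rw [← h, h1, sub_zero]
  · have h' := Finset.mem_Icc.mp hn
    rw [h1, hu.traceLeft (Finset.mem_Icc.mpr ⟨by omega, by omega⟩)]

theorem IsLift.innerNode_jump (hu : M.IsLift u H) (hv : M.IsLift v G) {n : ℕ} (hn : n ∈ Finset.Icc 1 M.N) :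
    M.innerNode (n - 1) (M.jump u (n - 1)) (M.jump v (n - 1)) =
      S.sliceInner (M.node (n - 1)) (fun y => M.startValue H n y - M.endValue H (n - 1) y)
        (fun y => M.startValue G n y - M.endValue G (n - 1) y) :=
  have h := Finset.mem_Icc.mp hn
  S.surfaceIntegral_mul_eq (M.node_mem (by omega)) (hu.jump_eq hn) (hv.jump_eq hn)

theorem IsLift.innerNode_traceRight (hu : M.IsLift u H) (hv : M.IsLift v G) {n : ℕ} (hn : n ∈ Finset.Icc 1 M.N) :
    M.innerNode (n - 1) (M.jump u (n - 1)) (M.traceRight v (n - 1)) =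
      S.sliceInner (M.node (n - 1)) (fun y => M.startValue H n y - M.endValue H (n - 1) y)
        (M.startValue G n) :=
  have h := Finset.mem_Icc.mp hn
  S.surfaceIntegral_mul_eq (M.node_mem (by omega)) (hu.jump_eq hn) (hv.traceRight hn)

theorem IsLift.innerNode_traceLeft (hu : M.IsLift u H) {n : ℕ} (hn : n ∈ Finset.Icc 1 M.N) :
    M.innerNode n (M.traceLeft u n) (M.traceLeft u n) =
      S.sliceInner (M.node n) (M.endValue H n) (M.endValue H n) := by
  have h := Finset.mem_Icc.mp hn
  have h0 : n ≠ 0 := by omega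
  have hy : ∀ y, M.traceLeft u n (S.flow y (M.node n)) = M.endValue H n y := fun y => by
    rw [endValue, if_neg h0, hu.traceLeft hn]
  exact S.surfaceIntegral_mul_eq (M.node_mem h.2) hy hy

theorem IsLift.formD_eq (hu : M.IsLift u H) (hv : M.IsLift v G) :
    M.formD u v = ∑ n ∈ Finset.Icc 1 M.N, S.sliceInner (M.node (n - 1))
      (fun y => M.startValue H n y - M.endValue H (n - 1) y) (M.startValue G n) :=
  Finset.sum_congr rfl fun _ hn => hu.innerNode_traceRight hv hn

theorem IsLift.continuous_jump (hu : M.IsLift u H) {n : ℕ} (hn : n ∈ Finset.Icc 1 M.N) :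
    Continuous fun y => M.startValue H n y - M.endValue H (n - 1) y :=
  have h := Finset.mem_Icc.mp hn
  (hu.continuous_startValue hn).sub (hu.continuous_endValue (by omega))

section bilinear

variable {u' v' : E3 × ℝ → ℝ} {H' G' : ℕ → S.Γ₀ → ℝ → ℝ}

theorem IsLift.formD_add_left (hu : M.IsLift u H) (hu' : M.IsLift u' H') (hv : M.IsLift v G) :
    M.formD (u + u') v = M.formD u v + M.formD u' v := by
  rw [(hu.add hu').formD_eq hv, hu.formD_eq hv, hu'.formD_eq hv, ← Finset.sum_add_distrib]
  refine Finset.sum_congr rfl fun n hn => ?_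
  rw [← S.sliceInner_add_left (hu.continuous_jump hn) (hu'.continuous_jump hn) (hv.continuous_startValue hn)]
  congr 1
  funext y
  simp only [startValue, endValue]
  split_ifs <;> ring

theorem IsLift.formD_smul_left (hu : M.IsLift u H) (hv : M.IsLift v G) (c : ℝ) :
    M.formD (c • u) v = c * M.formD u v := by
  rw [(hu.smul c).formD_eq hv, hu.formD_eq hv, Finset.mul_sum]
  refine Finset.sum_congr rfl fun n hn => ?_
  rw [← S.sliceInner_mul_left]
  congr 1
  funext y
  simp only [startValue, endValue]
  split_ifs <;> ring

theorem IsLift.formD_add_right (hu : M.IsLift u H) (hv : M.IsLift v G) (hv' : M.IsLift v' G') :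
    M.formD u (v + v') = M.formD u v + M.formD u v' := by
  rw [hu.formD_eq (hv.add hv'), hu.formD_eq hv, hu.formD_eq hv', ← Finset.sum_add_distrib]
  refine Finset.sum_congr rfl fun n hn => ?_
  simp only [S.sliceInner_comm _ (fun y => M.startValue H n y - M.endValue H (n - 1) y)]
  exact S.sliceInner_add_left (hv.continuous_startValue hn) (hv'.continuous_startValue hn) (hu.continuous_jump hn)

theorem IsLift.formD_smul_right (hu : M.IsLift u H) (hv : M.IsLift v G) (c : ℝ) :
    M.formD u (c • v) = c * M.formD u v := by
  rw [hu.formD_eq (hv.smul c), hu.formD_eq hv, Finset.mul_sum]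
  refine Finset.sum_congr rfl fun n hn => ?_
  simp only [S.sliceInner_comm _ (fun y => M.startValue H n y - M.endValue H (n - 1) y)]
  exact S.sliceInner_mul_left _ _ _ _

end bilinear

theorem sum_telescope (a : ℕ → ℝ) (k : ℕ) : ∑ n ∈ Finset.Icc 1 k, (a n - a (n - 1)) = a k - a 0 := by
  induction k with
  | zero => simp
  | succ k ih => rw [Finset.sum_Icc_succ_top (by omega), ih]; simp

/-- The energy inequality up to time `t_k`: the forms are tested with the restriction of `u` to the
first `k` time slabs. -/
theorem IsLift.energy (hu : M.IsLift u H) {ν c₀ σ : ℝ} {cF : ℝ → ℝ} (hν : 0 < ν)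
    (hcF : ∀ t ∈ Icc 0 S.T, 0 < cF t ∧ IsFriedrichsConstant (S.Γ t) (cF t))
    (hdiv : ∀ t ∈ Icc 0 S.T, ∀ x ∈ S.Γ t, c₀ ≤ S.divW (x, t) + ν * cF t)
    (hσ : ∀ t ∈ Icc 0 S.T, ν / 2 * (cF t / surfaceArea (S.Γ t)) ≤ σ)
    (hlip : ∀ t ∈ Ioc 0 S.T, ∃ K, LipschitzOnWith K (fun x => u (x, t)) (S.Γ t))
    {k : ℕ} (hk : k ∈ Finset.Icc 1 M.N) :
    1 / 2 * M.innerNode k (M.traceLeft u k) (M.traceLeft u k) +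
      1 / 2 * ∑ n ∈ Finset.Icc 1 k, M.innerNode (n - 1) (M.jump u (n - 1)) (M.jump u (n - 1)) +
      1 / 2 * (min ν c₀ * (∫ p in S.slab (Ioc 0 (M.node k)), u p * u p ∂S.stMeasure +
        ∫ p in S.slab (Ioc 0 (M.node k)), ‖S.grad u p‖ ^ 2 ∂S.stMeasure)) ≤
    M.formDot u (M.truncate k u) + S.formASigma ν σ u (M.truncate k u) + M.formD u (M.truncate k u) := by
  have hk' := Finset.mem_Icc.mp hk
  have hsub : ∀ n ∈ Finset.Icc 1 k, n ∈ Finset.Icc 1 M.N := fun n hn => by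
    simp only [Finset.mem_Icc] at *; omega
  have hco := hu.coercive (M.node_le hk'.2) hν hcF hdiv hσ hlip
  have i3 := S.integrable_of_memLp_top (memLp_top_mul S.memLp_divW (memLp_top_mul hu.memLp hu.memLp))
  -- `e n` is the squared norm at the end of slab `n` and `b n` that at its start. The `b n` cancel
  -- between `h1` and `h2`, and the `e n` telescope.
  set e : ℕ → ℝ := fun n => S.sliceInner (M.node n) (M.endValue H n) (M.endValue H n) with he
  set b : ℕ → ℝ := fun n => S.sliceInner (M.node (n - 1)) (M.startValue H n) (M.startValue H n) with hb
  have h1 : 2 * M.formDot u (M.truncate k u) = ∑ n ∈ Finset.Icc 1 k, (e n - b n) -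
      ∫ p in S.slab (Ioc 0 (M.node k)), S.divW p * (u p * u p) ∂S.stMeasure := by
    rw [hu.formDot_truncate hk'.2, M.integral_slab_eq_sum i3 hk'.2, Finset.mul_sum, ← Finset.sum_sub_distrib]
    refine Finset.sum_congr rfl fun n hn => ?_
    have h0 : n ≠ 0 := by have := Finset.mem_Icc.mp hn; omega
    have hend : M.endValue H n = fun y => H n y (M.node n) := by
      funext y
      rw [endValue, if_neg h0]
    simp only [he, hb, hend]
    exact hu.energy_slab (hsub n hn)
  have h2 : 2 * M.formD u (M.truncate k u) = ∑ n ∈ Finset.Icc 1 k,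
      (b n + M.innerNode (n - 1) (M.jump u (n - 1)) (M.jump u (n - 1)) - e (n - 1)) := by
    rw [hu.formD_eq (hu.truncate k), ← Finset.sum_subset (Finset.Icc_subset_Icc_right hk'.2), Finset.mul_sum]
    · refine Finset.sum_congr rfl fun n hn => ?_
      have hst : M.startValue (fun n y t => if n ≤ k then H n y t else 0) n = M.startValue H n := by
        funext y
        simp only [startValue, if_pos (Finset.mem_Icc.mp hn).2]
      rw [hst, hu.innerNode_jump hu (hsub n hn)]
      exact S.sliceInner_sub_left (hu.continuous_startValue (hsub n hn))
        (hu.continuous_endValue (by have := Finset.mem_Icc.mp (hsub n hn); omega))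
    -- Later slabs contribute nothing, including the jump of `u` at `t_k`: only the right trace of
    -- the test function enters, and it vanishes from there on.
    · intro n hn hnk
      have hst : M.startValue (fun n y t => if n ≤ k then H n y t else 0) n = fun _ => 0 := by
        funext y
        have : ¬ n ≤ k := by simp only [Finset.mem_Icc] at *; omega
        simp only [startValue, if_neg this]
      rw [hst]
      simp [EvolvingSurface.sliceInner]
  have h3 : S.formASigma ν σ u (M.truncate k u) =
      ν * ∫ p in S.slab (Ioc 0 (M.node k)), ‖S.grad u p‖ ^ 2 ∂S.stMeasure +
      ∫ p in S.slab (Ioc 0 (M.node k)), S.divW p * (u p * u p) ∂S.stMeasure +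
      σ * ∫ t in Ioc 0 (M.node k), S.bar u t * S.bar u t := by
    rw [EvolvingSurface.formASigma, EvolvingSurface.formA, M.gradInner_truncate, M.inner0_divW_truncate,
      M.integral_bar_truncate hk'.2]
  have h4 := sum_telescope e k
  have he0 : e 0 = 0 := by
    simp [he, EvolvingSurface.sliceInner, endValue]
  have h5 : M.innerNode k (M.traceLeft u k) (M.traceLeft u k) = e k := hu.innerNode_traceLeft hk
  rw [Finset.sum_sub_distrib] at h1 h4
  rw [Finset.sum_sub_distrib, Finset.sum_add_distrib] at h2
  rw [h3, h5]
  linarith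

end SpaceTimeMesh

/-! ### The discrete problem as a linear system: bilinearity, stability and injectivity. -/

/-- The linear map into `L²` that is induced by a map which is linear almost everywhere. -/
def linearMapToL2 {V X F : Type*} [AddCommGroup V] [Module ℝ V] [MeasurableSpace X] [NormedAddCommGroup F]
    [NormedSpace ℝ F] {μ : Measure X} (A : V → X → F) (hA : ∀ u, MemLp (A u) 2 μ)
    (hadd : ∀ u v, A (u + v) =ᵐ[μ] A u + A v) (hsmul : ∀ (c : ℝ) u, A (c • u) =ᵐ[μ] c • A u) :
    V →ₗ[ℝ] Lp F 2 μ where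
  toFun u := (hA u).toLp (A u)
  map_add' u v := by
    rw [← MemLp.toLp_add]
    exact MemLp.toLp_congr _ _ (hadd u v)
  map_smul' c u := by
    rw [RingHom.id_apply, ← MemLp.toLp_const_smul]
    exact MemLp.toLp_congr _ _ (hsmul c u)

theorem inner_toLp {X F : Type*} [MeasurableSpace X] [NormedAddCommGroup F] [InnerProductSpace ℝ F]
    {μ : Measure X} {f g : X → F} (hf : MemLp f 2 μ) (hg : MemLp g 2 μ) :
    inner ℝ (hf.toLp f) (hg.toLp g) = ∫ x, inner ℝ (f x) (g x) ∂μ := by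
  rw [L2.inner_def]
  refine integral_congr_ae ?_
  filter_upwards [hf.coeFn_toLp, hg.coeFn_toLp] with x h1 h2
  rw [h1, h2]

theorem inner_toLp_real {X : Type*} [MeasurableSpace X] {μ : Measure X} {f g : X → ℝ} (hf : MemLp f 2 μ)
    (hg : MemLp g 2 μ) : inner ℝ (hf.toLp f) (hg.toLp g) = ∫ x, f x * g x ∂μ := by
  rw [inner_toLp]
  exact integral_congr_ae (Eventually.of_forall fun x => by simp [mul_comm])

namespace EvolvingSurface
variable (S : EvolvingSurface)

theorem inner0_self_nonneg (u : E3 × ℝ → ℝ) : 0 ≤ S.inner0 u u := integral_nonneg fun _ => mul_self_nonneg _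

theorem gradInner_self_nonneg (u : E3 × ℝ → ℝ) : 0 ≤ S.gradInner u u :=
  integral_nonneg fun _ => real_inner_self_nonneg

theorem norm_toLp_eq_norm0 {f : E3 × ℝ → ℝ} (hf : MemLp f 2 S.stMeasure) : ‖hf.toLp f‖ = S.norm0 f := by
  rw [norm0, inner0, ← inner_toLp_real hf hf, real_inner_self_eq_norm_sq, Real.sqrt_sq (norm_nonneg _)]

theorem inner0_le {f g : E3 × ℝ → ℝ} (hf : MemLp f 2 S.stMeasure) (hg : MemLp g 2 S.stMeasure) :
    S.inner0 f g ≤ S.norm0 f * S.norm0 g := by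
  rw [inner0, ← inner_toLp_real hf hg, ← S.norm_toLp_eq_norm0 hf, ← S.norm_toLp_eq_norm0 hg]
  exact real_inner_le_norm _ _

end EvolvingSurface

namespace SpaceTimeMesh
variable {S : EvolvingSurface} {M : SpaceTimeMesh S}
variable {u v : E3 × ℝ → ℝ} {H G : ℕ → S.Γ₀ → ℝ → ℝ}

/-- This places each time slice in the class for which the Friedrichs inequality is assumed. -/
theorem exists_lipschitzOnWith_slice (hu : u ∈ M.surfaceSpace) {t : ℝ} (ht : t ∈ Ioc 0 S.T) :
    ∃ K, LipschitzOnWith K (fun x => u (x, t)) (S.Γ t) := by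
  obtain ⟨n, hn, htn⟩ := M.exists_mem_interval ht
  obtain ⟨φ₀, h₀, φ₁, h₁, h⟩ := ((M.mem_surfaceSpace_iff).mp hu).2 n hn
  have hK := M.isTriangulation n hn
  obtain ⟨C, hC⟩ := ((piecewiseAffine_locallyLipschitzOn S.isOpen_Ω hK h₀).mono
    S.swept_subset).exists_lipschitzOnWith_of_compact S.isCompact_swept
  obtain ⟨D, hD⟩ := ((piecewiseAffine_locallyLipschitzOn S.isOpen_Ω hK (piecewiseAffine_const_mul h₁ t)).mono
    S.swept_subset).exists_lipschitzOnWith_of_compact S.isCompact_swept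
  rw [← S.range_flow (Ioc_subset_Icc_self ht)]
  have hsub : range (fun y => S.flow y t) ⊆ S.swept := by
    rintro _ ⟨y, rfl⟩
    exact S.flow_mem_swept y t
  have hL := (hC.add hD).mono hsub
  refine ⟨C + D, ?_⟩
  rintro _ ⟨y, rfl⟩ _ ⟨z, rfl⟩
  simp only [h t htn]
  exact hL ⟨y, rfl⟩ ⟨z, rfl⟩

theorem IsLift.continuous_slice (hu : M.IsLift u H) {t : ℝ} (ht : t ∈ Ioc 0 S.T) :
    Continuous fun y : S.Γ₀ => u (S.flow y t, t) := by
  obtain ⟨n, hn, htn⟩ := M.exists_mem_interval ht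
  simp only [hu.eq n hn t htn]
  exact S.continuous_slice (hu.lipschitz n hn).continuous t

theorem IsLift.bar_add (hu : M.IsLift u H) (hv : M.IsLift v G) {t : ℝ} (ht : t ∈ Ioc 0 S.T) :
    S.bar (u + v) t = S.bar u t + S.bar v t := by
  have hJ := S.continuous_jac_slice t
  simp only [EvolvingSurface.bar, S.surfaceIntegral_eq (Ioc_subset_Icc_self ht)]
  have i1 : Integrable (fun y => S.jac y t * u (S.flow y t, t)) S.surfMeasure :=
    S.integrable_of_continuous (hJ.mul (hu.continuous_slice ht))
  have i2 : Integrable (fun y => S.jac y t * v (S.flow y t, t)) S.surfMeasure :=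
    S.integrable_of_continuous (hJ.mul (hv.continuous_slice ht))
  rw [← integral_add i1 i2]
  simp only [Pi.add_apply, mul_add]

theorem bar_smul (u : E3 × ℝ → ℝ) (c t : ℝ) : S.bar (c • u) t = c * S.bar u t := by
  simp only [EvolvingSurface.bar, surfaceIntegral, Pi.smul_apply, smul_eq_mul, integral_const_mul]

variable (M)

theorem exists_lift (u : M.surfaceSubmodule) : ∃ H, M.IsLift (u : E3 × ℝ → ℝ) H := M.exists_isLift u.2

theorem memLp_two (u : M.surfaceSubmodule) : MemLp (u : E3 × ℝ → ℝ) 2 S.stMeasure :=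
  (M.exists_lift u).choose_spec.memLp.mono_exponent le_top

/-- The inclusion of the surface finite element space into `L²`. -/
def valueL2 : M.surfaceSubmodule →ₗ[ℝ] Lp ℝ 2 S.stMeasure :=
  linearMapToL2 (fun u => u.1) M.memLp_two (fun _ _ => ae_eq_rfl) (fun _ _ => ae_eq_rfl)

theorem memLp_two_matDeriv (u : M.surfaceSubmodule) : MemLp (S.matDeriv u) 2 S.stMeasure :=
  (M.exists_lift u).choose_spec.memLp_matDeriv.mono_exponent le_top

/-- The material derivative, as a linear map into `L²`. -/
def matDerivL2 : M.surfaceSubmodule →ₗ[ℝ] Lp ℝ 2 S.stMeasure :=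
  linearMapToL2 (fun u => S.matDeriv u.1) M.memLp_two_matDeriv
    (fun u v => (M.exists_lift u).choose_spec.matDeriv_add (M.exists_lift v).choose_spec)
    (fun c u => (M.exists_lift u).choose_spec.matDeriv_smul c)

theorem memLp_two_grad (u : M.surfaceSubmodule) : MemLp (S.grad u) 2 S.stMeasure :=
  (M.exists_lift u).choose_spec.memLp_grad.mono_exponent le_top

/-- The tangential gradient, as a linear map into `L²`. -/
def gradL2 : M.surfaceSubmodule →ₗ[ℝ] Lp E3 2 S.stMeasure :=
  linearMapToL2 (fun u => S.grad u.1) M.memLp_two_grad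
    (fun u v => (M.exists_lift u).choose_spec.grad_add (M.exists_lift v).choose_spec)
    (fun c u => (M.exists_lift u).choose_spec.grad_smul c)

theorem memLp_two_divW_mul (u : M.surfaceSubmodule) : MemLp (fun p => S.divW p * u.1 p) 2 S.stMeasure :=
  (memLp_top_mul S.memLp_divW (M.exists_lift u).choose_spec.memLp).mono_exponent le_top

/-- The multiplication with the surface divergence of the velocity, as a linear map into `L²`. -/
def divMulL2 : M.surfaceSubmodule →ₗ[ℝ] Lp ℝ 2 S.stMeasure :=
  linearMapToL2 (fun u p => S.divW p * u.1 p) M.memLp_two_divW_mul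
    (fun u v => Eventually.of_forall fun p => by simp [mul_add])
    (fun c u => Eventually.of_forall fun p => by simp [mul_left_comm])

theorem memLp_two_bar (u : M.surfaceSubmodule) : MemLp (S.bar u) 2 (volume.restrict (Ioc 0 S.T)) :=
  (M.exists_lift u).choose_spec.memLp_bar.mono_exponent le_top

/-- The surface integrals `ū(t)`, as a linear map into `L²(0, T)`. -/
def barL2 : M.surfaceSubmodule →ₗ[ℝ] Lp ℝ 2 (volume.restrict (Ioc 0 S.T)) :=
  linearMapToL2 (fun u => S.bar u.1) M.memLp_two_bar
    (fun u v => by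
      filter_upwards [ae_restrict_mem measurableSet_Ioc] with t ht
      exact (M.exists_lift u).choose_spec.bar_add (M.exists_lift v).choose_spec ht)
    (fun c u => Eventually.of_forall fun t => bar_smul u.1 c t)

/-- Gradient and material derivative are additive only almost everywhere, so bilinearity is read off
from linear maps into `L²`. The traces in `formD` live on null sets of space-time and are kept
apart. -/
theorem form_eq_inner (ν σ : ℝ) (u v : M.surfaceSubmodule) :
    M.formDot u v + S.formASigma ν σ u v + M.formD u v =
      inner ℝ (M.matDerivL2 u) (M.valueL2 v) + (ν * inner ℝ (M.gradL2 u) (M.gradL2 v) +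
        inner ℝ (M.divMulL2 u) (M.valueL2 v) + σ * inner ℝ (M.barL2 u) (M.barL2 v)) + M.formD u v := by
  rw [(M.exists_lift u).choose_spec.formDot_eq (M.exists_lift v).choose_spec, EvolvingSurface.formASigma,
    EvolvingSurface.formA, intervalIntegral.integral_of_le S.T_pos.le]
  have h1 : inner ℝ (M.matDerivL2 u) (M.valueL2 v) = _ := inner_toLp_real (M.memLp_two_matDeriv u) (M.memLp_two v)
  have h2 : inner ℝ (M.gradL2 u) (M.gradL2 v) = _ := inner_toLp (M.memLp_two_grad u) (M.memLp_two_grad v)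
  have h3 : inner ℝ (M.divMulL2 u) (M.valueL2 v) = _ := inner_toLp_real (M.memLp_two_divW_mul u) (M.memLp_two v)
  have h4 : inner ℝ (M.barL2 u) (M.barL2 v) = _ := inner_toLp_real (M.memLp_two_bar u) (M.memLp_two_bar v)
  rw [h1, h2, h3, h4]
  rfl

/-- The bilinear form of the discrete problem. -/
def form (ν σ : ℝ) : M.surfaceSubmodule →ₗ[ℝ] M.surfaceSubmodule →ₗ[ℝ] ℝ :=
  LinearMap.mk₂ ℝ (fun u v => M.formDot u v + S.formASigma ν σ u v + M.formD u v)
    (fun u u' v => by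
      simp only [M.form_eq_inner, map_add, inner_add_left]
      rw [Submodule.coe_add, (M.exists_lift u).choose_spec.formD_add_left (M.exists_lift u').choose_spec
        (M.exists_lift v).choose_spec]
      ring)
    (fun c u v => by
      simp only [M.form_eq_inner, map_smul, real_inner_smul_left, smul_eq_mul]
      rw [Submodule.coe_smul, (M.exists_lift u).choose_spec.formD_smul_left (M.exists_lift v).choose_spec]
      ring)
    (fun u v v' => by
      simp only [M.form_eq_inner, map_add, inner_add_right]
      rw [Submodule.coe_add, (M.exists_lift u).choose_spec.formD_add_right (M.exists_lift v).choose_spec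
        (M.exists_lift v').choose_spec]
      ring)
    (fun c u v => by
      simp only [M.form_eq_inner, map_smul, real_inner_smul_right, smul_eq_mul]
      rw [Submodule.coe_smul, (M.exists_lift u).choose_spec.formD_smul_right (M.exists_lift v).choose_spec]
      ring)

theorem form_apply (ν σ : ℝ) (u v : M.surfaceSubmodule) :
    M.form ν σ u v = M.formDot u v + S.formASigma ν σ u v + M.formD u v := rfl

theorem innerNode_self_nonneg (n : ℕ) (ψ : E3 → ℝ) : 0 ≤ M.innerNode n ψ ψ :=
  integral_nonneg fun _ => mul_self_nonneg _

theorem sup_traceLeft_nonneg (u : E3 × ℝ → ℝ) : 0 ≤ (Finset.Icc 1 M.N).sup' (Finset.nonempty_Icc.mpr M.N_pos)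
    (fun n => M.innerNode n (M.traceLeft u n) (M.traceLeft u n)) :=
  (M.innerNode_self_nonneg 1 _).trans
    (Finset.le_sup' (f := fun n => M.innerNode n (M.traceLeft u n) (M.traceLeft u n))
      (Finset.mem_Icc.mpr ⟨le_rfl, M.N_pos⟩))

theorem sum_jump_nonneg (u : E3 × ℝ → ℝ) (s : Finset ℕ) :
    0 ≤ ∑ n ∈ s, M.innerNode (n - 1) (M.jump u (n - 1)) (M.jump u (n - 1)) :=
  Finset.sum_nonneg fun _ _ => M.innerNode_self_nonneg _ _

theorem inner0_truncate_le (k : ℕ) {f : E3 × ℝ → ℝ} (hf : MemLp f 2 S.stMeasure) (hu : u ∈ M.surfaceSpace) :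
    S.inner0 f (M.truncate k u) ≤ S.norm0 f * S.norm0 u := by
  have h1 := M.memLp_two ⟨_, M.truncate_mem hu k⟩
  have h2 := M.memLp_two ⟨u, hu⟩
  refine (S.inner0_le hf h1).trans (mul_le_mul_of_nonneg_left (Real.sqrt_le_sqrt ?_) (Real.sqrt_nonneg _))
  refine integral_mono (h1.integrable_mul h1) (h2.integrable_mul h2) fun p => ?_
  simp only [SpaceTimeMesh.truncate, indicator_apply]
  split_ifs
  · exact le_rfl
  · simpa using mul_self_nonneg (u p)

/-- The stability estimate. -/
theorem normh_le {ν c₀ σ : ℝ} {cF : ℝ → ℝ} (hν : 0 < ν)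
    (hcF : ∀ t ∈ Icc 0 S.T, 0 < cF t ∧ IsFriedrichsConstant (S.Γ t) (cF t)) (hc₀ : 0 < c₀)
    (hdiv : ∀ t ∈ Icc 0 S.T, ∀ x ∈ S.Γ t, c₀ ≤ S.divW (x, t) + ν * cF t)
    (hσ : ∀ t ∈ Icc 0 S.T, ν / 2 * (cF t / surfaceArea (S.Γ t)) ≤ σ)
    {f : E3 × ℝ → ℝ} (hf : MemLp f 2 S.stMeasure) (hu : M.IsDiscreteSolution ν σ f u) :
    M.normh u ≤ (1 / 4 * min 1 (min ν c₀))⁻¹ * S.norm0 f := by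
  obtain ⟨huW, hsol⟩ := hu
  obtain ⟨H, hH⟩ := M.exists_isLift huW
  set m := min ν c₀ with hm
  have hm0 : 0 < m := lt_min hν hc₀
  have key : ∀ k ∈ Finset.Icc 1 M.N, _ := fun k hk =>
    (hH.energy hν hcF hdiv hσ (fun t ht => exists_lipschitzOnWith_slice huW ht) hk).trans
      ((hsol _ (M.truncate_mem huW k)).le.trans (M.inner0_truncate_le k hf huW))
  rw [← hm] at key
  set X := (Finset.Icc 1 M.N).sup' (Finset.nonempty_Icc.mpr M.N_pos)
        (fun n => M.innerNode n (M.traceLeft u n) (M.traceLeft u n)) with hX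
  set Y := ∑ n ∈ Finset.Icc 1 M.N, M.innerNode (n - 1) (M.jump u (n - 1)) (M.jump u (n - 1)) with hY
  set Z := S.normHSq u with hZ
  have hX0 : 0 ≤ X := M.sup_traceLeft_nonneg u
  have hY0 : 0 ≤ Y := M.sum_jump_nonneg u _
  have hZ0 : 0 ≤ Z := add_nonneg (S.inner0_self_nonneg u) (S.gradInner_self_nonneg u)
  -- `k = N` controls all jumps and the full `H`-norm; the `k` attaining the maximum controls the
  -- traces. The sum of both bounds half of all terms by twice `‖f‖₀ ‖u‖₀`, which explains the
  -- factor 1/4.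
  have hfin := key M.N (Finset.mem_Icc.mpr ⟨M.N_pos, le_rfl⟩)
  rw [M.node_N, ← S.integral_eq_setIntegral_slab, ← S.integral_eq_setIntegral_slab] at hfin
  have hZeq : ∫ p, u p * u p ∂S.stMeasure + ∫ p, ‖S.grad u p‖ ^ 2 ∂S.stMeasure = Z := by
    simp only [hZ, EvolvingSurface.normHSq, EvolvingSurface.inner0, EvolvingSurface.gradInner,
      real_inner_self_eq_norm_sq]
  rw [hZeq, ← hY] at hfin
  have h1 := M.innerNode_self_nonneg M.N (M.traceLeft u M.N)
  obtain ⟨k, hk, hXk⟩ := Finset.exists_mem_eq_sup' (Finset.nonempty_Icc.mpr M.N_pos)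
    (fun n => M.innerNode n (M.traceLeft u n) (M.traceLeft u n))
  have hkey := key k hk
  rw [← hXk, ← hX] at hkey
  have h2 := M.sum_jump_nonneg u (Finset.Icc 1 k)
  have h3 : 0 ≤ m * (∫ p in S.slab (Ioc 0 (M.node k)), u p * u p ∂S.stMeasure +
      ∫ p in S.slab (Ioc 0 (M.node k)), ‖S.grad u p‖ ^ 2 ∂S.stMeasure) :=
    mul_nonneg hm0.le (add_nonneg (integral_nonneg fun _ => mul_self_nonneg _)
      (integral_nonneg fun _ => sq_nonneg _))
  have hm1 : 0 < min 1 m := lt_min one_pos hm0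
  have h4 : min 1 m * X ≤ 1 * X := mul_le_mul_of_nonneg_right (min_le_left _ _) hX0
  have h5 : min 1 m * Y ≤ 1 * Y := mul_le_mul_of_nonneg_right (min_le_left _ _) hY0
  have h6 : min 1 m * Z ≤ m * Z := mul_le_mul_of_nonneg_right (min_le_right _ _) hZ0
  have hn : M.normh u = Real.sqrt (X + Y + Z) := rfl
  have hu0 : S.norm0 u ≤ M.normh u := by
    rw [hn]
    refine Real.sqrt_le_sqrt ?_
    have : S.inner0 u u ≤ Z := le_add_of_nonneg_right (S.gradInner_self_nonneg u)
    linarith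
  have hf0 : 0 ≤ S.norm0 f := Real.sqrt_nonneg _
  have hsq : M.normh u * M.normh u = X + Y + Z := by
    rw [hn]
    exact Real.mul_self_sqrt (by positivity)
  have h7 : S.norm0 f * S.norm0 u ≤ S.norm0 f * M.normh u := mul_le_mul_of_nonneg_left hu0 hf0
  have h8 : 1 / 4 * min 1 m * M.normh u * M.normh u ≤ S.norm0 f * M.normh u := by
    rw [mul_assoc, hsq]
    linarith
  rw [le_inv_mul_iff₀ (by positivity)]
  have hn0 : 0 ≤ M.normh u := Real.sqrt_nonneg _
  rcases hn0.eq_or_lt with h | h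
  · rw [← h, mul_zero]
    exact hf0
  · exact le_of_mul_le_mul_right h8 h

/-- Elements of the space are functions rather than classes. The lift is continuous on each slab and
neighbourhoods there have positive measure, so vanishing almost everywhere is vanishing everywhere;
off the manifold the extension is zero. -/
theorem eq_zero_of_inner0_self (hu : u ∈ M.surfaceSpace) (h : S.inner0 u u = 0) : u = 0 := by
  have h2 := M.memLp_two ⟨u, hu⟩
  have hae : ∀ᵐ p ∂S.baseMeasure, u (S.stFlow p) = 0 := by
    refine S.ae_baseMeasure (q := fun p => u p = 0) ?_
    filter_upwards [(integral_eq_zero_iff_of_nonneg (fun p => mul_self_nonneg (u p))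
      (h2.integrable_mul h2)).mp h] with p hp
    exact mul_self_eq_zero.mp hp
  obtain ⟨H, hH⟩ := M.exists_isLift hu
  funext p
  by_cases hp : p ∈ S.manifold
  · obtain ⟨y, t, ht, rfl⟩ := mem_manifold_iff.mp hp
    obtain ⟨n, hn, htn⟩ := M.exists_mem_interval ht
    rw [hH.eq n hn t htn y]
    by_contra hne
    have hO : {p : S.Γ₀ × ℝ | H n p.1 p.2 ≠ 0} ∈ 𝓝 (y, t) :=
      ((hH.lipschitz n hn).continuous.continuousAt (x := (y, t))).eventually_ne hne
    refine (S.baseMeasure_pos htn (M.node_nonneg _) (M.node_le (Finset.mem_Icc.mp hn).2) hO).ne' ?_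
    refine measure_mono_null ?_ hae
    rintro ⟨z, s⟩ ⟨h1, -, h3⟩ h4
    exact h1 ((hH.eq n hn s h3 z).symm.trans h4)
  · exact ((M.mem_surfaceSpace_iff).mp hu).1 p hp

end SpaceTimeMesh

namespace SpaceTimeMesh
variable {S : EvolvingSurface} (M : SpaceTimeMesh S)

theorem isDiscreteSolution_iff {ν σ : ℝ} {f : E3 × ℝ → ℝ} (hf : MemLp f 2 S.stMeasure) (u : M.surfaceSubmodule) :
    M.IsDiscreteSolution ν σ f u ↔
      M.form ν σ u = (innerₛₗ ℝ (hf.toLp f)).comp M.valueL2 := by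
  have h : ∀ v : M.surfaceSubmodule, inner ℝ (hf.toLp f) (M.valueL2 v) = S.inner0 f v := fun v =>
    inner_toLp_real hf (M.memLp_two v)
  constructor
  · rintro ⟨-, hsol⟩
    ext v
    rw [form_apply, hsol v v.2, ← h v]
    rfl
  · intro heq
    refine ⟨u.2, fun v hv => ?_⟩
    have := LinearMap.congr_fun heq ⟨v, hv⟩
    rw [form_apply] at this
    rw [this]
    exact h ⟨v, hv⟩

/-- The discrete problem has at most the trivial solution for the zero right-hand side. -/
theorem form_injective {ν c₀ σ : ℝ} {cF : ℝ → ℝ} (hν : 0 < ν)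
    (hcF : ∀ t ∈ Icc 0 S.T, 0 < cF t ∧ IsFriedrichsConstant (S.Γ t) (cF t)) (hc₀ : 0 < c₀)
    (hdiv : ∀ t ∈ Icc 0 S.T, ∀ x ∈ S.Γ t, c₀ ≤ S.divW (x, t) + ν * cF t)
    (hσ : ∀ t ∈ Icc 0 S.T, ν / 2 * (cF t / surfaceArea (S.Γ t)) ≤ σ) :
    Function.Injective (M.form ν σ) := by
  rw [← LinearMap.ker_eq_bot, LinearMap.ker_eq_bot']
  intro u hu
  have h0 : MemLp (0 : E3 × ℝ → ℝ) 2 S.stMeasure := MemLp.zero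
  have hsol : M.IsDiscreteSolution ν σ 0 u := by
    rw [M.isDiscreteSolution_iff h0, hu, MemLp.toLp_zero]
    simp
  have hle := M.normh_le hν hcF hc₀ hdiv hσ h0 hsol
  have hn : S.norm0 0 = 0 := by simp [EvolvingSurface.norm0, EvolvingSurface.inner0]
  rw [hn, mul_zero] at hle
  have hsq := Real.sqrt_eq_zero'.mp (le_antisymm hle (Real.sqrt_nonneg _))
  have h1 := M.sup_traceLeft_nonneg u
  have h2 := M.sum_jump_nonneg u (Finset.Icc 1 M.N)
  have h3 := S.inner0_self_nonneg u
  have h4 := S.gradInner_self_nonneg u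
  rw [EvolvingSurface.normHSq] at hsq
  exact Subtype.ext (M.eq_zero_of_inner0_self u.2 (by linarith))

end SpaceTimeMesh

end

theorem proposition4p3 (S : EvolvingSurface) (M : SpaceTimeMesh S)
    (ν : ℝ) (hν : 0 < ν)
    (cF : ℝ → ℝ) (hcF : ∀ t ∈ Icc 0 S.T, 0 < cF t ∧ IsFriedrichsConstant (S.Γ t) (cF t))
    (c₀ : ℝ) (hc₀ : 0 < c₀)
    (hdiv : ∀ t ∈ Icc 0 S.T, ∀ x ∈ S.Γ t, c₀ ≤ S.divW (x, t) + ν * cF t)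
    (σ : ℝ) (hσ : ∀ t ∈ Icc 0 S.T, ν / 2 * (cF t / surfaceArea (S.Γ t)) ≤ σ)
    (f : E3 × ℝ → ℝ) (hf : MemLp f 2 S.stMeasure) :
    (∃! u, M.IsDiscreteSolution ν σ f u) ∧
      ∀ u, M.IsDiscreteSolution ν σ f u →
        M.normh u ≤ (1 / 4 * min 1 (min ν c₀))⁻¹ * S.norm0 f := by
  refine ⟨?_, fun u hu => M.normh_le hν hcF hc₀ hdiv hσ hf hu⟩
  have hinj := M.form_injective hν hcF hc₀ hdiv hσ
  -- The form maps the finite-dimensional space into its dual, which has the same dimension, so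
  -- injectivity gives solvability for every right-hand side.
  have hsurj : Function.Surjective (M.form ν σ) :=
    (LinearMap.injective_iff_surjective_of_finrank_eq_finrank (Subspace.dual_finrank_eq).symm).mp hinj
  obtain ⟨u, hu⟩ := hsurj ((innerₛₗ ℝ (hf.toLp f)).comp M.valueL2)
  refine ⟨u, (M.isDiscreteSolution_iff hf u).mpr hu, fun v hv => ?_⟩
  have hv' := (M.isDiscreteSolution_iff hf ⟨v, hv.1⟩).mp hv
  exact congrArg Subtype.val (hinj (hv'.trans hu.symm))
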